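/- Let $\varepsilon, L>0$ and let $a(t)=\sum_{n\ge 1}a_{2n}t^{2n}$ be given by a power series that converges for $|t|<\varepsilon$. Consider the billiard table bounded by the walls $\gamma_0(t)=(a(t),t)$ and $\gamma_1(t)=(L-a(t),t)$, $|t|<\varepsilon$. Traverse both walls with the table on the right, let $s$ be the arc length along the wall with $s=0$ at $t=0$, and let $R(s)$ be the radius of curvature (the same for both walls, positive where the wall is curved towards the table). Write $R=R(0)$, $R''=R''(0)$, $R^{(4)}=R^{(4)}(0)$, and assume $0<L/R<2$. A point of the phase space on a wall has the coordinates $(s,u)$, $u=-\cos\vartheta$, where $\vartheta\in(0,\pi)$ is the angle from the unit tangent vector to the outgoing direction; the billiard map sends an outgoing ray to the reflected ray at the next impact. In these coordinates the billiard map near the point $P=(0,0)$ on $\gamma_0$ (with values near the point $(0,0)$ on $\gamma_1$) and the billiard map near the point $(0,0)$ on $\gamma_1$ (with values near $P$) are given by one and the same map $F$, defined near the origin of $\mathbb R^2$; the orbit of $P$ is the orbit of period $2$ along the segment from $\gamma_0(0)$ to $\gamma_1(0)$. Let $\lambda=\frac LR-1-i\sqrt{L\left(\frac2R-\frac L{R^2}\right)}$.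 For $N\ge1$, a Birkhoff normal form of order $N$ of $F$ at $P$ is given by a smooth symplectic (area- and orientation-preserving) local coordinate change $h$ with $h(0)=0$ and numbers $\theta,\tau_1,\dots,\tau_N$ such that $$h^{-1}Fh(x,y)=(x\cos\Theta-y\sin\Theta,\;x\sin\Theta+y\cos\Theta)+O(r^{2N+2}),\qquad \Theta=\theta+\tau_1r^2+\dots+\tau_Nr^{2N},\quad r^2=x^2+y^2.$$ The number $\tau_N$ is the $N$-th twist coefficient $\tau_N(F,P)$ if such a normal form exists and $e^{i\theta}=\lambda$ and $\tau_N$ are the same for all normal forms of order $N$. (i) If (A1) $\lambda^4\ne1$, then the first twist coefficient exists, and $$\tau_1(F,P)=\frac1{8R}-\frac{L}{8(2R-L)}R''.$$ (ii) If (A1) $\lambda^4\neq1$ and (A2) $\lambda^6\ne1$, then the second twist coefficient exists, and $$\tau_2(F,P)=\frac1{64}\Big(\frac{3(7R^2-8RL+2L^2)}{4R^2(R-L)\sqrt{(2R-L)L}}-\frac{\sqrt L\,(27R^2-40RL+10L^2)}{6R(R-L)(2R-L)^{3/2}}R''+\frac{L^{3/2}(31R^2-36RL+6L^2)}{12(R-L)(2R-L)^{5/2}}(R'')^2-\frac{L^{3/2}R}{3(2R-L)^{3/2}}R^{(4)}\Big).$$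 -/

import Mathlib

open Set Filter Topology
open scoped ContDiff

noncomputable section

namespace SymmetricBilliard

/-! ### The table `Q(L, a, a)`

It is bounded by the walls `γ₀(t) = (a t, t)` and `γ₁(t) = (L - a t, t)`, `|t| < ε`. Both walls are
traversed with the table on the right: `γ₀` in the direction of increasing `t`, `γ₁` in the
direction of decreasing `t`. The half turn about `(L / 2, 0)` then exchanges the walls and
preserves the arc-length parameters. -/

/-- The point `γⱼ(t)`. -/
def wall (a : ℝ → ℝ) (L : ℝ) (j : Fin 2) (t : ℝ) : ℝ × ℝ :=
  if j = 0 then (a t, t) else (L - a t, t)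

/-- The part of the boundary of the table that consists of the two walls. -/
def boundary (a : ℝ → ℝ) (L ε : ℝ) : Set (ℝ × ℝ) :=
  {q | ∃ j : Fin 2, ∃ t ∈ Ioo (-ε) ε, q = wall a L j t}

/-- The direction in which the wall `γⱼ` is traversed: up for `γ₀`, down for `γ₁`. -/
def orient (j : Fin 2) : ℝ := if j = 0 then 1 else -1

/-- The speed `|γⱼ'(t)|`. -/
def speed (a : ℝ → ℝ) (t : ℝ) : ℝ := √(1 + (deriv a t) ^ 2)

/-- The (signed) length of the wall between the parameters `0` and `t`. -/
def arcLength (a : ℝ → ℝ) (t : ℝ) : ℝ := ∫ x in (0 : ℝ)..t, speed a x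

/-- The inverse of `arcLength` on the parameter interval `(-ε, ε)`. -/
def arcParam (a : ℝ → ℝ) (ε s : ℝ) : ℝ := Function.invFunOn (arcLength a) (Ioo (-ε) ε) s

/-- The unit tangent vector of `γⱼ` at the parameter `t`, in the direction of traversal. -/
def tangent (a : ℝ → ℝ) (j : Fin 2) (t : ℝ) : ℝ × ℝ :=
  (deriv a t / speed a t, orient j / speed a t)

/-- The unit normal vector of `γⱼ` at the parameter `t` that points into the table: the tangent
vector turned clockwise by a right angle. -/
def normal (a : ℝ → ℝ) (j : Fin 2) (t : ℝ) : ℝ × ℝ :=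
  ((tangent a j t).2, -(tangent a j t).1)

/-- The radius of curvature of either wall as a function of the arc length `s`, positive where the
wall is curved towards the table. -/
def radius (a : ℝ → ℝ) (ε s : ℝ) : ℝ :=
  speed a (arcParam a ε s) ^ 3 / deriv (deriv a) (arcParam a ε s)

/-! ### The billiard map

A point `(j, s, u)` of the phase space consists of the wall `γⱼ`, the arc length `s` of the foot
point on that wall, and `u = -cos θ`, where `θ ∈ (0, π)` is the angle from the tangent vector to the
outgoing direction. -/

/-- The parameter `t` of the foot point of `(j, s, u)`. -/
def footParam (a : ℝ → ℝ) (ε : ℝ) (x : Fin 2 × ℝ × ℝ) : ℝ := arcParam a ε (orient x.1 * x.2.1)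

/-- The foot point of `(j, s, u)` on the boundary of the table. -/
def foot (a : ℝ → ℝ) (L ε : ℝ) (x : Fin 2 × ℝ × ℝ) : ℝ × ℝ := wall a L x.1 (footParam a ε x)

/-- The outgoing unit vector of `(j, s, u)`. -/
def outgoing (a : ℝ → ℝ) (ε : ℝ) (x : Fin 2 × ℝ × ℝ) : ℝ × ℝ :=
  (-x.2.2) • tangent a x.1 (footParam a ε x) + √(1 - x.2.2 ^ 2) • normal a x.1 (footParam a ε x)

/-- The coordinates `(j, s, u)` for which there is a foot point and an outgoing vector. -/
def phaseSpace (a : ℝ → ℝ) (ε : ℝ) : Set (Fin 2 × ℝ × ℝ) :=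
  {x | orient x.1 * x.2.1 ∈ arcLength a '' Ioo (-ε) ε ∧ |x.2.2| < 1}

/-- The Euclidean scalar product of the plane. -/
def dot (v w : ℝ × ℝ) : ℝ := v.1 * w.1 + v.2 * w.2

/-- The mirror reflection of the vector `v` in the line orthogonal to the unit vector `n`. -/
def reflect (n v : ℝ × ℝ) : ℝ × ℝ := v - (2 * dot v n) • n

/-- The light ray that leaves the boundary at `x` next hits the boundary at the foot point of `y`,
and `y` is its reflection there. -/
def BilliardStep (a : ℝ → ℝ) (L ε : ℝ) (x y : Fin 2 × ℝ × ℝ) : Prop :=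
  x ∈ phaseSpace a ε ∧ y ∈ phaseSpace a ε ∧
    ∃ l : ℝ, 0 < l ∧ foot a L ε y = foot a L ε x + l • outgoing a ε x ∧
      (∀ m ∈ Ioo 0 l, foot a L ε x + m • outgoing a ε x ∉ boundary a L ε) ∧
      outgoing a ε y = reflect (normal a y.1 (footParam a ε y)) (outgoing a ε x)

open Classical in
/-- The billiard map (with the value `x` where the ray has no reflection). -/
def billiardMap (a : ℝ → ℝ) (L ε : ℝ) (x : Fin 2 × ℝ × ℝ) : Fin 2 × ℝ × ℝ :=
  if h : ∃ y, BilliardStep a L ε x y then h.choose else x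

/-- The one-step billiard map in the coordinates `(s, u)`, from a neighbourhood of the periodic
point on `γ₀` to a neighbourhood of the periodic point on `γ₁`; the two neighbourhoods are
identified through the coordinates `(s, u)`. -/
def oneStep (a : ℝ → ℝ) (L ε : ℝ) (p : ℝ × ℝ) : ℝ × ℝ := (billiardMap a L ε (0, p)).2

/-- The eigenvalue `λ` of the linearization of the one-step map at the periodic point. -/
def eigenvalue (L R : ℝ) : ℂ :=
  ((L / R - 1 : ℝ) : ℂ) - Complex.I * ((√(L * (2 / R - L / R ^ 2)) : ℝ) : ℂ)

/-! ### Birkhoff normal form -/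

/-- The angle `Θ(r²) = θ + τ₁ r² + ⋯ + τ_N r^{2N}`, as a function of `ρ = r²`. -/
def angle (N : ℕ) (θ : ℝ) (τ : ℕ → ℝ) (ρ : ℝ) : ℝ := θ + ∑ k ∈ Finset.Icc 1 N, τ k * ρ ^ k

/-- The map `(x, y) ↦ (x cos Θ - y sin Θ, x sin Θ + y cos Θ)` with `Θ = Θ(x² + y²)`. -/
def twistMap (N : ℕ) (θ : ℝ) (τ : ℕ → ℝ) (p : ℝ × ℝ) : ℝ × ℝ :=
  (p.1 * Real.cos (angle N θ τ (p.1 ^ 2 + p.2 ^ 2)) -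
      p.2 * Real.sin (angle N θ τ (p.1 ^ 2 + p.2 ^ 2)),
    p.1 * Real.sin (angle N θ τ (p.1 ^ 2 + p.2 ^ 2)) +
      p.2 * Real.cos (angle N θ τ (p.1 ^ 2 + p.2 ^ 2)))

/-- `h` is a smooth symplectic coordinate change near the fixed origin that brings `f` into
Birkhoff normal form of order `N`, with coefficients `θ, τ 1, …, τ N`. (The inverse of `h` is
smooth too, because the Jacobian of `h` is `1`.) -/
structure IsBirkhoffNormalForm (f : ℝ × ℝ → ℝ × ℝ) (N : ℕ)
    (h : OpenPartialHomeomorph (ℝ × ℝ) (ℝ × ℝ)) (θ : ℝ) (τ : ℕ → ℝ) : Prop where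
  zero_mem : (0 : ℝ × ℝ) ∈ h.source
  map_zero : h 0 = 0
  smooth : ContDiffOn ℝ ∞ h h.source
  symplectic : ∀ p ∈ h.source, (fderiv ℝ h p).det = 1
  eventually_mem : ∀ᶠ p in 𝓝 (0 : ℝ × ℝ), f (h p) ∈ h.target
  normal_form : (fun p => h.symm (f (h p)) - twistMap N θ τ p)
    =O[𝓝 (0 : ℝ × ℝ)] (fun p => ‖p‖ ^ (2 * N + 2))

/-- `c` is the `k`-th twist coefficient of `f` at the fixed origin, where `lam` is the eigenvalue of
the linearization: a Birkhoff normal form of order `k` exists, with rotation angle an argument of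
`lam`, and its `k`-th coefficient is `c`, whatever symplectic coordinates are used to reach it. -/
def IsTwistCoefficient (f : ℝ × ℝ → ℝ × ℝ) (lam : ℂ) (k : ℕ) (c : ℝ) : Prop :=
  (∃ h θ τ, IsBirkhoffNormalForm f k h θ τ ∧ Complex.exp (θ * Complex.I) = lam) ∧
    ∀ h θ τ, IsBirkhoffNormalForm f k h θ τ → Complex.exp (θ * Complex.I) = lam ∧ τ k = c

end SymmetricBilliard

end

/-!
The coordinates `(t, w)`, where `t` is the parameter of the wall and `w = u |γ'(t)|` the conjugate
momentum, are symplectic, and in them the billiard map is generated by the length of chords: the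
half turn identifies the walls, and a chord with the parameters `t`, `σ` maps
`(t, momentum a L t σ)` to `(σ, -momentum a L σ t)` (`IsWall.eventually_billiardMap`). Near the axis
such a chord is a billiard step, since the distances from the walls are monotone along it. So a
normal form amounts to a pair of functions `X`, `W` on the plane of the normal form such that the
momentum of the chord from `X z` to `X (T z)` is `W z`, where `T` is the twist map, and such that
`(X, W)` is symplectic. If `X` is even and `W` odd in `y`, this half of the invariance implies the
other one, because `T` is reversed by `(x, y) ↦ (x, -y)` (`orderGE_momentum_reversed`).

*Existence.* `X` is a polynomial in `x`, `y` with unknown coefficients, and the condition that the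
momentum of the chord be odd in `y` determines the twist coefficients and the remaining coefficients
from those of the wall (`isOddJet_momentum_position`). Two free coefficients are used to make the
area form constant up to the order of the normal form. A last change of variables
`(x, y) ↦ (x, P (x, y))`, which is the identity to that order, makes the coordinates exactly
symplectic (`exists_symplectic_chart`, `IsWall.exists_normalForm`). The conditions `λ⁴ ≠ 1` and
`λ⁶ ≠ 1` say that `cos θ` and `4 cos² θ - 1` do not vanish, so that the equations for the amplitudes
of the third and fifth harmonics can be solved.

*Uniqueness.* The transition between two normal forms conjugates two twist maps up to the order of
the normal forms and preserves the area (`exists_conjugacy`). In the complex coordinate, comparison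
of the coefficients of its Taylor polynomial leaves, up to a rotation, the terms `z |z|^{2k}`
only, and those of `z |z|^{2k}` in the conjugacy relation compare the twist coefficients
(`coeff_eq_zero_of_conjugacy`). The second twist coefficient could still be changed by a
transition `z ↦ (1 + κ |z|²) z` with `κ` real, but for `κ ≠ 0` such a map changes the area of small
discs (`eq_zero_of_det_eq_one`).

Finally, the coefficients of the wall are expressed in terms of the radius of curvature
(`IsWall.radius_derivs`, `twistOne_eq`, `twistTwo_eq`).
-/

noncomputable section

namespace SymmetricBilliard

/-! ### Orders of vanishing and jets at the origin -/

/-- `f` vanishes to order `k` at the origin of the plane: `f z = O(‖z‖ ^ k)`. -/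
abbrev OrderGE {F : Type*} [NormedAddCommGroup F] (k : ℕ) (f : ℝ × ℝ → F) : Prop :=
  f =O[𝓝 (0 : ℝ × ℝ)] fun z => ‖z‖ ^ k

section Order

variable {F : Type*} [NormedAddCommGroup F] {𝕜 : Type*} [NormedField 𝕜]

theorem OrderGE.mono {j k : ℕ} {f : ℝ × ℝ → F} (hf : OrderGE k f) (h : j ≤ k) :
    OrderGE j f := by
  refine hf.trans (Asymptotics.IsBigO.of_bound 1 ?_)
  filter_upwards [Metric.ball_mem_nhds (0 : ℝ × ℝ) one_pos] with z hz
  rw [mem_ball_zero_iff] at hz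
  rw [norm_pow, norm_pow, norm_norm, one_mul]
  exact pow_le_pow_of_le_one (norm_nonneg _) hz.le h

theorem OrderGE.add {k : ℕ} {f g : ℝ × ℝ → F} (hf : OrderGE k f) (hg : OrderGE k g) :
    OrderGE k fun z => f z + g z :=
  Asymptotics.IsBigO.add hf hg

theorem OrderGE.sub {k : ℕ} {f g : ℝ × ℝ → F} (hf : OrderGE k f) (hg : OrderGE k g) :
    OrderGE k fun z => f z - g z :=
  Asymptotics.IsBigO.sub hf hg

theorem OrderGE.mul {j k : ℕ} {f g : ℝ × ℝ → 𝕜} (hf : OrderGE j f) (hg : OrderGE k g) :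
    OrderGE (j + k) fun z => f z * g z := by
  simpa only [OrderGE, pow_add] using Asymptotics.IsBigO.mul hf hg

theorem OrderGE.pow {j : ℕ} {f : ℝ × ℝ → 𝕜} (hf : OrderGE j f) (n : ℕ) :
    OrderGE (j * n) fun z => f z ^ n := by
  simpa only [OrderGE, pow_mul] using Asymptotics.IsBigO.pow hf n

theorem orderGE_const (c : F) : OrderGE 0 fun _ => c := by
  simpa [OrderGE] using Asymptotics.isBigO_const_const (l := 𝓝 (0 : ℝ × ℝ)) c (one_ne_zero (α := ℝ))

theorem orderGE_fst : OrderGE 1 (Prod.fst : ℝ × ℝ → ℝ) := by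
  simp only [OrderGE, pow_one]
  exact Asymptotics.IsBigO.of_bound 1 (Eventually.of_forall fun z => by
    simpa using norm_fst_le z)

theorem orderGE_snd : OrderGE 1 (Prod.snd : ℝ × ℝ → ℝ) := by
  simp only [OrderGE, pow_one]
  exact Asymptotics.IsBigO.of_bound 1 (Eventually.of_forall fun z => by
    simpa using norm_snd_le z)

theorem orderGE_zero (k : ℕ) : OrderGE k fun _ : ℝ × ℝ => (0 : F) :=
  Asymptotics.isBigO_zero _ _

theorem OrderGE.const_mul {k : ℕ} {f : ℝ × ℝ → 𝕜} (hf : OrderGE k f) (c : 𝕜) :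
    OrderGE k fun z => c * f z :=
  Asymptotics.IsBigO.const_mul_left hf c

theorem OrderGE.congr {k : ℕ} {f g : ℝ × ℝ → F} (hf : OrderGE k f) (h : ∀ z, f z = g z) :
    OrderGE k g := by
  rwa [show g = f from funext fun z => (h z).symm]

theorem OrderGE.tendsto {k : ℕ} {f : ℝ × ℝ → F} (hf : OrderGE (k + 1) f) :
    Tendsto f (𝓝 0) (𝓝 0) := by
  refine Asymptotics.IsBigO.trans_tendsto hf ?_
  have : ContinuousAt (fun z : ℝ × ℝ => ‖z‖ ^ (k + 1)) 0 := by fun_prop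
  simpa [ContinuousAt] using this

/-- Substitution of a map that vanishes to order one. -/
theorem OrderGE.comp {k : ℕ} {f : ℝ × ℝ → F} {g : ℝ × ℝ → ℝ × ℝ} (hf : OrderGE k f)
    (hg : OrderGE 1 g) : OrderGE k fun z => f (g z) := by
  refine (Asymptotics.IsBigO.comp_tendsto hf (OrderGE.tendsto (k := 0) hg)).trans ?_
  have := Asymptotics.IsBigO.pow (Asymptotics.IsBigO.norm_left hg) k
  simpa [Function.comp_def] using this

end Order

/-- The function `f` of the plane has the even jet `c + f₂ + f₄` modulo order six. -/
structure IsEvenJet (f : ℝ × ℝ → ℝ) (c : ℝ) (f₂ f₄ : ℝ × ℝ → ℝ) : Prop where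
  two : OrderGE 2 f₂
  four : OrderGE 4 f₄
  rem : OrderGE 6 fun z => f z - (c + f₂ z + f₄ z)

/-- The function `f` of the plane has the odd jet `f₁ + f₃ + f₅` modulo order six. -/
structure IsOddJet (f : ℝ × ℝ → ℝ) (f₁ f₃ f₅ : ℝ × ℝ → ℝ) : Prop where
  one : OrderGE 1 f₁
  three : OrderGE 3 f₃
  five : OrderGE 5 f₅
  rem : OrderGE 6 fun z => f z - (f₁ z + f₃ z + f₅ z)

section Jets

variable {f g f₁ f₂ f₃ f₄ f₅ g₁ g₂ g₃ g₄ g₅ : ℝ × ℝ → ℝ} {c d : ℝ}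

theorem IsEvenJet.orderGE_sub (hf : IsEvenJet f c f₂ f₄) : OrderGE 2 fun z => f z - c := by
  refine (((hf.rem.mono (by norm_num)).add hf.two).add
    (hf.four.mono (by norm_num))).congr fun z => ?_
  ring

theorem IsEvenJet.orderGE (hf : IsEvenJet f c f₂ f₄) : OrderGE 0 f := by
  refine ((hf.orderGE_sub.mono (by norm_num)).add (orderGE_const c)).congr fun z => ?_
  ring

theorem IsOddJet.orderGE (hf : IsOddJet f f₁ f₃ f₅) : OrderGE 1 f := by
  refine ((((hf.rem.mono (by norm_num)).add hf.one).add
    (hf.three.mono (by norm_num))).add (hf.five.mono (by norm_num))).congr fun z => ?_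
  ring

theorem IsEvenJet.congr (hf : IsEvenJet f c f₂ f₄) (hd : c = d) (h₂ : ∀ z, f₂ z = g₂ z)
    (h₄ : ∀ z, f₄ z = g₄ z) : IsEvenJet f d g₂ g₄ := by
  rw [show g₂ = f₂ from funext fun z => (h₂ z).symm,
    show g₄ = f₄ from funext fun z => (h₄ z).symm, ← hd]
  exact hf

theorem IsOddJet.congr (hf : IsOddJet f f₁ f₃ f₅) (h₁ : ∀ z, f₁ z = g₁ z)
    (h₃ : ∀ z, f₃ z = g₃ z) (h₅ : ∀ z, f₅ z = g₅ z) : IsOddJet f g₁ g₃ g₅ := by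
  rw [show g₁ = f₁ from funext fun z => (h₁ z).symm,
    show g₃ = f₃ from funext fun z => (h₃ z).symm,
    show g₅ = f₅ from funext fun z => (h₅ z).symm]
  exact hf

theorem IsEvenJet.congr_left (hf : IsEvenJet f c f₂ f₄) (h : f =ᶠ[𝓝 0] g) :
    IsEvenJet g c f₂ f₄ :=
  ⟨hf.two, hf.four, hf.rem.congr' (h.mono fun z hz => by simp only [hz]) EventuallyEq.rfl⟩

theorem IsOddJet.congr_left (hf : IsOddJet f f₁ f₃ f₅) (h : f =ᶠ[𝓝 0] g) :
    IsOddJet g f₁ f₃ f₅ :=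
  ⟨hf.one, hf.three, hf.five,
    hf.rem.congr' (h.mono fun z hz => by simp only [hz]) EventuallyEq.rfl⟩

theorem isEvenJet_const (c : ℝ) : IsEvenJet (fun _ => c) c (fun _ => 0) (fun _ => 0) :=
  ⟨orderGE_zero _, orderGE_zero _, (orderGE_zero 6).congr fun z => by ring⟩

theorem IsEvenJet.add (hf : IsEvenJet f c f₂ f₄) (hg : IsEvenJet g d g₂ g₄) :
    IsEvenJet (fun z => f z + g z) (c + d) (fun z => f₂ z + g₂ z) (fun z => f₄ z + g₄ z) :=
  ⟨hf.two.add hg.two, hf.four.add hg.four, (hf.rem.add hg.rem).congr fun z => by ring⟩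

theorem IsOddJet.add (hf : IsOddJet f f₁ f₃ f₅) (hg : IsOddJet g g₁ g₃ g₅) :
    IsOddJet (fun z => f z + g z) (fun z => f₁ z + g₁ z) (fun z => f₃ z + g₃ z)
      (fun z => f₅ z + g₅ z) :=
  ⟨hf.one.add hg.one, hf.three.add hg.three, hf.five.add hg.five,
    (hf.rem.add hg.rem).congr fun z => by ring⟩

theorem IsEvenJet.smul (hf : IsEvenJet f c f₂ f₄) (k : ℝ) :
    IsEvenJet (fun z => k * f z) (k * c) (fun z => k * f₂ z) (fun z => k * f₄ z) :=
  ⟨hf.two.const_mul k, hf.four.const_mul k, (hf.rem.const_mul k).congr fun z => by ring⟩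

theorem IsOddJet.smul (hf : IsOddJet f f₁ f₃ f₅) (k : ℝ) :
    IsOddJet (fun z => k * f z) (fun z => k * f₁ z) (fun z => k * f₃ z) (fun z => k * f₅ z) :=
  ⟨hf.one.const_mul k, hf.three.const_mul k, hf.five.const_mul k,
    (hf.rem.const_mul k).congr fun z => by ring⟩

theorem IsEvenJet.sub (hf : IsEvenJet f c f₂ f₄) (hg : IsEvenJet g d g₂ g₄) :
    IsEvenJet (fun z => f z - g z) (c - d) (fun z => f₂ z - g₂ z) (fun z => f₄ z - g₄ z) :=
  ⟨hf.two.sub hg.two, hf.four.sub hg.four, (hf.rem.sub hg.rem).congr fun z => by ring⟩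

theorem IsOddJet.sub (hf : IsOddJet f f₁ f₃ f₅) (hg : IsOddJet g g₁ g₃ g₅) :
    IsOddJet (fun z => f z - g z) (fun z => f₁ z - g₁ z) (fun z => f₃ z - g₃ z)
      (fun z => f₅ z - g₅ z) :=
  ⟨hf.one.sub hg.one, hf.three.sub hg.three, hf.five.sub hg.five,
    (hf.rem.sub hg.rem).congr fun z => by ring⟩

theorem IsEvenJet.mul (hf : IsEvenJet f c f₂ f₄) (hg : IsEvenJet g d g₂ g₄) :
    IsEvenJet (fun z => f z * g z) (c * d) (fun z => c * g₂ z + d * f₂ z)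
      (fun z => c * g₄ z + f₂ z * g₂ z + d * f₄ z) := by
  refine ⟨(hg.two.const_mul c).add (hf.two.const_mul d),
    ((hg.four.const_mul c).add (hf.two.mul hg.two)).add (hf.four.const_mul d), ?_⟩
  have h1 := (hf.rem.mul hg.orderGE).mono (show 6 ≤ 6 + 0 by norm_num)
  have h2 := hg.rem.const_mul c
  have h3 := (hf.two.mul hg.rem).mono (show 6 ≤ 2 + 6 by norm_num)
  have h4 := (hf.four.mul hg.rem).mono (show 6 ≤ 4 + 6 by norm_num)
  have h5 : OrderGE 6 _ := hf.two.mul hg.four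
  have h6 : OrderGE 6 _ := hf.four.mul hg.two
  have h7 := (hf.four.mul hg.four).mono (show 6 ≤ 4 + 4 by norm_num)
  exact ((((((h1.add h2).add h3).add h4).add h5).add h6).add h7).congr fun z => by ring

theorem IsEvenJet.mul_odd (hf : IsEvenJet f c f₂ f₄) (hg : IsOddJet g g₁ g₃ g₅) :
    IsOddJet (fun z => f z * g z) (fun z => c * g₁ z) (fun z => c * g₃ z + f₂ z * g₁ z)
      (fun z => c * g₅ z + f₂ z * g₃ z + f₄ z * g₁ z) := by
  refine ⟨hg.one.const_mul c, (hg.three.const_mul c).add (hf.two.mul hg.one),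
    ((hg.five.const_mul c).add (hf.two.mul hg.three)).add (hf.four.mul hg.one), ?_⟩
  have h1 := (hf.rem.mul hg.orderGE).mono (show 6 ≤ 6 + 1 by norm_num)
  have h2 := hg.rem.const_mul c
  have h3 := (hf.two.mul hg.rem).mono (show 6 ≤ 2 + 6 by norm_num)
  have h4 := (hf.four.mul hg.rem).mono (show 6 ≤ 4 + 6 by norm_num)
  have h5 := (hf.two.mul hg.five).mono (show 6 ≤ 2 + 5 by norm_num)
  have h6 := (hf.four.mul hg.three).mono (show 6 ≤ 4 + 3 by norm_num)
  have h7 := (hf.four.mul hg.five).mono (show 6 ≤ 4 + 5 by norm_num)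
  exact ((((((h1.add h2).add h3).add h4).add h5).add h6).add h7).congr fun z => by ring

theorem IsOddJet.mul (hf : IsOddJet f f₁ f₃ f₅) (hg : IsOddJet g g₁ g₃ g₅) :
    IsEvenJet (fun z => f z * g z) 0 (fun z => f₁ z * g₁ z)
      (fun z => f₁ z * g₃ z + f₃ z * g₁ z) := by
  refine ⟨hf.one.mul hg.one, (hf.one.mul hg.three).add (hf.three.mul hg.one), ?_⟩
  have h1 := (hf.rem.mul hg.orderGE).mono (show 6 ≤ 6 + 1 by norm_num)
  have h2 := (hf.one.mul hg.rem).mono (show 6 ≤ 1 + 6 by norm_num)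
  have h3 := (hf.three.mul hg.rem).mono (show 6 ≤ 3 + 6 by norm_num)
  have h4 := (hf.five.mul hg.rem).mono (show 6 ≤ 5 + 6 by norm_num)
  have h5 : OrderGE 6 _ := hf.one.mul hg.five
  have h6 : OrderGE 6 _ := hf.five.mul hg.one
  have h7 : OrderGE 6 _ := hf.three.mul hg.three
  have h8 := (hf.three.mul hg.five).mono (show 6 ≤ 3 + 5 by norm_num)
  have h9 := (hf.five.mul hg.three).mono (show 6 ≤ 5 + 3 by norm_num)
  have h10 := (hf.five.mul hg.five).mono (show 6 ≤ 5 + 5 by norm_num)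
  exact (((((((((h1.add h2).add h3).add h4).add h5).add h6).add h7).add h8).add h9).add
    h10).congr fun z => by ring

/-- Composition with a function of one variable whose Taylor expansion is known to order two. -/
theorem IsEvenJet.comp {φ : ℝ → ℝ} {a₀ a₁ a₂ : ℝ}
    (hφ : (fun u => φ u - (a₀ + a₁ * u + a₂ * u ^ 2)) =O[𝓝 0] fun u => u ^ 3)
    (hf : IsEvenJet f 0 f₂ f₄) :
    IsEvenJet (fun z => φ (f z)) a₀ (fun z => a₁ * f₂ z)
      (fun z => a₁ * f₄ z + a₂ * f₂ z ^ 2) := by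
  have hf2 : OrderGE 2 f := hf.orderGE_sub.congr fun z => by ring
  refine ⟨hf.two.const_mul _, (hf.four.const_mul _).add ((hf.two.pow 2).const_mul _), ?_⟩
  have h1 : OrderGE 6 fun z => φ (f z) - (a₀ + a₁ * f z + a₂ * f z ^ 2) := by
    refine (hφ.comp_tendsto (OrderGE.tendsto (k := 1) hf2)).trans ?_
    exact hf2.pow 3
  have h2 := hf.rem.const_mul a₁
  have h3 := (((hf.mul hf).rem).const_mul a₂)
  exact ((h1.add h2).add h3).congr fun z => by ring

end Jets

/-! ### Taylor expansions of elementary functions -/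

theorem inv_one_sub_expansion :
    (fun u : ℝ => (1 - u)⁻¹ - (1 + 1 * u + 1 * u ^ 2)) =O[𝓝 0] fun u => u ^ 3 := by
  have h : ∀ᶠ u : ℝ in 𝓝 0, u < 1 / 2 := eventually_lt_nhds (by norm_num)
  refine Asymptotics.IsBigO.of_bound 2 ?_
  filter_upwards [h] with u hu
  have h1 : (0 : ℝ) < 1 - u := by linarith
  have h2 : (1 - u)⁻¹ - (1 + 1 * u + 1 * u ^ 2) = (1 - u)⁻¹ * u ^ 3 := by
    field_simp
    ring
  rw [h2, norm_mul, norm_inv, Real.norm_of_nonneg h1.le]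
  gcongr
  rw [inv_le_comm₀ h1 (by norm_num)]
  linarith

theorem inv_sqrt_one_add_expansion :
    (fun u : ℝ => (√(1 + u))⁻¹ - (1 + (-1 / 2) * u + (3 / 8) * u ^ 2)) =O[𝓝 0]
      fun u => u ^ 3 := by
  have h : ∀ᶠ u : ℝ in 𝓝 0, |u| < 1 / 2 := by
    filter_upwards [Metric.ball_mem_nhds (0 : ℝ) (show (0 : ℝ) < 1 / 2 by norm_num)] with u hu
    simpa only [mem_ball_zero_iff, Real.norm_eq_abs] using hu
  refine Asymptotics.IsBigO.of_bound 10 ?_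
  filter_upwards [h] with u hu
  obtain ⟨hu1, hu2⟩ := abs_lt.1 hu
  have h1 : (0 : ℝ) < 1 + u := by linarith
  set v := √(1 + u) with hv
  have hv2 : v ^ 2 = 1 + u := Real.sq_sqrt h1.le
  have hv0 : 0 < v := Real.sqrt_pos.2 h1
  set P := 1 + (-1 / 2) * u + (3 / 8) * u ^ 2 with hP
  have hP0 : 1 / 2 < P := by
    rw [hP]
    nlinarith [sq_nonneg u]
  -- the square of the Taylor polynomial is the inverse of `1 + u` up to order three
  have key : v⁻¹ - P =
      (-(5 / 8 + -15 / 64 * u + 9 / 64 * u ^ 2) / ((1 + u) * (v⁻¹ + P))) * u ^ 3 := by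
    have h3 : v⁻¹ + P ≠ 0 := by positivity
    have h4 : v⁻¹ ^ 2 * (1 + u) = 1 := by rw [← hv2, inv_pow]; field_simp
    rw [div_mul_eq_mul_div, eq_div_iff (by positivity)]
    have : (v⁻¹ - P) * ((1 + u) * (v⁻¹ + P)) = v⁻¹ ^ 2 * (1 + u) - P ^ 2 * (1 + u) := by ring
    rw [this, h4, hP]
    ring
  rw [key, norm_mul]
  gcongr
  rw [norm_div, Real.norm_eq_abs, Real.norm_eq_abs, div_le_iff₀ (by positivity)]
  have h5 : |(1 + u) * (v⁻¹ + P)| ≥ 1 / 4 := by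
    rw [abs_of_pos (by positivity)]
    nlinarith [inv_pos.2 hv0]
  have h6 : |-(5 / 8 + -15 / 64 * u + 9 / 64 * u ^ 2)| ≤ 1 := by
    rw [abs_le]
    constructor <;> nlinarith [sq_nonneg u]
  linarith

theorem cos_expansion :
    (fun u : ℝ => Real.cos u - (1 + 0 * u + (-1 / 2) * u ^ 2)) =O[𝓝 0] fun u => u ^ 3 := by
  refine Asymptotics.IsBigO.of_bound 1 ?_
  filter_upwards [Metric.ball_mem_nhds (0 : ℝ) one_pos] with u hu
  rw [mem_ball_zero_iff, Real.norm_eq_abs] at hu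
  have h := Real.cos_bound hu.le
  rw [show 1 + 0 * u + (-1 / 2) * u ^ 2 = 1 - u ^ 2 / 2 by ring, Real.norm_eq_abs, norm_pow,
    Real.norm_eq_abs]
  have h1 : |u| ^ 4 ≤ |u| ^ 3 := pow_le_pow_of_le_one (abs_nonneg _) hu.le (by norm_num)
  nlinarith [pow_nonneg (abs_nonneg u) 3]

theorem sin_expansion :
    (fun u : ℝ => Real.sin u - (0 + 1 * u + 0 * u ^ 2)) =O[𝓝 0] fun u => u ^ 3 := by
  refine Asymptotics.IsBigO.of_bound 1 ?_
  filter_upwards [Metric.ball_mem_nhds (0 : ℝ) one_pos] with u hu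
  rw [mem_ball_zero_iff, Real.norm_eq_abs] at hu
  have h := abs_le.1 (Real.sin_bound hu.le)
  rw [Real.norm_eq_abs, norm_pow, Real.norm_eq_abs]
  have h1 : |u| ^ 5 ≤ |u| ^ 3 := pow_le_pow_of_le_one (abs_nonneg _) hu.le (by norm_num)
  have h2 : |u ^ 3| = |u| ^ 3 := abs_pow u 3
  have h3 := abs_le.1 h2.le
  rw [abs_le]
  constructor <;> nlinarith [pow_nonneg (abs_nonneg u) 3]

/-! ### The momentum of a chord -/

/-- For the chord from `γ₀(t)` to the point of `γ₁` at height `-σ`, the derivative of its length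
with respect to `t`. The sign of `σ` makes the orientations of the two walls agree. -/
def momentum (a : ℝ → ℝ) (L t σ : ℝ) : ℝ :=
  (t + σ - (L - a t - a σ) * deriv a t) / √((L - a t - a σ) ^ 2 + (t + σ) ^ 2)

/-- The jet of the momentum of the chord from `L X` to `L Z`, in terms of the scaled coefficients of
the wall. -/
theorem isOddJet_momentum {a φ ψ : ℝ → ℝ} {L k₀ k₁ k₂ : ℝ} (hL : 0 < L)
    (hφ : ∀ᶠ t in 𝓝 0, a t = φ (t ^ 2)) (hψ : ∀ᶠ t in 𝓝 0, deriv a t = ψ (t ^ 2) * t)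
    (hφ' : (fun u => φ u - (0 + k₀ * u + k₁ * u ^ 2)) =O[𝓝 0] fun u => u ^ 3)
    (hψ' : (fun u => ψ u - (2 * k₀ + 4 * k₁ * u + 6 * k₂ * u ^ 2)) =O[𝓝 0] fun u => u ^ 3)
    {c p e : ℝ} (hk₀ : k₀ * L = (1 + c) / 2) (hk₁ : k₁ * L ^ 3 = p) (hk₂ : k₂ * L ^ 5 = e)
    {X Z u₁ u₃ u₅ v₁ v₃ v₅ : ℝ × ℝ → ℝ} (hX : IsOddJet X u₁ u₃ u₅) (hZ : IsOddJet Z v₁ v₃ v₅) :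
    IsOddJet (fun z => momentum a L (L * X z) (L * Z z))
      (fun z => v₁ z - c * u₁ z)
      (fun z => v₃ z - c * u₃ z
        + ((u₁ z + v₁ z) * ((1 + c) / 2 * (u₁ z ^ 2 + v₁ z ^ 2)) - 4 * p * u₁ z ^ 3)
        - (u₁ z + v₁ z) ^ 2 * (v₁ z - c * u₁ z) / 2)
      (fun z => v₅ z - c * u₅ z
        + ((u₃ z + v₃ z) * ((1 + c) / 2 * (u₁ z ^ 2 + v₁ z ^ 2))
          + (u₁ z + v₁ z) * ((1 + c) * (u₁ z * u₃ z + v₁ z * v₃ z) + p * (u₁ z ^ 4 + v₁ z ^ 4)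
            + ((1 + c) / 2 * (u₁ z ^ 2 + v₁ z ^ 2)) ^ 2)
          - 12 * p * u₁ z ^ 2 * u₃ z - 6 * e * u₁ z ^ 5)
        - (u₁ z + v₁ z) ^ 2 / 2 * (v₃ z - c * u₃ z
          + ((u₁ z + v₁ z) * ((1 + c) / 2 * (u₁ z ^ 2 + v₁ z ^ 2)) - 4 * p * u₁ z ^ 3))
        + (3 / 8 * (u₁ z + v₁ z) ^ 4 - (u₁ z + v₁ z) * (u₃ z + v₃ z
          + (u₁ z + v₁ z) * ((1 + c) / 2 * (u₁ z ^ 2 + v₁ z ^ 2)))) * (v₁ z - c * u₁ z)) := by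
  have hL0 : L ≠ 0 := hL.ne'
  have tX : Tendsto (fun z => L * X z) (𝓝 0) (𝓝 0) :=
    OrderGE.tendsto (k := 0) (hX.orderGE.const_mul L)
  have tZ : Tendsto (fun z => L * Z z) (𝓝 0) (𝓝 0) :=
    OrderGE.tendsto (k := 0) (hZ.orderGE.const_mul L)
  have jX := (hX.smul L).mul (hX.smul L)
  have jZ := (hZ.smul L).mul (hZ.smul L)
  have jA := (((jX.comp hφ').add (jZ.comp hφ')).smul L⁻¹).congr (d := 0) (by ring)
    (fun z => rfl) (fun z => rfl)
  have jA' := (jX.comp hψ').mul_odd (hX.smul L)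
  have jq := (jA.comp inv_one_sub_expansion).mul_odd (hX.add hZ)
  have jr := ((jq.mul jq).comp inv_sqrt_one_add_expansion).mul_odd (jq.sub jA')
  have small : ∀ᶠ z : ℝ × ℝ in 𝓝 0,
      L⁻¹ * (φ (L * X z * (L * X z)) + φ (L * Z z * (L * Z z))) < 1 := by
    have := OrderGE.tendsto (k := 1) (jA.orderGE_sub.congr fun z => sub_zero _)
    exact this.eventually (eventually_lt_nhds one_pos)
  refine (jr.congr_left ?_).congr ?_ ?_ ?_
  · filter_upwards [tX.eventually hφ, tZ.eventually hφ, tX.eventually hψ, small] with z h1 h2 h3 h4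
    rw [momentum, h1, h2, h3]
    simp only [pow_two] at h4 ⊢
    set P := φ (L * X z * (L * X z))
    set Q := φ (L * Z z * (L * Z z))
    have h5 : 0 < 1 - L⁻¹ * (P + Q) := by linarith
    have h6 : L - P - Q = L * (1 - L⁻¹ * (P + Q)) := by field_simp; ring
    rw [h6]
    set D := 1 - L⁻¹ * (P + Q)
    have h7 : L * D * (L * D) + (L * X z + L * Z z) * (L * X z + L * Z z) =
        (L * D) ^ 2 * (1 + D⁻¹ * (X z + Z z) * (D⁻¹ * (X z + Z z))) := by
      field_simp
    rw [h7, Real.sqrt_mul (by positivity), Real.sqrt_sq (by positivity)]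
    have h8 : 0 < √(1 + D⁻¹ * (X z + Z z) * (D⁻¹ * (X z + Z z))) :=
      Real.sqrt_pos.2 (by nlinarith [mul_self_nonneg (D⁻¹ * (X z + Z z))])
    set E := √(1 + D⁻¹ * (X z + Z z) * (D⁻¹ * (X z + Z z)))
    field_simp
  · intro z
    have e0 : k₀ = (1 + c) / 2 / L := by rw [← hk₀]; field_simp
    simp only [e0]
    field_simp
    ring
  · intro z
    have e0 : k₀ = (1 + c) / 2 / L := by rw [← hk₀]; field_simp
    have e1 : k₁ = p / L ^ 3 := by rw [← hk₁]; field_simp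
    simp only [e0, e1]
    field_simp
    ring
  · intro z
    have e0 : k₀ = (1 + c) / 2 / L := by rw [← hk₀]; field_simp
    have e1 : k₁ = p / L ^ 3 := by rw [← hk₁]; field_simp
    have e2 : k₂ = e / L ^ 5 := by rw [← hk₂]; field_simp
    simp only [e0, e1, e2]
    field_simp
    ring

/-! ### Lindstedt series of the invariant curves

The position along the invariant curves is a function `X` of the normal form coordinates `(x, y)`,
even in `y`, and the momentum of the chord from `X(z)` to `X(T z)`, `T` the twist map, has to be odd
in `y`. This condition, taken degree by degree, determines the twist coefficients and the series; it
is linear in the unknowns of the top degree. The coefficients of the wall enter linearly as well, so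
one may prescribe instead the amplitudes `b`, `C` of the third and fifth harmonics of `X` and solve
for the coefficients of the wall: in terms of `b`, `C` and `c = cos θ` all coefficients are
polynomials. The unit of length is `L`, and `s = sin θ`. -/

/-- The scaled coefficient `a₄ L³` of the wall, in terms of the amplitude `b` of the third
harmonic. -/
def quarticParam (b c : ℝ) : ℝ :=
    4 * b * c ^ 3 + 1 / 2 * c ^ 4 + 1 / 2 * c ^ 3 - 4 * b * c - 1 / 4 * c ^ 2 + 1 / 4

/-- The scaled coefficient `a₆ L⁵` of the wall, in terms of the amplitudes `b`, `C` of the third and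
fifth harmonics. -/
def sexticParam (b C c : ℝ) : ℝ :=
    32 / 3 * b * c ^ 8 + 4 / 3 * c ^ 9 + 16 / 3 * b * c ^ 7 + 2 * c ^ 8 - 8 * b * c ^ 6 - c ^ 7
    + 128 / 3 * C * c ^ 5 + 8 / 3 * b * c ^ 5 - 2 * c ^ 6 - 16 / 3 * b * c ^ 4 - 32 * b ^ 2 * c
    ^ 3 + 1 / 3 * c ^ 5 - 160 / 3 * C * c ^ 3 - 28 / 3 * b * c ^ 3 + 5 / 6 * c ^ 4 + 4 * b * c ^
    2 + 32 * b ^ 2 * c + 1 / 4 * c ^ 3 + 32 / 3 * C * c + 4 / 3 * b * c + 1 / 12 * c ^ 2 - 4 / 3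
    * b + 1 / 12 * c + 1 / 12

/-- The first twist coefficient in the scaled variables, divided by `sin θ`. -/
def twistOne (b c : ℝ) : ℝ :=
    12 * b * c + 3 / 2 * c ^ 2 + c - 1 / 2

/-- The coefficient of `r² x` in the position, fixed by the condition that the area is preserved. -/
def amplOne (b c : ℝ) : ℝ :=
    -6 * b * c ^ 2 - 3 / 4 * c ^ 3 - 3 / 4 * c ^ 2

/-- The second twist coefficient in the scaled variables, divided by `sin θ`. -/
def twistTwo (b C c : ℝ) : ℝ :=
    40 * b * c ^ 6 + 5 * c ^ 7 + 20 * b * c ^ 5 + 15 / 2 * c ^ 6 - 44 * b * c ^ 4 - 216 * b ^ 2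
    * c ^ 3 - 17 / 8 * c ^ 5 + 160 * C * c ^ 3 - 30 * b * c ^ 3 - 15 / 2 * c ^ 4 - 25 * b * c ^
    2 - 108 * b ^ 2 * c - 7 / 2 * c ^ 3 - 40 * C * c - 14 * b * c - 1 / 4 * c ^ 2 + 5 * b + 5 /
    8 * c + 1 / 4

/-- The coefficient of `r² Re z³` in the position. -/
def thirdTwo (b C c : ℝ) : ℝ :=
    5 * b * c ^ 5 + 5 / 8 * c ^ 6 + 2 * b * c ^ 4 + 7 / 8 * c ^ 5 - 45 / 4 * b * c ^ 3 - 54 * b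
    ^ 2 * c ^ 2 - 5 / 8 * c ^ 4 + 20 * C * c ^ 2 - 25 / 4 * b * c ^ 2 - 9 / 8 * c ^ 3 + 2 * b *
    c - 5 * C + 1 / 4 * c

/-- The coefficient of `r⁴ x` in the position, fixed by the condition that the area is preserved. -/
def amplTwo (b C c : ℝ) : ℝ :=
    -20 * b * c ^ 7 - 5 / 2 * c ^ 8 - 10 * b * c ^ 6 - 15 / 4 * c ^ 7 + 53 / 2 * b * c ^ 5 + 126
    * b ^ 2 * c ^ 4 + 43 / 32 * c ^ 6 - 80 * C * c ^ 4 + 35 / 2 * b * c ^ 4 + 65 / 16 * c ^ 5 +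
    22 * b * c ^ 3 + 84 * b ^ 2 * c ^ 2 + 83 / 32 * c ^ 4 + 20 * C * c ^ 2 + 17 * b * c ^ 2 + 13
    / 8 * c ^ 3 - 4 * b * c + 3 / 2 * b ^ 2 - 1 / 2 * c

/-- The coefficient of `s x² y` in the momentum. -/
def momA (b c : ℝ) : ℝ :=
    -18 * b * c ^ 2 - 9 / 4 * c ^ 3 - 9 / 4 * c ^ 2 + 3 * b

/-- The coefficient of `s y³` in the momentum. -/
def momB (b c : ℝ) : ℝ :=
    -2 * b * c ^ 2 - 1 / 4 * c ^ 3 - 1 / 4 * c ^ 2 - b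

/-- The coefficient of `s x⁴ y` in the momentum. -/
def momC (b C c : ℝ) : ℝ :=
    -100 * b * c ^ 7 - 25 / 2 * c ^ 8 - 50 * b * c ^ 6 - 75 / 4 * c ^ 7 + 153 / 2 * b * c ^ 5 +
    306 * b ^ 2 * c ^ 4 + 153 / 32 * c ^ 6 - 400 * C * c ^ 4 + 33 / 2 * b * c ^ 4 + 233 / 16 * c
    ^ 5 + 269 / 4 * b * c ^ 3 + 258 * b ^ 2 * c ^ 2 + 153 / 32 * c ^ 4 + 200 * C * c ^ 2 + 269 /
    4 * b * c ^ 2 + 5 / 2 * c ^ 3 - 10 * b * c - 3 / 2 * b ^ 2 - 20 * C - 5 / 4 * c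

/-- The coefficient of `s x² y³` in the momentum. -/
def momD (b C c : ℝ) : ℝ :=
    -40 * b * c ^ 7 - 5 * c ^ 8 - 20 * b * c ^ 6 - 15 / 2 * c ^ 7 + 61 * b * c ^ 5 + 324 * b ^ 2
    * c ^ 4 + 41 / 16 * c ^ 6 - 160 * C * c ^ 4 + 49 * b * c ^ 4 + 69 / 8 * c ^ 5 + 139 / 2 * b
    * c ^ 3 + 300 * b ^ 2 * c ^ 2 + 121 / 16 * c ^ 4 + 99 / 2 * b * c ^ 2 + 11 / 2 * c ^ 3 - 12
    * b * c - 3 * b ^ 2 - 3 / 2 * c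

/-- The coefficient of `s y⁵` in the momentum. -/
def momE (b C c : ℝ) : ℝ :=
    -4 * b * c ^ 7 - 1 / 2 * c ^ 8 - 2 * b * c ^ 6 - 3 / 4 * c ^ 7 + 1 / 2 * b * c ^ 5 + 18 * b
    ^ 2 * c ^ 4 - 7 / 32 * c ^ 6 - 16 * C * c ^ 4 + 1 / 2 * b * c ^ 4 + 1 / 16 * c ^ 5 + 41 / 4
    * b * c ^ 3 + 42 * b ^ 2 * c ^ 2 + 25 / 32 * c ^ 4 - 8 * C * c ^ 2 + 25 / 4 * b * c ^ 2 + c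
    ^ 3 - 2 * b * c - 3 / 2 * b ^ 2 + 4 * C - 1 / 4 * c

/-- The position along the approximate invariant curves: in polar coordinates a sum of the
harmonics `cos φ`, `cos 3φ`, `cos 5φ`, whose coefficients are polynomials in the radius. -/
def position (α α₂ b B C : ℝ) (z : ℝ × ℝ) : ℝ :=
  z.1 * (1 + α * (z.1 ^ 2 + z.2 ^ 2) + α₂ * (z.1 ^ 2 + z.2 ^ 2) ^ 2)
    + (z.1 ^ 3 - 3 * z.1 * z.2 ^ 2) * (b + B * (z.1 ^ 2 + z.2 ^ 2))
    + C * (z.1 ^ 5 - 10 * z.1 ^ 3 * z.2 ^ 2 + 5 * z.1 * z.2 ^ 4)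

/-- The momentum along the approximate invariant curves, divided by `s = sin θ`: an odd polynomial
in the second variable. -/
def momentumSeries (w₁ w₂ w₃ w₄ w₅ : ℝ) (z : ℝ × ℝ) : ℝ :=
  z.2 * (-1 + w₁ * z.1 ^ 2 + w₂ * z.2 ^ 2 + w₃ * z.1 ^ 4 + w₄ * z.1 ^ 2 * z.2 ^ 2 + w₅ * z.2 ^ 4)

theorem isOddJet_fst : IsOddJet Prod.fst Prod.fst (fun _ => 0) (fun _ => 0) :=
  ⟨orderGE_fst, orderGE_zero _, orderGE_zero _, (orderGE_zero 6).congr fun z => by ring⟩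

theorem isOddJet_snd : IsOddJet Prod.snd Prod.snd (fun _ => 0) (fun _ => 0) :=
  ⟨orderGE_snd, orderGE_zero _, orderGE_zero _, (orderGE_zero 6).congr fun z => by ring⟩

/-- The polar radius squared, in terms of `x` and `V = y / s`. -/
theorem isEvenJet_radiusSq {c s : ℝ} (hs : s ^ 2 = 1 - c ^ 2) (hs0 : s ≠ 0) :
    IsEvenJet (fun z => z.1 ^ 2 + z.2 ^ 2) 0
      (fun z => z.1 ^ 2 + (1 - c ^ 2) * (z.2 / s) ^ 2) (fun _ => 0) := by
  refine (((isOddJet_fst.mul isOddJet_fst).add (isOddJet_snd.mul isOddJet_snd)).congr_left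
    (Eventually.of_forall fun z => ?_)).congr (by ring) (fun z => ?_) fun z => by ring
  · dsimp only
    ring
  · rw [← hs]
    field_simp

/-- The jet of the position at a point given by the jets of its first coordinate and of its second
coordinate divided by `s`. -/
theorem isOddJet_position (α α₂ b B C : ℝ) {c s : ℝ} (hs : s ^ 2 = 1 - c ^ 2)
    {X V X₁ X₃ X₅ V₁ V₃ V₅ ρ ρ₂ : ℝ × ℝ → ℝ} (hX : IsOddJet X X₁ X₃ X₅)
    (hV : IsOddJet V V₁ V₃ V₅) (hρ : IsEvenJet ρ 0 ρ₂ fun _ => 0)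
    (hXV : ∀ z, X z ^ 2 + (s * V z) ^ 2 = ρ z) :
    IsOddJet (fun z => position α α₂ b B C (X z, s * V z)) X₁
      (fun z => X₃ z + α * ρ₂ z * X₁ z + b * (X₁ z ^ 3 - 3 * (1 - c ^ 2) * X₁ z * V₁ z ^ 2))
      (fun z => X₅ z + α * ρ₂ z * X₃ z + α₂ * ρ₂ z ^ 2 * X₁ z
        + b * (3 * X₁ z ^ 2 * X₃ z
          - 3 * (1 - c ^ 2) * (X₃ z * V₁ z ^ 2 + 2 * X₁ z * V₁ z * V₃ z))
        + B * ρ₂ z * (X₁ z ^ 3 - 3 * (1 - c ^ 2) * X₁ z * V₁ z ^ 2)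
        + C * (X₁ z ^ 5 - 10 * (1 - c ^ 2) * X₁ z ^ 3 * V₁ z ^ 2
          + 5 * (1 - c ^ 2) ^ 2 * X₁ z * V₁ z ^ 4)) := by
  have jXX := hX.mul hX
  have jVV := hV.mul hV
  have jA := ((isEvenJet_const 1).add (hρ.smul α)).add ((hρ.mul hρ).smul α₂)
  have j3 := (jXX.sub (jVV.smul (3 * (1 - c ^ 2)))).mul_odd hX
  have jB := ((isEvenJet_const b).add (hρ.smul B)).mul_odd j3
  have j5 := ((((jXX.mul jXX).sub ((jXX.mul jVV).smul (10 * (1 - c ^ 2)))).add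
    ((jVV.mul jVV).smul (5 * (1 - c ^ 2) ^ 2))).mul_odd hX).smul C
  refine ((((jA.mul_odd hX).add jB).add j5).congr_left (Eventually.of_forall fun z => ?_)).congr
    (fun z => ?_) (fun z => ?_) fun z => ?_
  · simp only [position, hXV]
    rw [← hs]
    ring
  all_goals ring

/-- The jets of the coordinates of the twist map, the second one divided by `s`: this division
removes all odd powers of `s`. -/
theorem isOddJet_twistMap {c s θ t₁ t₂ : ℝ} (hc : Real.cos θ = c) (hsin : Real.sin θ = s)
    (hs : s ^ 2 = 1 - c ^ 2) (hs0 : s ≠ 0) {τ : ℕ → ℝ} (h₁ : τ 1 = s * t₁) (h₂ : τ 2 = s * t₂) :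
    IsOddJet (fun z => (twistMap 2 θ τ z).1)
      (fun z => c * z.1 - (1 - c ^ 2) * (z.2 / s))
      (fun z => -t₁ * (z.1 ^ 2 + (1 - c ^ 2) * (z.2 / s) ^ 2) * (1 - c ^ 2)
        * (z.1 + c * (z.2 / s)))
      (fun z => (1 - c ^ 2) * (z.1 ^ 2 + (1 - c ^ 2) * (z.2 / s) ^ 2) ^ 2
        * (-t₂ * (z.1 + c * (z.2 / s)) - t₁ ^ 2 / 2 * (c * z.1 - (1 - c ^ 2) * (z.2 / s)))) ∧
    IsOddJet (fun z => (twistMap 2 θ τ z).2 / s)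
      (fun z => z.1 + c * (z.2 / s))
      (fun z => t₁ * (z.1 ^ 2 + (1 - c ^ 2) * (z.2 / s) ^ 2)
        * (c * z.1 - (1 - c ^ 2) * (z.2 / s)))
      (fun z => (z.1 ^ 2 + (1 - c ^ 2) * (z.2 / s) ^ 2) ^ 2
        * (t₂ * (c * z.1 - (1 - c ^ 2) * (z.2 / s))
          - (1 - c ^ 2) * t₁ ^ 2 / 2 * (z.1 + c * (z.2 / s)))) := by
  have jρ := isEvenJet_radiusSq hs hs0
  have jψ := ((jρ.smul (s * t₁)).add ((jρ.mul jρ).smul (s * t₂))).congr (d := 0) (by ring)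
    (fun z => rfl) (fun z => rfl)
  have jcos := jψ.comp cos_expansion
  have jsin := jψ.comp sin_expansion
  have jC := (jcos.smul c).sub (jsin.smul s)
  have jS := (jcos.smul s).add (jsin.smul c)
  have hy : ∀ z : ℝ × ℝ, z.2 = s * (z.2 / s) := fun z => by field_simp
  have ha : ∀ z : ℝ × ℝ, angle 2 θ τ (z.1 ^ 2 + z.2 ^ 2) = θ + (s * t₁ * (z.1 ^ 2 + z.2 ^ 2)
      + s * t₂ * ((z.1 ^ 2 + z.2 ^ 2) * (z.1 ^ 2 + z.2 ^ 2))) := fun z => by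
    rw [angle, show Finset.Icc 1 2 = {1, 2} by decide, Finset.sum_pair (by norm_num), h₁, h₂]
    ring
  constructor
  · refine (((jC.mul_odd isOddJet_fst).sub (jS.mul_odd isOddJet_snd)).congr_left
      (Eventually.of_forall fun z => ?_)).congr (fun z => ?_) (fun z => ?_) fun z => ?_
    · simp only [twistMap, ha, Real.cos_add, Real.sin_add, hc, hsin]
      ring
    · linear_combination (-(z.2 / s)) * hs - s * hy z
    · generalize z.1 ^ 2 + (1 - c ^ 2) * (z.2 / s) ^ 2 = ρ
      linear_combination (-t₁ * ρ * (z.1 + c * (z.2 / s))) * hs - t₁ * ρ * c * s * hy z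
    · generalize z.1 ^ 2 + (1 - c ^ 2) * (z.2 / s) ^ 2 = ρ
      linear_combination (ρ ^ 2 * (-t₂ * (z.1 + c * (z.2 / s)) - t₁ ^ 2 / 2 * c * z.1
        + t₁ ^ 2 / 2 * (z.2 / s) * (s ^ 2 + 1 - c ^ 2))) * hs
        - ρ ^ 2 * (c * s * t₂ - s ^ 3 * t₁ ^ 2 / 2) * hy z
  · refine ((((jS.mul_odd isOddJet_fst).add (jC.mul_odd isOddJet_snd)).smul s⁻¹).congr_left
      (Eventually.of_forall fun z => ?_)).congr (fun z => ?_) (fun z => ?_) fun z => ?_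
    · simp only [twistMap, ha, Real.cos_add, Real.sin_add, hc, hsin]
      ring
    · field_simp
      ring
    · generalize z.1 ^ 2 + (1 - c ^ 2) * (z.2 / s) ^ 2 = ρ
      rw [← hs]
      field_simp
      ring
    · generalize z.1 ^ 2 + (1 - c ^ 2) * (z.2 / s) ^ 2 = ρ
      rw [← hs]
      field_simp
      ring

theorem twistMap_radiusSq (N : ℕ) (θ : ℝ) (τ : ℕ → ℝ) (z : ℝ × ℝ) :
    (twistMap N θ τ z).1 ^ 2 + (twistMap N θ τ z).2 ^ 2 = z.1 ^ 2 + z.2 ^ 2 := by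
  simp only [twistMap]
  linear_combination (z.1 ^ 2 + z.2 ^ 2) * Real.sin_sq_add_cos_sq (angle N θ τ (z.1 ^ 2 + z.2 ^ 2))

section Series

variable {a φ ψ : ℝ → ℝ} {L k₀ k₁ k₂ c s θ : ℝ} {τ : ℕ → ℝ}

/-- The momentum of the chord from `X(z)` to `X(T z)` modulo order six. With the coefficients above,
it is odd in `y` up to degree four for all values of the coefficients of degree five, and up to
degree five if these are chosen as above, too. -/
theorem isOddJet_momentum_position (hL : 0 < L)
    (hφ : ∀ᶠ t in 𝓝 0, a t = φ (t ^ 2)) (hψ : ∀ᶠ t in 𝓝 0, deriv a t = ψ (t ^ 2) * t)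
    (hφ' : (fun u => φ u - (0 + k₀ * u + k₁ * u ^ 2)) =O[𝓝 0] fun u => u ^ 3)
    (hψ' : (fun u => ψ u - (2 * k₀ + 4 * k₁ * u + 6 * k₂ * u ^ 2)) =O[𝓝 0] fun u => u ^ 3)
    (hk₀ : k₀ * L = (1 + c) / 2) {b : ℝ} (hk₁ : k₁ * L ^ 3 = quarticParam b c)
    (hc : Real.cos θ = c) (hsin : Real.sin θ = s) (hs : s ^ 2 = 1 - c ^ 2) (hs0 : s ≠ 0)
    {t₂ : ℝ} (h₁ : τ 1 = s * twistOne b c) (h₂ : τ 2 = s * t₂) (α₂ B C : ℝ) :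
    ∃ f₅ : ℝ × ℝ → ℝ, IsOddJet (fun z => momentum a L (L * position (amplOne b c) α₂ b B C z)
        (L * position (amplOne b c) α₂ b B C (twistMap 2 θ τ z)))
      (fun z => -(s * z.2))
      (fun z => s * z.2 * (momA b c * z.1 ^ 2 + momB b c * z.2 ^ 2)) f₅ ∧
      (t₂ = twistTwo b C c → α₂ = amplTwo b C c → B = thirdTwo b C c →
        k₂ * L ^ 5 = sexticParam b C c →
        ∀ z, f₅ z = s * z.2 * (momC b C c * z.1 ^ 4 + momD b C c * z.1 ^ 2 * z.2 ^ 2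
          + momE b C c * z.2 ^ 4)) := by
  have jρ := isEvenJet_radiusSq hs hs0
  obtain ⟨jT, jT'⟩ := isOddJet_twistMap hc hsin hs hs0 h₁ h₂
  have jV : IsOddJet (fun z : ℝ × ℝ => z.2 / s) (fun z => z.2 / s) (fun _ => 0) fun _ => 0 :=
    ((isOddJet_snd.smul s⁻¹).congr_left (Eventually.of_forall fun z => inv_mul_eq_div _ _)).congr
      (fun z => inv_mul_eq_div _ _) (fun z => mul_zero _) fun z => mul_zero _
  have hmul : ∀ y : ℝ, s * (y / s) = y := fun y => mul_div_cancel₀ y hs0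
  have jX := isOddJet_position (amplOne b c) α₂ b B C hs isOddJet_fst jV jρ
    (fun z => by rw [hmul])
  have jZ := isOddJet_position (amplOne b c) α₂ b B C hs jT jT' jρ
    (fun z => by rw [hmul, twistMap_radiusSq])
  simp only [hmul, Prod.mk.eta] at jX jZ
  have hy : ∀ z : ℝ × ℝ, s * z.2 = (1 - c ^ 2) * (z.2 / s) := fun z => by
    rw [← hs]
    field_simp
  have hy2 : ∀ z : ℝ × ℝ, z.2 ^ 2 = (1 - c ^ 2) * (z.2 / s) ^ 2 := fun z => by
    rw [← hs]
    field_simp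
  have hy4 : ∀ z : ℝ × ℝ, z.2 ^ 4 = ((1 - c ^ 2) * (z.2 / s) ^ 2) ^ 2 := fun z => by
    rw [← hy2]
    ring
  refine ⟨_, (isOddJet_momentum hL hφ hψ hφ' hψ' hk₀ hk₁ rfl jX jZ).congr (fun z => ?_)
    (fun z => ?_) (fun z => rfl), fun e₁ e₂ e₃ e₄ z => ?_⟩
  · rw [hy]
    ring
  · rw [hy, hy2]
    generalize z.2 / s = V
    simp only [quarticParam, amplOne, twistOne, momA, momB]
    ring
  · rw [hy, hy2, hy4, e₁, e₂, e₃, e₄]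
    generalize z.2 / s = V
    generalize z.1 = x
    simp only [quarticParam, amplOne, twistOne, momC, momD, momE, sexticParam, amplTwo, thirdTwo,
      twistTwo]
    ring

end Series

/-! ### The wall and its arc length -/

/-- The Taylor polynomial of `a` with a remainder `t⁸ E(t²)` that may be differentiated. -/
theorem exists_wall_expansion {ε : ℝ} (hε : 0 < ε) {coef : ℕ → ℝ} {a : ℝ → ℝ}
    (ha : ∀ t ∈ Ioo (-ε) ε, HasSum (fun n : ℕ => coef n * t ^ (2 * (n + 1))) (a t)) :
    ∃ E : ℝ → ℝ, ContDiffOn ℝ ∞ E (Ioo (-ε ^ 2) (ε ^ 2)) ∧ ∀ t ∈ Ioo (-ε) ε,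
      a t = coef 0 * t ^ 2 + coef 1 * t ^ 4 + coef 2 * t ^ 6 + t ^ 8 * E (t ^ 2) := by
  have htail : ∀ t ∈ Ioo (-ε) ε, HasSum (fun n : ℕ => coef (n + 3) * t ^ (2 * (n + 4)))
      (a t - (coef 0 * t ^ 2 + coef 1 * t ^ 4 + coef 2 * t ^ 6)) := by
    intro t ht
    have := (hasSum_nat_add_iff' 3).2 (ha t ht)
    simpa [Finset.sum_range_succ, add_assoc] using this
  set p : FormalMultilinearSeries ℝ ℝ ℝ :=
    FormalMultilinearSeries.ofScalars ℝ fun n => coef (n + 3) with hp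
  have hrad : ENNReal.ofReal (ε ^ 2) ≤ p.radius := by
    refine ENNReal.le_of_forall_nnreal_lt fun r hr => ?_
    have hr' : (r : ℝ) < ε ^ 2 := by
      rw [← ENNReal.ofReal_coe_nnreal] at hr
      exact (ENNReal.ofReal_lt_ofReal_iff (by positivity)).1 hr
    rcases eq_or_lt_of_le r.coe_nonneg with h0 | h0
    · have : r = 0 := NNReal.coe_injective h0.symm
      simp [this]
    have ht : √(r : ℝ) ∈ Ioo (-ε) ε := by
      have : √(r : ℝ) < ε := (Real.sqrt_lt' hε).2 hr'
      exact ⟨by linarith [Real.sqrt_nonneg (r : ℝ)], this⟩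
    have hb := (htail _ ht).summable.tendsto_atTop_zero
    have h1 : (fun n => coef (n + 3) * √(r : ℝ) ^ (2 * (n + 4))) =O[atTop] fun _ => (1 : ℝ) :=
      hb.isBigO_one ℝ
    refine p.le_radius_of_isBigO ?_
    have h2 := (h1.const_mul_left ((r : ℝ) ^ 4)⁻¹).norm_left
    refine h2.congr (fun n => ?_) fun _ => rfl
    rw [hp, FormalMultilinearSeries.ofScalars_norm, pow_mul, Real.sq_sqrt h0.le, pow_add, norm_mul,
      norm_mul, norm_mul, norm_inv, norm_pow, norm_pow, Real.norm_of_nonneg h0.le]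
    field_simp
  have hpos : 0 < p.radius := lt_of_lt_of_le (ENNReal.ofReal_pos.2 (by positivity)) hrad
  refine ⟨p.sum, ?_, fun t ht => ?_⟩
  · refine ((p.hasFPowerSeriesOnBall hpos).analyticOnNhd.contDiffOn_of_completeSpace).mono ?_
    intro u hu
    rw [Metric.mem_eball, edist_dist, Real.dist_eq, sub_zero]
    refine lt_of_lt_of_le ?_ hrad
    rw [ENNReal.ofReal_lt_ofReal_iff (by positivity)]
    exact abs_lt.2 ⟨by simpa using hu.1, hu.2⟩
  · have hu : t ^ 2 ∈ Metric.eball (0 : ℝ) p.radius := by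
      rw [Metric.mem_eball, edist_dist, Real.dist_eq, sub_zero]
      refine lt_of_lt_of_le ?_ hrad
      rw [ENNReal.ofReal_lt_ofReal_iff (by positivity), abs_of_nonneg (sq_nonneg t)]
      exact sq_lt_sq' ht.1 ht.2
    have h1 := (p.hasSum hu).mul_left (t ^ 8)
    have h2 : (fun n => t ^ 8 * (p n fun _ => t ^ 2)) =
        fun n => coef (n + 3) * t ^ (2 * (n + 4)) := by
      funext n
      rw [hp, FormalMultilinearSeries.ofScalars_apply_eq, smul_eq_mul]
      ring
    rw [h2] at h1
    have := h1.unique (htail t ht)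
    linarith

/-- An even smooth wall over `(-ε, ε)` through the origin, with its Taylor coefficients `k₀`, `k₁`,
`k₂` at `t²`, `t⁴`, `t⁶`; the expansions of `a`, `a'`, `a''` are stated in the variable `t²`. -/
structure IsWall (a : ℝ → ℝ) (ε k₀ k₁ k₂ : ℝ) : Prop where
  pos : 0 < ε
  smooth : ContDiffOn ℝ ∞ a (Ioo (-ε) ε)
  even : ∀ t ∈ Ioo (-ε) ε, a (-t) = a t
  expansion : ∃ φ ψ χ : ℝ → ℝ, (∀ᶠ t in 𝓝 0, a t = φ (t ^ 2)) ∧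
    (∀ᶠ t in 𝓝 0, deriv a t = ψ (t ^ 2) * t) ∧ (∀ᶠ t in 𝓝 0, deriv (deriv a) t = χ (t ^ 2)) ∧
    (fun u => φ u - (0 + k₀ * u + k₁ * u ^ 2)) =O[𝓝 0] (fun u => u ^ 3) ∧
    (fun u => ψ u - (2 * k₀ + 4 * k₁ * u + 6 * k₂ * u ^ 2)) =O[𝓝 0] (fun u => u ^ 3) ∧
    (fun u => χ u - (2 * k₀ + 12 * k₁ * u + 30 * k₂ * u ^ 2)) =O[𝓝 0] (fun u => u ^ 3)

theorem isWall_of_hasSum {ε : ℝ} (hε : 0 < ε) {coef : ℕ → ℝ} {a : ℝ → ℝ}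
    (ha : ∀ t ∈ Ioo (-ε) ε, HasSum (fun n : ℕ => coef n * t ^ (2 * (n + 1))) (a t)) :
    IsWall a ε (coef 0) (coef 1) (coef 2) := by
  obtain ⟨E, hE, haE⟩ := exists_wall_expansion hε ha
  have hmaps : ∀ t ∈ Ioo (-ε) ε, t ^ 2 ∈ Ioo (-ε ^ 2) (ε ^ 2) := fun t ht =>
    ⟨by nlinarith [sq_nonneg t, sq_pos_of_pos hε], sq_lt_sq' ht.1 ht.2⟩
  have hd : ∀ u ∈ Ioo (-ε ^ 2) (ε ^ 2), HasDerivAt E (deriv E u) u := fun u hu =>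
    ((hE.differentiableOn (by simp)).differentiableAt (isOpen_Ioo.mem_nhds hu)).hasDerivAt
  have hE' : ContDiffOn ℝ ∞ (deriv E) (Ioo (-ε ^ 2) (ε ^ 2)) :=
    ((contDiffOn_infty_iff_deriv_of_isOpen isOpen_Ioo).1 hE).2
  have hE'' : ContDiffOn ℝ ∞ (deriv (deriv E)) (Ioo (-ε ^ 2) (ε ^ 2)) :=
    ((contDiffOn_infty_iff_deriv_of_isOpen isOpen_Ioo).1 hE').2
  have hd' : ∀ u ∈ Ioo (-ε ^ 2) (ε ^ 2), HasDerivAt (deriv E) (deriv (deriv E) u) u := fun u hu =>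
    ((hE'.differentiableOn (by simp)).differentiableAt (isOpen_Ioo.mem_nhds hu)).hasDerivAt
  have hda : ∀ t ∈ Ioo (-ε) ε, deriv a t =
      (2 * coef 0 + 4 * coef 1 * t ^ 2 + 6 * coef 2 * (t ^ 2) ^ 2
        + (t ^ 2) ^ 3 * (8 * E (t ^ 2) + 2 * t ^ 2 * deriv E (t ^ 2))) * t := by
    intro t ht
    have h1 : HasDerivAt (fun t => E (t ^ 2)) _ t :=
      HasDerivAt.comp (h := fun x : ℝ => x ^ 2) (h₂ := E) t (hd _ (hmaps t ht))
        (hasDerivAt_pow 2 t)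
    have h2 := ((((hasDerivAt_pow 2 t).const_mul (coef 0)).add
      ((hasDerivAt_pow 4 t).const_mul (coef 1))).add ((hasDerivAt_pow 6 t).const_mul (coef 2))).add
      ((hasDerivAt_pow 8 t).mul h1)
    have h3 : a =ᶠ[𝓝 t] _ := Filter.mem_of_superset (isOpen_Ioo.mem_nhds ht) haE
    rw [(h2.congr_of_eventuallyEq h3).deriv]
    norm_num
    ring
  have hdda : ∀ t ∈ Ioo (-ε) ε, deriv (deriv a) t =
      2 * coef 0 + 12 * coef 1 * t ^ 2 + 30 * coef 2 * (t ^ 2) ^ 2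
        + (t ^ 2) ^ 3 * (56 * E (t ^ 2) + 34 * t ^ 2 * deriv E (t ^ 2)
          + 4 * (t ^ 2) ^ 2 * deriv (deriv E) (t ^ 2)) := by
    intro t ht
    have h1 : HasDerivAt (fun t => E (t ^ 2)) _ t :=
      HasDerivAt.comp (h := fun x : ℝ => x ^ 2) (h₂ := E) t (hd _ (hmaps t ht))
        (hasDerivAt_pow 2 t)
    have h1' : HasDerivAt (fun t => deriv E (t ^ 2)) _ t :=
      HasDerivAt.comp (h := fun x : ℝ => x ^ 2) (h₂ := deriv E) t (hd' _ (hmaps t ht))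
        (hasDerivAt_pow 2 t)
    have h2 := (((((hasDerivAt_id t).const_mul (2 * coef 0)).add
      ((hasDerivAt_pow 3 t).const_mul (4 * coef 1))).add
      ((hasDerivAt_pow 5 t).const_mul (6 * coef 2))).add
      (((hasDerivAt_pow 7 t).const_mul 8).mul h1)).add
      (((hasDerivAt_pow 9 t).const_mul 2).mul h1')
    have h3 : deriv a =ᶠ[𝓝 t] _ := Filter.mem_of_superset (isOpen_Ioo.mem_nhds ht) hda
    refine ((h2.congr_of_eventuallyEq ?_).deriv).trans ?_
    · filter_upwards [h3] with x hx
      rw [hx]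
      simp only [Pi.add_apply, Pi.mul_apply, id_eq]
      ring
    · norm_num
      ring
  have hev : ∀ᶠ t in 𝓝 (0 : ℝ), t ∈ Ioo (-ε) ε := Ioo_mem_nhds (by linarith) hε
  have h0 : (0 : ℝ) ∈ Ioo (-ε ^ 2) (ε ^ 2) := by simpa using hmaps 0 ⟨by linarith, hε⟩
  have big : ∀ {F : ℝ → ℝ}, ContinuousAt F 0 →
      (fun u => u ^ 3 * F u) =O[𝓝 0] fun u : ℝ => u ^ 3 := fun {F} hF => by
    simpa using (Asymptotics.isBigO_refl (fun u : ℝ => u ^ 3) (𝓝 0)).mul (hF.isBigO_one ℝ)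
  have hc : ContinuousAt E 0 := (hE.continuousOn).continuousAt (isOpen_Ioo.mem_nhds h0)
  have hc' : ContinuousAt (deriv E) 0 := (hE'.continuousOn).continuousAt (isOpen_Ioo.mem_nhds h0)
  have hc'' : ContinuousAt (deriv (deriv E)) 0 :=
    (hE''.continuousOn).continuousAt (isOpen_Ioo.mem_nhds h0)
  refine ⟨hε, ?_, fun t ht => ?_, fun u => coef 0 * u + coef 1 * u ^ 2 + u ^ 3 * (coef 2 + u * E u),
    fun u => 2 * coef 0 + 4 * coef 1 * u + 6 * coef 2 * u ^ 2
      + u ^ 3 * (8 * E u + 2 * u * deriv E u),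
    fun u => 2 * coef 0 + 12 * coef 1 * u + 30 * coef 2 * u ^ 2
      + u ^ 3 * (56 * E u + 34 * u * deriv E u + 4 * u ^ 2 * deriv (deriv E) u),
    ?_, ?_, ?_, ?_, ?_, ?_⟩
  · have h1 : ContDiffOn ℝ ∞ (fun t : ℝ => E (t ^ 2)) (Ioo (-ε) ε) :=
      hE.comp (by fun_prop) hmaps
    have h2 : ContDiffOn ℝ ∞ (fun t : ℝ => coef 0 * t ^ 2 + coef 1 * t ^ 4 + coef 2 * t ^ 6)
      (Ioo (-ε) ε) := by fun_prop
    have h3 : ContDiffOn ℝ ∞ (fun t : ℝ => t ^ 8) (Ioo (-ε) ε) := by fun_prop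
    exact (h2.add (h3.mul h1)).congr haE
  · rw [haE t ht, haE (-t) ⟨by linarith [ht.2], by linarith [ht.1]⟩]
    simp only [Even.neg_pow (by decide : Even 2), Even.neg_pow (by decide : Even 4),
      Even.neg_pow (by decide : Even 6), Even.neg_pow (by decide : Even 8)]
  · filter_upwards [hev] with t ht
    rw [haE t ht]
    ring
  · filter_upwards [hev] with t ht using hda t ht
  · filter_upwards [hev] with t ht using hdda t ht
  · refine (big (F := fun u => coef 2 + u * E u) (by fun_prop)).congr_left fun u => ?_
    ring
  · refine (big (F := fun u => 8 * E u + 2 * u * deriv E u) (by fun_prop)).congr_left fun u => ?_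
    ring
  · refine (big (F := fun u => 56 * E u + 34 * u * deriv E u + 4 * u ^ 2 * deriv (deriv E) u)
      (by fun_prop)).congr_left fun u => ?_
    ring

theorem eq_of_isBigO_cube {φ : ℝ → ℝ} {c₀ c₁ c₂ : ℝ}
    (h : (fun u => φ u - (c₀ + c₁ * u + c₂ * u ^ 2)) =O[𝓝 0] fun u => u ^ 3) : φ 0 = c₀ := by
  obtain ⟨C, hC⟩ := h.bound
  have := hC.self_of_nhds
  simp only [mul_zero, add_zero, ne_eq, OfNat.ofNat_ne_zero, not_false_eq_true, zero_pow, norm_zero,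
    norm_le_zero_iff] at this
  linarith

namespace IsWall

variable {a : ℝ → ℝ} {ε k₀ k₁ k₂ : ℝ}

theorem zero_mem (ha : IsWall a ε k₀ k₁ k₂) : (0 : ℝ) ∈ Ioo (-ε) ε :=
  ⟨by linarith [ha.pos], ha.pos⟩

theorem neg_mem {t : ℝ} (ht : t ∈ Ioo (-ε) ε) : -t ∈ Ioo (-ε) ε :=
  ⟨by linarith [ht.2], by linarith [ht.1]⟩

theorem nhds_zero (ha : IsWall a ε k₀ k₁ k₂) : ∀ᶠ t in 𝓝 (0 : ℝ), t ∈ Ioo (-ε) ε :=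
  isOpen_Ioo.mem_nhds ha.zero_mem

theorem apply_zero (ha : IsWall a ε k₀ k₁ k₂) : a 0 = 0 := by
  obtain ⟨φ, ψ, χ, h1, h2, h3, h4, h5, h6⟩ := ha.expansion
  have h := h1.self_of_nhds
  rwa [zero_pow two_ne_zero, eq_of_isBigO_cube h4] at h

theorem smooth_deriv (ha : IsWall a ε k₀ k₁ k₂) : ContDiffOn ℝ ∞ (deriv a) (Ioo (-ε) ε) :=
  ((contDiffOn_infty_iff_deriv_of_isOpen isOpen_Ioo).1 ha.smooth).2

theorem hasDerivAt (ha : IsWall a ε k₀ k₁ k₂) {t : ℝ} (ht : t ∈ Ioo (-ε) ε) :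
    HasDerivAt a (deriv a t) t :=
  ((ha.smooth.differentiableOn (by simp)).differentiableAt (isOpen_Ioo.mem_nhds ht)).hasDerivAt

theorem deriv_neg (ha : IsWall a ε k₀ k₁ k₂) {t : ℝ} (ht : t ∈ Ioo (-ε) ε) :
    deriv a (-t) = -deriv a t := by
  have h1 : (fun x => a (-x)) =ᶠ[𝓝 t] a :=
    Filter.mem_of_superset (isOpen_Ioo.mem_nhds ht) ha.even
  have h2 := h1.deriv_eq
  rw [deriv_comp_neg] at h2
  linarith

theorem deriv_zero (ha : IsWall a ε k₀ k₁ k₂) : deriv a 0 = 0 := by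
  have := ha.deriv_neg ha.zero_mem
  rw [neg_zero] at this
  linarith

theorem deriv_deriv_zero (ha : IsWall a ε k₀ k₁ k₂) : deriv (deriv a) 0 = 2 * k₀ := by
  obtain ⟨φ, ψ, χ, h1, h2, h3, h4, h5, h6⟩ := ha.expansion
  rw [h3.self_of_nhds, ← eq_of_isBigO_cube h6]
  norm_num

end IsWall

theorem one_le_speed (a : ℝ → ℝ) (t : ℝ) : 1 ≤ speed a t := by
  rw [speed, Real.one_le_sqrt]
  nlinarith [sq_nonneg (deriv a t)]

theorem speed_pos (a : ℝ → ℝ) (t : ℝ) : 0 < speed a t := one_pos.trans_le (one_le_speed a t)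

theorem speed_sq (a : ℝ → ℝ) (t : ℝ) : speed a t ^ 2 = 1 + deriv a t ^ 2 :=
  Real.sq_sqrt (by positivity)

namespace IsWall

variable {a : ℝ → ℝ} {ε k₀ k₁ k₂ : ℝ}

theorem speed_neg (ha : IsWall a ε k₀ k₁ k₂) {t : ℝ} (ht : t ∈ Ioo (-ε) ε) :
    speed a (-t) = speed a t := by
  rw [speed, speed, ha.deriv_neg ht, neg_sq]

theorem smooth_speed (ha : IsWall a ε k₀ k₁ k₂) : ContDiffOn ℝ ∞ (speed a) (Ioo (-ε) ε) := by
  have h := ha.smooth_deriv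
  refine ContDiffOn.sqrt (by fun_prop) fun t _ => ?_
  positivity

theorem intervalIntegrable_speed (ha : IsWall a ε k₀ k₁ k₂) {t t' : ℝ} (ht : t ∈ Ioo (-ε) ε)
    (ht' : t' ∈ Ioo (-ε) ε) : IntervalIntegrable (speed a) MeasureTheory.volume t t' :=
  (ha.smooth_speed.continuousOn.mono (ordConnected_Ioo.uIcc_subset ht ht')).intervalIntegrable

theorem hasDerivAt_arcLength (ha : IsWall a ε k₀ k₁ k₂) {t : ℝ} (ht : t ∈ Ioo (-ε) ε) :
    HasDerivAt (arcLength a) (speed a t) t := by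
  refine intervalIntegral.integral_hasDerivAt_right (ha.intervalIntegrable_speed ha.zero_mem ht) ?_
    (ha.smooth_speed.continuousOn.continuousAt (isOpen_Ioo.mem_nhds ht))
  exact ha.smooth_speed.continuousOn.stronglyMeasurableAtFilter isOpen_Ioo t ht

theorem smooth_arcLength (ha : IsWall a ε k₀ k₁ k₂) :
    ContDiffOn ℝ ∞ (arcLength a) (Ioo (-ε) ε) := by
  rw [contDiffOn_infty_iff_deriv_of_isOpen isOpen_Ioo]
  exact ⟨fun t ht => (ha.hasDerivAt_arcLength ht).differentiableAt.differentiableWithinAt,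
    ha.smooth_speed.congr fun t ht => (ha.hasDerivAt_arcLength ht).deriv⟩

theorem strictMonoOn_arcLength (ha : IsWall a ε k₀ k₁ k₂) :
    StrictMonoOn (arcLength a) (Ioo (-ε) ε) := by
  refine strictMonoOn_of_deriv_pos (convex_Ioo _ _) ha.smooth_arcLength.continuousOn fun t ht => ?_
  rw [interior_Ioo] at ht
  rw [(ha.hasDerivAt_arcLength ht).deriv]
  exact speed_pos a t

theorem arcParam_arcLength (ha : IsWall a ε k₀ k₁ k₂) {t : ℝ} (ht : t ∈ Ioo (-ε) ε) :
    arcParam a ε (arcLength a t) = t :=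
  ha.strictMonoOn_arcLength.injOn.leftInvOn_invFunOn ht

theorem arcLength_neg (ha : IsWall a ε k₀ k₁ k₂) {t : ℝ} (ht : t ∈ Ioo (-ε) ε) :
    arcLength a (-t) = -arcLength a t := by
  have h : ∫ x in (0 : ℝ)..t, speed a (-x) = ∫ x in (0 : ℝ)..t, speed a x := by
    refine intervalIntegral.integral_congr fun x hx => ha.speed_neg ?_
    exact ordConnected_Ioo.uIcc_subset ha.zero_mem ht hx
  rw [intervalIntegral.integral_comp_neg, neg_zero, intervalIntegral.integral_symm] at h
  rw [arcLength, arcLength, ← h, neg_neg]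

end IsWall

theorem arcLength_zero (a : ℝ → ℝ) : arcLength a 0 = 0 :=
  intervalIntegral.integral_same

/-! ### The billiard map in terms of chords -/

/-- The change from the symplectic coordinates `(t, w)`, where `w = u |γ'(t)|` is the momentum
conjugate to the parameter `t`, to the coordinates `(s, u)`. -/
def phaseCoord (a : ℝ → ℝ) (q : ℝ × ℝ) : ℝ × ℝ := (arcLength a q.1, q.2 / speed a q.1)

theorem orient_sq (j : Fin 2) : orient j * orient j = 1 := by
  unfold orient
  split_ifs <;> norm_num

theorem orient_one_sub (j : Fin 2) : orient (1 - j) = -orient j := by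
  fin_cases j <;> simp [orient]

theorem dot_outgoing_tangent (a : ℝ → ℝ) (ε : ℝ) (x : Fin 2 × ℝ × ℝ) :
    dot (outgoing a ε x) (tangent a x.1 (footParam a ε x)) = -x.2.2 := by
  obtain ⟨j, s, u⟩ := x
  set t := footParam a ε (j, s, u) with ht
  have h0 := (speed_pos a t).ne'
  have h2 := speed_sq a t
  have h3 := orient_sq j
  simp only [outgoing, ← ht, dot, tangent, normal, Prod.fst_add, Prod.snd_add, Prod.smul_fst,
    Prod.smul_snd, smul_eq_mul]
  field_simp
  linear_combination (-u) * h3 + u * h2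

/-- A phase point is determined by its foot parameter and its outgoing vector. -/
theorem eq_of_outgoing_eq {a : ℝ → ℝ} {ε : ℝ} {j : Fin 2} {p q : ℝ × ℝ}
    (hp : (j, p) ∈ phaseSpace a ε) (hq : (j, q) ∈ phaseSpace a ε)
    (hf : footParam a ε (j, p) = footParam a ε (j, q))
    (ho : outgoing a ε (j, p) = outgoing a ε (j, q)) : p = q := by
  have h1 := dot_outgoing_tangent a ε (j, p)
  have h2 := dot_outgoing_tangent a ε (j, q)
  rw [ho, hf] at h1
  dsimp only at h1 h2
  have h3 : orient j * p.1 = orient j * q.1 := by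
    have e1 := Function.invFunOn_eq hp.1
    have e2 := Function.invFunOn_eq hq.1
    rw [← e1, ← e2]
    exact congrArg (arcLength a) hf
  have h4 := orient_sq j
  ext
  · linear_combination orient j * h3 - (p.1 - q.1) * h4
  · linarith

namespace IsWall

variable {a : ℝ → ℝ} {ε k₀ k₁ k₂ : ℝ}

theorem orient_mul_mem {t : ℝ} (ht : t ∈ Ioo (-ε) ε) (j : Fin 2) :
    orient j * t ∈ Ioo (-ε) ε := by
  unfold orient
  split_ifs
  · simpa using ht
  · simpa using neg_mem ht

theorem arcLength_orient (ha : IsWall a ε k₀ k₁ k₂) {t : ℝ} (ht : t ∈ Ioo (-ε) ε) (j : Fin 2) :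
    arcLength a (orient j * t) = orient j * arcLength a t := by
  unfold orient
  split_ifs
  · simp
  · simpa using ha.arcLength_neg ht

theorem deriv_orient (ha : IsWall a ε k₀ k₁ k₂) {t : ℝ} (ht : t ∈ Ioo (-ε) ε) (j : Fin 2) :
    deriv a (orient j * t) = orient j * deriv a t := by
  unfold orient
  split_ifs
  · simp
  · simpa using ha.deriv_neg ht

theorem speed_orient (ha : IsWall a ε k₀ k₁ k₂) {t : ℝ} (ht : t ∈ Ioo (-ε) ε) (j : Fin 2) :
    speed a (orient j * t) = speed a t := by
  unfold orient
  split_ifs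
  · simp
  · simpa using ha.speed_neg ht

theorem footParam_phaseCoord (ha : IsWall a ε k₀ k₁ k₂) {t : ℝ} (ht : t ∈ Ioo (-ε) ε) (j : Fin 2)
    (w : ℝ) : footParam a ε (j, phaseCoord a (t, w)) = orient j * t := by
  rw [footParam]
  simp only [phaseCoord]
  rw [← ha.arcLength_orient ht, ha.arcParam_arcLength (orient_mul_mem ht j)]

theorem mem_phaseSpace (ha : IsWall a ε k₀ k₁ k₂) {t : ℝ} (ht : t ∈ Ioo (-ε) ε) (j : Fin 2)
    {w : ℝ} (hw : |w| < speed a t) : (j, phaseCoord a (t, w)) ∈ phaseSpace a ε := by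
  refine ⟨⟨orient j * t, orient_mul_mem ht j, ha.arcLength_orient ht j⟩, ?_⟩
  simp only [phaseCoord]
  rwa [abs_div, abs_of_pos (speed_pos a t), div_lt_one (speed_pos a t)]

/-- The outgoing vector with the momentum `w` is the unit vector with tangential part `-w` that
points into the table. -/
theorem outgoing_phaseCoord (ha : IsWall a ε k₀ k₁ k₂) {t : ℝ} (ht : t ∈ Ioo (-ε) ε) (j : Fin 2)
    {v : ℝ × ℝ} (hv : v.1 ^ 2 + v.2 ^ 2 = 1) (hn : 0 < v.1 - v.2 * deriv a t) :
    (j, phaseCoord a (t, -(v.1 * deriv a t + v.2))) ∈ phaseSpace a ε ∧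
      outgoing a ε (j, phaseCoord a (t, -(v.1 * deriv a t + v.2))) = orient j • v := by
  have h0 := speed_pos a t
  have h2 := speed_sq a t
  have key : speed a t ^ 2 = (v.1 * deriv a t + v.2) ^ 2 + (v.1 - v.2 * deriv a t) ^ 2 := by
    rw [h2]
    linear_combination (-(1 + deriv a t ^ 2)) * hv
  have hw : |-(v.1 * deriv a t + v.2)| < speed a t := by
    refine abs_lt_of_sq_lt_sq ?_ h0.le
    rw [key]
    nlinarith [pow_pos hn 2]
  refine ⟨ha.mem_phaseSpace ht j hw, ?_⟩
  have hsq : √(1 - (-(v.1 * deriv a t + v.2) / speed a t) ^ 2) =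
      (v.1 - v.2 * deriv a t) / speed a t := by
    rw [show 1 - (-(v.1 * deriv a t + v.2) / speed a t) ^ 2 =
      ((v.1 - v.2 * deriv a t) / speed a t) ^ 2 by
        field_simp
        linear_combination key]
    exact Real.sqrt_sq (by positivity)
  have hf := ha.footParam_phaseCoord ht j (-(v.1 * deriv a t + v.2))
  rw [outgoing]
  simp only [hf]
  simp only [phaseCoord, hsq, normal, tangent, ha.deriv_orient ht, ha.speed_orient ht]
  ext
  · simp only [Prod.fst_add, Prod.smul_fst, smul_eq_mul]
    field_simp
    linear_combination (-(orient j * v.1)) * h2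
  · simp only [Prod.snd_add, Prod.smul_snd, smul_eq_mul]
    field_simp
    linear_combination (-(orient j * v.2)) * h2

/-! The half turn about `(L / 2, 0)` is a symmetry of the billiard. -/

theorem footParam_flip (ha : IsWall a ε k₀ k₁ k₂) {x : Fin 2 × ℝ × ℝ} (hx : x ∈ phaseSpace a ε) :
    footParam a ε (1 - x.1, x.2) = -footParam a ε x ∧ footParam a ε x ∈ Ioo (-ε) ε := by
  obtain ⟨t, ht, h⟩ := hx.1
  have h1 : footParam a ε x = t := by rw [footParam, ← h, ha.arcParam_arcLength ht]
  rw [h1]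
  refine ⟨?_, ht⟩
  rw [footParam]
  dsimp only
  rw [orient_one_sub, neg_mul, ← h, ← ha.arcLength_neg ht, ha.arcParam_arcLength (neg_mem ht)]

theorem mem_phaseSpace_flip (ha : IsWall a ε k₀ k₁ k₂) {x : Fin 2 × ℝ × ℝ}
    (hx : x ∈ phaseSpace a ε) : (1 - x.1, x.2) ∈ phaseSpace a ε := by
  obtain ⟨t, ht, h⟩ := hx.1
  refine ⟨⟨-t, neg_mem ht, ?_⟩, hx.2⟩
  dsimp only
  rw [ha.arcLength_neg ht, h, orient_one_sub, neg_mul]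

theorem wall_flip (ha : IsWall a ε k₀ k₁ k₂) (L : ℝ) (j : Fin 2) {t : ℝ} (ht : t ∈ Ioo (-ε) ε) :
    wall a L (1 - j) (-t) = (L, 0) - wall a L j t := by
  fin_cases j <;> simp [wall, ha.even t ht]

theorem tangent_flip (ha : IsWall a ε k₀ k₁ k₂) (j : Fin 2) {t : ℝ} (ht : t ∈ Ioo (-ε) ε) :
    tangent a (1 - j) (-t) = -tangent a j t := by
  rw [tangent, tangent, ha.deriv_neg ht, ha.speed_neg ht, orient_one_sub]
  ext <;> simp [neg_div]

theorem boundary_flip (ha : IsWall a ε k₀ k₁ k₂) (L : ℝ) {q : ℝ × ℝ}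
    (hq : (L, 0) - q ∈ boundary a L ε) : q ∈ boundary a L ε := by
  obtain ⟨j, t, ht, h⟩ := hq
  refine ⟨1 - j, -t, neg_mem ht, ?_⟩
  rw [ha.wall_flip L j ht, ← h, sub_sub_cancel]

theorem outgoing_flip (ha : IsWall a ε k₀ k₁ k₂) {x : Fin 2 × ℝ × ℝ} (hx : x ∈ phaseSpace a ε) :
    outgoing a ε (1 - x.1, x.2) = -outgoing a ε x := by
  obtain ⟨h1, h2⟩ := ha.footParam_flip hx
  simp only [outgoing, h1, normal, ha.tangent_flip x.1 h2]
  ext <;> simp [add_comm]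

theorem billiardStep_flip (ha : IsWall a ε k₀ k₁ k₂) {L : ℝ} {x y : Fin 2 × ℝ × ℝ}
    (h : BilliardStep a L ε x y) : BilliardStep a L ε (1 - x.1, x.2) (1 - y.1, y.2) := by
  obtain ⟨hx, hy, l, hl, h1, h2, h3⟩ := h
  obtain ⟨fx, fx'⟩ := ha.footParam_flip hx
  obtain ⟨fy, fy'⟩ := ha.footParam_flip hy
  have hfx : foot a L ε (1 - x.1, x.2) = (L, 0) - foot a L ε x := by
    rw [foot, foot, fx]
    exact ha.wall_flip L x.1 fx'
  have hfy : foot a L ε (1 - y.1, y.2) = (L, 0) - foot a L ε y := by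
    rw [foot, foot, fy]
    exact ha.wall_flip L y.1 fy'
  refine ⟨ha.mem_phaseSpace_flip hx, ha.mem_phaseSpace_flip hy, l, hl, ?_, fun m hm hb => ?_, ?_⟩
  · rw [hfx, hfy, ha.outgoing_flip hx, h1, smul_neg]
    abel
  · refine h2 m hm (ha.boundary_flip L ?_)
    rw [hfx, ha.outgoing_flip hx, smul_neg] at hb
    rwa [show (L, 0) - (foot a L ε x + m • outgoing a ε x) =
      (L, 0) - foot a L ε x + -(m • outgoing a ε x) by abel]
  · rw [ha.outgoing_flip hx, ha.outgoing_flip hy, h3, fy]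
    simp only [reflect, dot, normal, ha.tangent_flip y.1 fy']
    ext <;> simp <;> ring

/-- The bounds that hold near the origin. -/
theorem exists_bounds (ha : IsWall a ε k₀ k₁ k₂) {L : ℝ} (hL : 0 < L) :
    ∃ δ, 0 < δ ∧ δ ≤ L / 4 ∧ Ioo (-δ) δ ⊆ Ioo (-ε) ε ∧ (∀ t ∈ Ioo (-δ) δ, |a t| < L / 4) ∧
      ∀ t ∈ Ioo (-δ) δ, |deriv a t| < 1 / 2 := by
  have h1 : ∀ᶠ t in 𝓝 (0 : ℝ), |a t| < L / 4 := by
    have : ContinuousAt a 0 := (ha.hasDerivAt ha.zero_mem).continuousAt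
    have := this.abs
    rw [ContinuousAt, ha.apply_zero, abs_zero] at this
    exact this.eventually (eventually_lt_nhds (by positivity))
  have h2 : ∀ᶠ t in 𝓝 (0 : ℝ), |deriv a t| < 1 / 2 := by
    have := (ha.smooth_deriv.continuousOn.continuousAt (isOpen_Ioo.mem_nhds ha.zero_mem)).abs
    rw [ContinuousAt, ha.deriv_zero, abs_zero] at this
    exact this.eventually (eventually_lt_nhds (by positivity))
  obtain ⟨δ, hδ, h⟩ := Metric.eventually_nhds_iff_ball.1 (h1.and (h2.and ha.nhds_zero))
  have hsub : Ioo (-min δ (L / 4)) (min δ (L / 4)) ⊆ Metric.ball 0 δ := fun t ht => by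
    rw [mem_ball_zero_iff, Real.norm_eq_abs, abs_lt]
    exact ⟨by linarith [ht.1, min_le_left δ (L / 4)], ht.2.trans_le (min_le_left _ _)⟩
  exact ⟨min δ (L / 4), lt_min hδ (by positivity), min_le_right _ _,
    fun t ht => (h t (hsub ht)).2.2, fun t ht => (h t (hsub ht)).1,
    fun t ht => (h t (hsub ht)).2.1⟩

/-- A chord between the two walls that is short in the second direction is a billiard step, and it
is the only step from its initial point: along a ray close to the axis the distances from the walls
are strictly monotone. -/
theorem billiardStep_chord (ha : IsWall a ε k₀ k₁ k₂) {L δ : ℝ}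
    (hδL : δ ≤ L / 4) (hδε : Ioo (-δ) δ ⊆ Ioo (-ε) ε) (hb : ∀ t ∈ Ioo (-δ) δ, |a t| < L / 4)
    (hb' : ∀ t ∈ Ioo (-δ) δ, |deriv a t| < 1 / 2) {t σ : ℝ} (ht : t ∈ Ioo (-δ) δ)
    (hσ : σ ∈ Ioo (-δ) δ) :
    BilliardStep a L ε (0, phaseCoord a (t, momentum a L t σ))
      (1, phaseCoord a (σ, -momentum a L σ t)) ∧
    ∀ y, BilliardStep a L ε (0, phaseCoord a (t, momentum a L t σ)) y →
      y = (1, phaseCoord a (σ, -momentum a L σ t)) := by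
  have hδ : 0 < δ := by linarith [ht.1, ht.2]
  set D := L - a t - a σ with hD
  set S := t + σ with hS
  set ℓ := √(D ^ 2 + S ^ 2) with hℓ
  have hD0 : L / 2 < D := by
    have := abs_lt.1 (hb t ht)
    have := abs_lt.1 (hb σ hσ)
    rw [hD]
    linarith
  have hSD : |S| < D := by
    rw [abs_lt, hS]
    constructor <;> linarith [ht.1, ht.2, hσ.1, hσ.2]
  have hDpos : 0 < D := by linarith
  have hℓ0 : 0 < ℓ := Real.sqrt_pos.2 (by positivity)
  have hℓ2 : ℓ ^ 2 = D ^ 2 + S ^ 2 := Real.sq_sqrt (by positivity)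
  have hneg : ∀ x, x ∈ Ioo (-δ) δ → -x ∈ Ioo (-δ) δ := fun x hx =>
    ⟨by linarith [hx.2], by linarith [hx.1]⟩
  have hn : ∀ x, x ∈ Ioo (-δ) δ → 0 < D + S * deriv a x := fun x hx => by
    have h1 : |S * deriv a x| ≤ D * (1 / 2) := by
      rw [abs_mul]
      exact mul_le_mul hSD.le (hb' x hx).le (abs_nonneg _) hDpos.le
    linarith [(abs_le.1 h1).1]
  have lip : ∀ x ∈ Ioo (-δ) δ, ∀ y ∈ Ioo (-δ) δ, |a y - a x| ≤ 1 / 2 * |y - x| :=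
    fun x hx y hy => (convex_Ioo (-δ) δ).norm_image_sub_le_of_norm_deriv_le
      (fun z hz => (ha.hasDerivAt (hδε hz)).differentiableAt) (fun z hz => (hb' z hz).le) hx hy
  -- the direction of the chord, and its reflection
  set e : ℝ × ℝ := (D / ℓ, -S / ℓ) with he
  have he1 : e.1 ^ 2 + e.2 ^ 2 = 1 := by
    simp only [he, div_pow, neg_sq]
    rw [← add_div, ← hℓ2, div_self (by positivity)]
  set n := (D + S * deriv a σ) / (ℓ * speed a σ ^ 2) with hn'
  set v : ℝ × ℝ := (-e.1 + 2 * n, -e.2 - 2 * n * deriv a σ) with hv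
  have hsp := speed_sq a σ
  have hsp0 := speed_pos a σ
  have hne : n * speed a σ ^ 2 = e.1 - e.2 * deriv a σ := by
    rw [hn', he]
    field_simp
    ring
  have hv1 : v.1 ^ 2 + v.2 ^ 2 = 1 := by
    simp only [hv]
    linear_combination he1 + 4 * n * hne - 4 * n ^ 2 * hsp
  have hvn : 0 < v.1 - v.2 * deriv a σ := by
    have h1 : v.1 - v.2 * deriv a σ = e.1 - e.2 * deriv a σ := by
      simp only [hv]
      linear_combination 2 * hne - 2 * n * hsp
    rw [h1, he]
    have := hn σ hσ
    have h2 : D / ℓ - -S / ℓ * deriv a σ = (D + S * deriv a σ) / ℓ := by ring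
    rw [h2]
    positivity
  have hen : 0 < e.1 - e.2 * deriv a t := by
    have := hn t ht
    have h2 : e.1 - e.2 * deriv a t = (D + S * deriv a t) / ℓ := by
      rw [he]
      ring
    rw [h2]
    positivity
  have hm1 : momentum a L t σ = -(e.1 * deriv a t + e.2) := by
    rw [momentum, ← hD, ← hS, ← hℓ, he]
    ring
  have hm2 : -momentum a L σ t = -(v.1 * deriv a σ + v.2) := by
    rw [momentum, show L - a σ - a t = D by rw [hD]; ring, show σ + t = S by rw [hS]; ring, ← hℓ,
      hv,
      he]
    ring
  obtain ⟨hx, hox⟩ := ha.outgoing_phaseCoord (hδε ht) 0 he1 hen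
  obtain ⟨hy, hoy⟩ := ha.outgoing_phaseCoord (hδε hσ) 1 hv1 hvn
  rw [← hm1] at hx hox
  rw [← hm2] at hy hoy
  have ox : outgoing a ε (0, phaseCoord a (t, momentum a L t σ)) = e := by
    rw [hox]
    simp [orient]
  have oy : outgoing a ε (1, phaseCoord a (σ, -momentum a L σ t)) = -v := by
    rw [hoy]
    simp [orient]
  have px : footParam a ε (0, phaseCoord a (t, momentum a L t σ)) = t := by
    rw [ha.footParam_phaseCoord (hδε ht)]
    simp [orient]
  have py : footParam a ε (1, phaseCoord a (σ, -momentum a L σ t)) = -σ := by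
    rw [ha.footParam_phaseCoord (hδε hσ)]
    simp [orient]
  have fx : foot a L ε (0, phaseCoord a (t, momentum a L t σ)) = (a t, t) := by
    rw [foot, px]
    simp [wall]
  have fy : foot a L ε (1, phaseCoord a (σ, -momentum a L σ t)) = (L - a σ, -σ) := by
    rw [foot, py]
    simp [wall, ha.even σ (hδε hσ)]
  have hfoot : foot a L ε (1, phaseCoord a (σ, -momentum a L σ t)) =
      foot a L ε (0, phaseCoord a (t, momentum a L t σ)) +
        ℓ • outgoing a ε (0, phaseCoord a (t, momentum a L t σ)) := by
    rw [fx, fy, ox, he]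
    ext
    · simp only [Prod.fst_add, Prod.smul_fst, smul_eq_mul]
      field_simp
      rw [hD]
      ring
    · simp only [Prod.snd_add, Prod.smul_snd, smul_eq_mul]
      field_simp
      rw [hS]
      ring
  have hrefl : -v = reflect (normal a 1 (-σ)) e := by
    have hd : deriv a (-σ) = -deriv a σ := ha.deriv_neg (hδε hσ)
    have hs' : speed a (-σ) = speed a σ := ha.speed_neg (hδε hσ)
    simp only [reflect, dot, normal, tangent, hd, hs', orient, hv]
    have h1 : e.1 - e.2 * deriv a σ = n * speed a σ ^ 2 := hne.symm
    ext
    · simp only [Prod.fst_sub, Prod.smul_fst, Prod.fst_neg, smul_eq_mul]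
      norm_num
      field_simp
      linear_combination 2 * h1
    · simp only [Prod.snd_sub, Prod.smul_snd, Prod.snd_neg, smul_eq_mul]
      norm_num
      field_simp
      linear_combination (-2 * deriv a σ) * h1
  -- the open chord does not meet the walls
  have hfree : ∀ m ∈ Ioo 0 ℓ, foot a L ε (0, phaseCoord a (t, momentum a L t σ)) +
      m • outgoing a ε (0, phaseCoord a (t, momentum a L t σ)) ∉ boundary a L ε := by
    rintro m ⟨hm0, hmℓ⟩ ⟨j, x, hx, h⟩
    rw [fx, ox, he] at h
    set y := t + m * (-S / ℓ) with hy
    have hyσ : y + σ = (ℓ - m) * (S / ℓ) := by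
      rw [hy]
      field_simp
      rw [hS]
      ring
    have hyδ : y ∈ Ioo (-δ) δ := by
      have h1 : y = (1 - m / ℓ) • t + (m / ℓ) • (-σ) := by
        rw [hy, hS]
        simp only [smul_eq_mul]
        ring
      rw [h1]
      refine convex_Ioo (-δ) δ ht (hneg σ hσ) ?_ (by positivity) (by ring)
      rw [sub_nonneg, div_le_one hℓ0]
      exact hmℓ.le
    have hr : |S / ℓ| < D / ℓ := by
      rw [abs_div, abs_of_pos hℓ0]
      exact div_lt_div_of_pos_right hSD hℓ0
    have hDℓ : 0 < D / ℓ := by positivity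
    have h1 : |a y - a t| ≤ m * (D / ℓ) * (1 / 2) := by
      refine (lip t ht y hyδ).trans ?_
      have : y - t = -(m * (S / ℓ)) := by rw [hy]; ring
      rw [this, abs_neg, abs_mul, abs_of_pos hm0]
      have h6 := mul_le_mul_of_nonneg_left hr.le hm0.le
      linarith
    have h2 : |a y - a σ| ≤ (ℓ - m) * (D / ℓ) * (1 / 2) := by
      have h3 := lip (-σ) (hneg σ hσ) y hyδ
      rw [ha.even σ (hδε hσ), sub_neg_eq_add, hyσ, abs_mul, abs_of_pos (sub_pos.2 hmℓ)] at h3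
      have h6 := mul_le_mul_of_nonneg_left hr.le (sub_pos.2 hmℓ).le
      linarith
    have h3 : (ℓ - m) * (D / ℓ) = D - m * (D / ℓ) := by field_simp
    have h4 : 0 < m * (D / ℓ) := by positivity
    have h5 : 0 < (ℓ - m) * (D / ℓ) := mul_pos (sub_pos.2 hmℓ) hDℓ
    have hx2 : y = x := by
      have := congrArg Prod.snd h
      unfold wall at this
      split_ifs at this <;> simpa [hy] using this
    have hx1 := congrArg Prod.fst h
    rw [← hx2] at hx1
    have e1 := abs_le.1 h1
    have e2 := abs_le.1 h2
    unfold wall at hx1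
    split_ifs at hx1 <;> simp only [Prod.fst_add, Prod.smul_fst, smul_eq_mul] at hx1 <;> linarith
  refine ⟨⟨hx, hy, ℓ, hℓ0, hfoot, hfree, ?_⟩, ?_⟩
  · rw [ox, oy, py]
    exact hrefl
  · rintro ⟨j, q⟩ ⟨-, hq, l, hl, hl1, hl2, hl3⟩
    have hmem : ∀ {z : Fin 2 × ℝ × ℝ}, z ∈ phaseSpace a ε → foot a L ε z ∈ boundary a L ε :=
      fun {z} hz => ⟨z.1, _, (ha.footParam_flip hz).2, rfl⟩
    have hlℓ : l = ℓ := by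
      rcases lt_trichotomy l ℓ with h | h | h
      · exact absurd (hl1 ▸ hmem hq) (hfree l ⟨hl, h⟩)
      · exact h
      · exact absurd (hfoot ▸ hmem hy) (hl2 ℓ ⟨hℓ0, h⟩)
    rw [hlℓ, ← hfoot, fy, foot] at hl1
    have hbσ := abs_lt.1 (hb σ hσ)
    have hj : j = 1 := by
      by_contra hj
      have hj0 : j = 0 := by omega
      subst hj0
      simp only [wall, if_true, Prod.mk.injEq] at hl1
      obtain ⟨e1, e2⟩ := hl1
      rw [e2, ha.even σ (hδε hσ)] at e1
      linarith
    subst hj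
    have hfp : footParam a ε (1, q) = -σ := by
      have := congrArg Prod.snd hl1
      simpa [wall] using this
    have hstep : outgoing a ε (1, phaseCoord a (σ, -momentum a L σ t)) = outgoing a ε (1, q) := by
      rw [hl3, oy]
      dsimp only
      rw [hfp, ox]
      exact hrefl
    rw [eq_of_outgoing_eq hq hy (by rw [hfp, py]) hstep.symm]

/-- The billiard map near the orbit of period two: the chord from `t` to `σ` maps the phase point
with the foot `t` to the one with the foot `σ`. -/
theorem eventually_billiardMap (ha : IsWall a ε k₀ k₁ k₂) {L : ℝ} (hL : 0 < L) :
    ∀ᶠ q in 𝓝 (0 : ℝ × ℝ), ∀ j : Fin 2,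
      billiardMap a L ε (j, phaseCoord a (q.1, momentum a L q.1 q.2)) =
        (1 - j, phaseCoord a (q.2, -momentum a L q.2 q.1)) := by
  obtain ⟨δ, hδ, hδL, hδε, hb, hb'⟩ := ha.exists_bounds hL
  have hmem : Ioo (-δ) δ ∈ 𝓝 (0 : ℝ) := Ioo_mem_nhds (by linarith) hδ
  have h2 : Ioo (-δ) δ ×ˢ Ioo (-δ) δ ∈ 𝓝 (0 : ℝ × ℝ) := prod_mem_nhds hmem hmem
  filter_upwards [h2] with q hq j
  obtain ⟨h3, h4⟩ := ha.billiardStep_chord hδL hδε hb hb' hq.1 hq.2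
  have key : BilliardStep a L ε (j, phaseCoord a (q.1, momentum a L q.1 q.2))
        (1 - j, phaseCoord a (q.2, -momentum a L q.2 q.1)) ∧
      ∀ y, BilliardStep a L ε (j, phaseCoord a (q.1, momentum a L q.1 q.2)) y →
        y = (1 - j, phaseCoord a (q.2, -momentum a L q.2 q.1)) := by
    fin_cases j
    · exact ⟨h3, h4⟩
    · refine ⟨ha.billiardStep_flip h3, fun y hy => ?_⟩
      have h5 := h4 _ (ha.billiardStep_flip hy)
      obtain ⟨i, p⟩ := y
      simp only [Prod.mk.injEq] at h5
      have h6 : i = 0 := by omega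
      rw [h6, h5.2]
      rfl
  have hex : ∃ y, BilliardStep a L ε (j, phaseCoord a (q.1, momentum a L q.1 q.2)) y := ⟨_, key.1⟩
  rw [billiardMap, dif_pos hex]
  exact key.2 _ hex.choose_spec

end IsWall

/-! ### Symplectic charts -/

theorem det_eq (A : ℝ × ℝ →L[ℝ] ℝ × ℝ) :
    A.det = (A (1, 0)).1 * (A (0, 1)).2 - (A (0, 1)).1 * (A (1, 0)).2 := by
  rw [ContinuousLinearMap.det, ← LinearMap.det_toMatrix (Module.Basis.finTwoProd ℝ),
    Matrix.det_fin_two]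
  simp [LinearMap.toMatrix_apply]

theorem det_comp (A B : ℝ × ℝ →L[ℝ] ℝ × ℝ) : (A.comp B).det = A.det * B.det := by
  simp only [ContinuousLinearMap.det, ContinuousLinearMap.toLinearMap_comp, LinearMap.det_comp]

/-- The inverse function theorem for a smooth map of the plane, with a smooth inverse on the whole
target. -/
theorem exists_smooth_chart {f : ℝ × ℝ → ℝ × ℝ} {U : Set (ℝ × ℝ)} (hU : IsOpen U) (h0 : 0 ∈ U)
    (hf : ContDiffOn ℝ ∞ f U) (hdet : (fderiv ℝ f 0).det ≠ 0) :
    ∃ h : OpenPartialHomeomorph (ℝ × ℝ) (ℝ × ℝ), ⇑h = f ∧ (0 : ℝ × ℝ) ∈ h.source ∧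
      h.source ⊆ U ∧ (∀ p ∈ h.source, (fderiv ℝ f p).det ≠ 0) ∧
      ContDiffOn ℝ ∞ h.symm h.target := by
  have hcd : ∀ p ∈ U, ContDiffAt ℝ ∞ f p := fun p hp => hf.contDiffAt (hU.mem_nhds hp)
  have hd : ∀ p ∈ U, HasFDerivAt f (fderiv ℝ f p) p := fun p hp =>
    ((hcd p hp).differentiableAt (by simp)).hasFDerivAt
  have hcont : ContinuousOn (fun p => (fderiv ℝ f p).det) U :=
    ContinuousLinearMap.continuous_det.comp_continuousOn
      (hf.continuousOn_fderiv_of_isOpen hU (by simp))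
  have hV : IsOpen (U ∩ {p | (fderiv ℝ f p).det ≠ 0}) :=
    hcont.isOpen_inter_preimage hU isOpen_ne
  set e := ContinuousLinearMap.toContinuousLinearEquivOfDetNeZero (fderiv ℝ f 0) hdet with he
  have hde : HasFDerivAt f (e : ℝ × ℝ →L[ℝ] ℝ × ℝ) 0 := hd 0 h0
  set k := (hcd 0 h0).toOpenPartialHomeomorph f hde (by simp) with hk
  have hk0 : (0 : ℝ × ℝ) ∈ k.source :=
    (hcd 0 h0).mem_toOpenPartialHomeomorph_source hde (by simp)
  have hkf : ⇑k = f := (hcd 0 h0).toOpenPartialHomeomorph_coe hde (by simp)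
  refine ⟨k.restrOpen _ hV, ?_, ?_, ?_, ?_, ?_⟩
  · simp [hkf]
  · rw [OpenPartialHomeomorph.restrOpen_source]
    exact ⟨hk0, h0, hdet⟩
  · rw [OpenPartialHomeomorph.restrOpen_source]
    exact fun p hp => hp.2.1
  · rw [OpenPartialHomeomorph.restrOpen_source]
    exact fun p hp => hp.2.2
  · intro q hq
    set h := k.restrOpen _ hV with hh
    have hp := h.map_target hq
    rw [hh, OpenPartialHomeomorph.restrOpen_source, ← hh] at hp
    have hfp : HasFDerivAt h ((ContinuousLinearMap.toContinuousLinearEquivOfDetNeZero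
        (fderiv ℝ f (h.symm q)) hp.2.2 : (ℝ × ℝ) ≃L[ℝ] ℝ × ℝ) : ℝ × ℝ →L[ℝ] ℝ × ℝ) (h.symm q) := by
      have : ⇑h = f := by simp [hh, hkf]
      rw [this]
      exact hd _ hp.2.1
    refine (h.contDiffAt_symm hq hfp ?_).contDiffWithinAt
    have : ⇑h = f := by simp [hh, hkf]
    rw [this]
    exact hcd _ hp.2.1

/-- If the Jacobian of `f` is `∂P / ∂y`, then `f` becomes symplectic after the change of variables
`(x, y) ↦ (x, P (x, y))` in the source. -/
theorem exists_symplectic_chart {f : ℝ × ℝ → ℝ × ℝ} {U : Set (ℝ × ℝ)} (hU : IsOpen U)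
    (h0 : 0 ∈ U) (hf : ContDiffOn ℝ ∞ f U) (hdet : (fderiv ℝ f 0).det ≠ 0) {P : ℝ × ℝ → ℝ}
    (hP : ContDiff ℝ ∞ P) (hP0 : P 0 = 0)
    (hdetP : ∀ p ∈ U, (fderiv ℝ f p).det = fderiv ℝ P p (0, 1)) :
    ∃ h G : OpenPartialHomeomorph (ℝ × ℝ) (ℝ × ℝ), ⇑G = (fun p => (p.1, P p)) ∧
      (0 : ℝ × ℝ) ∈ G.source ∧ h.source ⊆ G.target ∧ (∀ p, h p = f (G.symm p)) ∧
      (0 : ℝ × ℝ) ∈ h.source ∧ ContDiffOn ℝ ∞ h h.source ∧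
      (∀ p ∈ h.source, (fderiv ℝ h p).det = 1) ∧ ContDiffOn ℝ ∞ h.symm h.target ∧
      ContDiffOn ℝ ∞ G.symm G.target := by
  set g : ℝ × ℝ → ℝ × ℝ := fun p => (p.1, P p) with hg
  have hgs : ContDiff ℝ ∞ g := contDiff_fst.prodMk hP
  have hPd : ∀ p, HasFDerivAt P (fderiv ℝ P p) p := fun p =>
    (hP.differentiable (by simp) p).hasFDerivAt
  have hgd : ∀ p, HasFDerivAt g ((ContinuousLinearMap.fst ℝ ℝ ℝ).prod (fderiv ℝ P p)) p :=
    fun p => hasFDerivAt_fst.prodMk (hPd p)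
  have hgdet : ∀ p, (fderiv ℝ g p).det = fderiv ℝ P p (0, 1) := fun p => by
    rw [(hgd p).fderiv, det_eq]
    simp
  obtain ⟨G, hGg, hG0, hGU, hGdet, hGs⟩ := exists_smooth_chart hU h0 hgs.contDiffOn
    (by rwa [hgdet, ← hdetP 0 h0])
  have hg0 : g 0 = 0 := by simp [hg, hP0]
  have hGt : (0 : ℝ × ℝ) ∈ G.target := by
    have := G.map_source hG0
    rwa [hGg, hg0] at this
  have hmaps : MapsTo G.symm G.target U := fun p hp => hGU (G.map_target hp)
  have hcomp : ContDiffOn ℝ ∞ (fun p => f (G.symm p)) G.target := hf.comp hGs hmaps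
  have hdet1 : ∀ p ∈ G.target, (fderiv ℝ (fun p => f (G.symm p)) p).det = 1 := by
    intro p hp
    have hpt := G.open_target.mem_nhds hp
    have h1 : HasFDerivAt G.symm (fderiv ℝ G.symm p) p :=
      ((hGs.contDiffAt hpt).differentiableAt (by simp)).hasFDerivAt
    have h2 : HasFDerivAt f (fderiv ℝ f (G.symm p)) (G.symm p) :=
      ((hf.contDiffAt (hU.mem_nhds (hmaps hp))).differentiableAt (by simp)).hasFDerivAt
    have h3 : HasFDerivAt g (fderiv ℝ g (G.symm p)) (G.symm p) :=
      (hgs.differentiable (by simp) _).hasFDerivAt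
    have h4 : (fderiv ℝ g (G.symm p)).comp (fderiv ℝ G.symm p) = ContinuousLinearMap.id ℝ _ := by
      refine (h3.comp p h1).unique ((hasFDerivAt_id p).congr_of_eventuallyEq ?_)
      filter_upwards [hpt] with q hq
      rw [Function.comp_apply, ← hGg, G.right_inv hq, id]
    have h5 : (fderiv ℝ (fun p => f (G.symm p)) p) =
        (fderiv ℝ f (G.symm p)).comp (fderiv ℝ G.symm p) := (h2.comp p h1).fderiv
    rw [h5, det_comp, hdetP _ (hmaps hp), ← hgdet, ← det_comp, h4]
    simp [ContinuousLinearMap.det]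
  obtain ⟨h, hhf, hh0, hhU, hhdet, hhs⟩ := exists_smooth_chart G.open_target hGt hcomp
    (by rw [hdet1 0 hGt]; norm_num)
  refine ⟨h, G, hGg, hG0, hhU, fun p => by rw [hhf], hh0, ?_, fun p hp => ?_, hhs, hGs⟩
  · rw [hhf]
    exact hcomp.mono hhU
  · rw [hhf]
    exact hdet1 p (hhU hp)

/-! ### Taylor polynomials in the complex coordinate -/

/-- The complex coordinate `z = x + i y` of the plane. -/
def toC (v : ℝ × ℝ) : ℂ := ⟨v.1, v.2⟩

/-- The homogeneous polynomial of degree `k` in `z`, `z̄` with the coefficient `p j` at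
`z ^ j * z̄ ^ (k - j)`. -/
def homPoly (k : ℕ) (p : ℕ → ℂ) (v : ℝ × ℝ) : ℂ :=
  ∑ j ∈ Finset.range (k + 1), p j * toC v ^ j * (starRingEnd ℂ) (toC v) ^ (k - j)

theorem toC_sub (v w : ℝ × ℝ) : toC (v - w) = toC v - toC w := by
  apply Complex.ext <;> simp [toC]

theorem toC_smul (s : ℝ) (v : ℝ × ℝ) : toC (s • v) = s * toC v := by
  apply Complex.ext <;> simp [toC]

theorem normSq_toC (v : ℝ × ℝ) : Complex.normSq (toC v) = v.1 ^ 2 + v.2 ^ 2 := by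
  simp [toC, Complex.normSq_apply]
  ring

theorem norm_toC_le (v : ℝ × ℝ) : ‖toC v‖ ≤ 2 * ‖v‖ := by
  refine (Complex.norm_le_abs_re_add_abs_im _).trans ?_
  have h1 := norm_fst_le v
  have h2 := norm_snd_le v
  simp only [Real.norm_eq_abs] at h1 h2
  simp only [toC]
  linarith

theorem norm_le_norm_toC (v : ℝ × ℝ) : ‖v‖ ≤ ‖toC v‖ := by
  rw [Prod.norm_def]
  exact max_le (Complex.abs_re_le_norm (toC v)) (Complex.abs_im_le_norm (toC v))

theorem orderGE_toC : OrderGE 1 toC := by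
  refine Asymptotics.IsBigO.of_bound 2 (Eventually.of_forall fun v => ?_)
  simpa using norm_toC_le v

theorem orderGE_conj_toC : OrderGE 1 fun v => (starRingEnd ℂ) (toC v) := by
  refine Asymptotics.IsBigO.of_bound 2 (Eventually.of_forall fun v => ?_)
  simpa using norm_toC_le v

theorem orderGE_sum {ι : Type*} (s : Finset ι) {k : ℕ} {f : ι → ℝ × ℝ → ℂ}
    (h : ∀ i ∈ s, OrderGE k (f i)) : OrderGE k fun v => ∑ i ∈ s, f i v := by
  simpa only [Finset.sum_fn] using Asymptotics.IsBigO.sum h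

theorem orderGE_homPoly (k : ℕ) (p : ℕ → ℂ) : OrderGE k (homPoly k p) := by
  refine orderGE_sum _ fun j hj => ?_
  have h := ((orderGE_const (p j)).mul (orderGE_toC.pow j)).mul (orderGE_conj_toC.pow (k - j))
  refine h.mono (le_of_eq ?_)
  have := Finset.mem_range.1 hj
  omega

theorem homPoly_smul (k : ℕ) (p : ℕ → ℂ) (s : ℝ) (v : ℝ × ℝ) :
    homPoly k p (s • v) = s ^ k * homPoly k p v := by
  simp only [homPoly, Finset.mul_sum]
  refine Finset.sum_congr rfl fun j hj => ?_
  have hk : k = j + (k - j) := by have := Finset.mem_range.1 hj; omega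
  rw [toC_smul, map_mul, Complex.conj_ofReal]
  conv_rhs => rw [hk, pow_add, ← hk]
  ring

/-- Being a homogeneous polynomial of degree `k`. -/
def IsHom (k : ℕ) (f : ℝ × ℝ → ℂ) : Prop := ∃ p, ∀ v, f v = homPoly k p v

theorem IsHom.add {k : ℕ} {f g : ℝ × ℝ → ℂ} (hf : IsHom k f) (hg : IsHom k g) :
    IsHom k fun v => f v + g v := by
  obtain ⟨p, hp⟩ := hf
  obtain ⟨q, hq⟩ := hg
  refine ⟨fun j => p j + q j, fun v => ?_⟩
  dsimp only
  rw [hp, hq, homPoly, homPoly, homPoly, ← Finset.sum_add_distrib]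
  exact Finset.sum_congr rfl fun j _ => by ring

theorem IsHom.const_mul {k : ℕ} {f : ℝ × ℝ → ℂ} (hf : IsHom k f) (c : ℂ) :
    IsHom k fun v => c * f v := by
  obtain ⟨p, hp⟩ := hf
  refine ⟨fun j => c * p j, fun v => ?_⟩
  dsimp only
  rw [hp, homPoly, homPoly, Finset.mul_sum]
  exact Finset.sum_congr rfl fun j _ => by ring

theorem IsHom.mul_toC {k : ℕ} {f : ℝ × ℝ → ℂ} (hf : IsHom k f) :
    IsHom (k + 1) fun v => toC v * f v := by
  obtain ⟨p, hp⟩ := hf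
  refine ⟨fun j => if j = 0 then 0 else p (j - 1), fun v => ?_⟩
  dsimp only
  rw [hp, homPoly, homPoly, Finset.sum_range_succ' _ (k + 1), Finset.mul_sum]
  simp only [if_true, zero_mul, add_zero, Nat.succ_ne_zero, if_false, Nat.add_sub_cancel]
  refine Finset.sum_congr rfl fun j _ => ?_
  rw [Nat.add_sub_add_right]
  ring

theorem IsHom.mul_conj {k : ℕ} {f : ℝ × ℝ → ℂ} (hf : IsHom k f) :
    IsHom (k + 1) fun v => (starRingEnd ℂ) (toC v) * f v := by
  obtain ⟨p, hp⟩ := hf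
  refine ⟨fun j => if j ≤ k then p j else 0, fun v => ?_⟩
  dsimp only
  rw [hp, homPoly, homPoly, Finset.sum_range_succ _ (k + 1), Finset.mul_sum, if_neg (by omega),
    zero_mul, zero_mul, add_zero]
  refine Finset.sum_congr rfl fun j hj => ?_
  have hj' : j ≤ k := Nat.lt_succ_iff.1 (Finset.mem_range.1 hj)
  rw [if_pos hj', show k + 1 - j = k - j + 1 by omega]
  ring

theorem IsHom.fst_mul {k : ℕ} {f : ℝ × ℝ → ℂ} (hf : IsHom k f) :
    IsHom (k + 1) fun v => (v.1 : ℂ) * f v := by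
  obtain ⟨p, hp⟩ := (hf.mul_toC.add hf.mul_conj).const_mul (1 / 2)
  refine ⟨p, fun v => ?_⟩
  have h : (v.1 : ℂ) = 1 / 2 * (toC v + (starRingEnd ℂ) (toC v)) := by
    rw [Complex.add_conj]
    simp [toC]
  rw [← hp]
  dsimp only
  rw [h]
  ring

theorem IsHom.snd_mul {k : ℕ} {f : ℝ × ℝ → ℂ} (hf : IsHom k f) :
    IsHom (k + 1) fun v => (v.2 : ℂ) * f v := by
  obtain ⟨p, hp⟩ := (hf.mul_toC.add (hf.mul_conj.const_mul (-1))).const_mul (1 / (2 * Complex.I))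
  refine ⟨p, fun v => ?_⟩
  have h : (v.2 : ℂ) = 1 / (2 * Complex.I) * (toC v - (starRingEnd ℂ) (toC v)) := by
    rw [Complex.sub_conj]
    have := Complex.I_ne_zero
    simp only [toC]
    push_cast
    field_simp
  rw [← hp]
  dsimp only
  rw [h]
  ring

/-- Taylor's formula at the origin, with the Taylor polynomial written in `z`, `z̄`. -/
theorem exists_taylor (n : ℕ) : ∀ {f : ℝ × ℝ → ℂ} {U : Set (ℝ × ℝ)}, IsOpen U → (0 : ℝ × ℝ) ∈ U →
    ContDiffOn ℝ ∞ f U → ∃ p : ℕ → ℕ → ℂ,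
      OrderGE n fun v => f v - ∑ k ∈ Finset.range n, homPoly k (p k) v := by
  induction n with
  | zero =>
    intro f U hU h0 hf
    refine ⟨fun _ _ => 0, ?_⟩
    have : ContinuousAt f 0 := hf.continuousOn.continuousAt (hU.mem_nhds h0)
    simpa [OrderGE] using this.isBigO_one ℝ
  | succ n ih =>
    intro f U hU h0 hf
    have hfd : ∀ v ∈ U, HasFDerivAt f (fderiv ℝ f v) v := fun v hv =>
      ((hf.contDiffAt (hU.mem_nhds hv)).differentiableAt (by simp)).hasFDerivAt
    have hf' : ContDiffOn ℝ ∞ (fderiv ℝ f) U := hf.fderiv_of_isOpen hU (by simp)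
    obtain ⟨p, hp⟩ := ih hU h0 (f := fun v => fderiv ℝ f v (1, 0)) (hf'.clm_apply contDiffOn_const)
    obtain ⟨q, hq⟩ := ih hU h0 (f := fun v => fderiv ℝ f v (0, 1)) (hf'.clm_apply contDiffOn_const)
    -- the radial primitive of the Taylor polynomial of the derivative
    have hhom : ∀ k, IsHom (k + 1) fun v => (1 / (k + 1 : ℂ)) *
        ((v.1 : ℂ) * homPoly k (p k) v + (v.2 : ℂ) * homPoly k (q k) v) := fun k =>
      ((IsHom.fst_mul ⟨p k, fun _ => rfl⟩).add (IsHom.snd_mul ⟨q k, fun _ => rfl⟩)).const_mul _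
    choose r hr using hhom
    refine ⟨fun k => if k = 0 then fun _ => f 0 else r (k - 1), ?_⟩
    have hsum : ∀ v, ∑ k ∈ Finset.range (n + 1),
        homPoly k ((fun k => if k = 0 then fun _ => f 0 else r (k - 1)) k) v =
        f 0 + ∑ k ∈ Finset.range n, homPoly (k + 1) (r k) v := fun v => by
      rw [Finset.sum_range_succ', add_comm]
      congr 1
      simp [homPoly]
    simp only [hsum]
    obtain ⟨C₁, hC₁⟩ := hp.bound
    obtain ⟨C₂, hC₂⟩ := hq.bound
    obtain ⟨δ, hδ, hball⟩ := Metric.eventually_nhds_iff_ball.1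
      ((hC₁.and hC₂).and (hU.mem_nhds h0))
    refine Asymptotics.IsBigO.of_bound (|C₁| + |C₂|) ?_
    filter_upwards [Metric.ball_mem_nhds (0 : ℝ × ℝ) hδ] with v hv
    have hvδ : ‖v‖ < δ := by simpa using hv
    have hsv : ∀ s ∈ Icc (0 : ℝ) 1, s • v ∈ Metric.ball (0 : ℝ × ℝ) δ := fun s hs => by
      rw [mem_ball_zero_iff, norm_smul, Real.norm_of_nonneg hs.1]
      exact (mul_le_of_le_one_left (norm_nonneg _) hs.2).trans_lt hvδ
    set φ : ℝ → ℂ := fun s => f (s • v) - (f 0 + ∑ k ∈ Finset.range n,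
      (s : ℂ) ^ (k + 1) * homPoly (k + 1) (r k) v) with hφ
    have hder : ∀ s ∈ Icc (0 : ℝ) 1, HasDerivAt φ
        ((v.1 : ℂ) * (fderiv ℝ f (s • v) (1, 0) - ∑ k ∈ Finset.range n, homPoly k (p k) (s • v))
        + (v.2 : ℂ) * (fderiv ℝ f (s • v) (0, 1)
          - ∑ k ∈ Finset.range n, homPoly k (q k) (s • v))) s := by
      intro s hs
      have h1 : HasDerivAt (fun s : ℝ => f (s • v)) (fderiv ℝ f (s • v) v) s := by
        have h2 : HasDerivAt (fun s : ℝ => s • v) ((1 : ℝ) • v) s :=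
          (hasDerivAt_id s).smul_const v
        rw [one_smul] at h2
        exact (hfd _ (hball _ (hsv s hs)).2).comp_hasDerivAt s h2
      have h3 : HasDerivAt (fun s : ℝ => ∑ k ∈ Finset.range n,
          (s : ℂ) ^ (k + 1) * homPoly (k + 1) (r k) v) (∑ k ∈ Finset.range n,
          (((k + 1 : ℕ) : ℂ) * (s : ℂ) ^ k * 1) * homPoly (k + 1) (r k) v) s := by
        refine HasDerivAt.fun_sum fun k _ => ?_
        have h4 : HasDerivAt (fun s : ℝ => (s : ℂ)) 1 s := by
          simpa using (hasDerivAt_id s).ofReal_comp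
        simpa using (h4.pow (k + 1)).mul_const (homPoly (k + 1) (r k) v)
      refine (h1.sub (h3.const_add (f 0))).congr_deriv ?_
      have h5 : fderiv ℝ f (s • v) v = (v.1 : ℂ) * fderiv ℝ f (s • v) (1, 0)
          + (v.2 : ℂ) * fderiv ℝ f (s • v) (0, 1) := by
        have : v = v.1 • ((1 : ℝ), (0 : ℝ)) + v.2 • ((0 : ℝ), (1 : ℝ)) := by
          ext <;> simp
        conv_lhs => rw [this]
        rw [map_add, map_smul, map_smul]
        simp only [Complex.real_smul]
        rw [← this]
      have h6 : ∑ k ∈ Finset.range n, (((k + 1 : ℕ) : ℂ) * (s : ℂ) ^ k * 1)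
          * homPoly (k + 1) (r k) v = (v.1 : ℂ) * ∑ k ∈ Finset.range n, homPoly k (p k) (s • v)
          + (v.2 : ℂ) * ∑ k ∈ Finset.range n, homPoly k (q k) (s • v) := ?_
      · rw [h5, h6]
        ring
      rw [Finset.mul_sum, Finset.mul_sum, ← Finset.sum_add_distrib]
      refine Finset.sum_congr rfl fun k _ => ?_
      rw [← hr, homPoly_smul, homPoly_smul]
      have : (k : ℂ) + 1 ≠ 0 := Nat.cast_add_one_ne_zero k
      push_cast
      field_simp
    have hbound : ∀ s ∈ Icc (0 : ℝ) 1, ‖(v.1 : ℂ) * (fderiv ℝ f (s • v) (1, 0)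
        - ∑ k ∈ Finset.range n, homPoly k (p k) (s • v)) + (v.2 : ℂ) * (fderiv ℝ f (s • v) (0, 1)
          - ∑ k ∈ Finset.range n, homPoly k (q k) (s • v))‖ ≤ (|C₁| + |C₂|) * ‖v‖ ^ (n + 1) := by
      intro s hs
      obtain ⟨⟨b₁, b₂⟩, -⟩ := hball _ (hsv s hs)
      have hsn : ‖s • v‖ ^ n ≤ ‖v‖ ^ n := by
        refine pow_le_pow_left₀ (norm_nonneg _) ?_ n
        rw [norm_smul, Real.norm_of_nonneg hs.1]
        exact mul_le_of_le_one_left (norm_nonneg _) hs.2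
      have hb : ∀ {C : ℝ} {w : ℂ}, ‖w‖ ≤ C * ‖‖s • v‖ ^ n‖ → ‖w‖ ≤ |C| * ‖v‖ ^ n := by
        intro C w hw
        rw [norm_pow, norm_norm] at hw
        exact hw.trans (mul_le_mul (le_abs_self C) hsn (by positivity) (abs_nonneg _))
      have hv1 : ‖(v.1 : ℂ)‖ ≤ ‖v‖ := by simpa using norm_fst_le v
      have hv2 : ‖(v.2 : ℂ)‖ ≤ ‖v‖ := by simpa using norm_snd_le v
      refine (norm_add_le _ _).trans ?_
      rw [norm_mul, norm_mul]
      have e1 := mul_le_mul hv1 (hb b₁) (norm_nonneg _) (norm_nonneg _)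
      have e2 := mul_le_mul hv2 (hb b₂) (norm_nonneg _) (norm_nonneg _)
      calc _ ≤ ‖v‖ * (|C₁| * ‖v‖ ^ n) + ‖v‖ * (|C₂| * ‖v‖ ^ n) := add_le_add e1 e2
        _ = _ := by ring
    have := (convex_Icc (0 : ℝ) 1).norm_image_sub_le_of_norm_hasDerivWithin_le
      (fun s hs => (hder s hs).hasDerivWithinAt) hbound (left_mem_Icc.2 zero_le_one)
      (right_mem_Icc.2 zero_le_one)
    simpa [hφ] using this

/-- A polynomial of degree less than `n` that is `O(s ^ n)` vanishes. -/
theorem coeff_eq_zero_of_isBigO (n : ℕ) {q : ℕ → ℂ}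
    (h : (fun s : ℝ => ∑ k ∈ Finset.range n, (s : ℂ) ^ k * q k) =O[𝓝[≠] 0] fun s => s ^ n) :
    ∀ k < n, q k = 0 := by
  induction n with
  | zero => intro k hk; omega
  | succ n ih =>
    have hpow : (fun s : ℝ => s ^ (n + 1)) =O[𝓝[≠] 0] fun s => s ^ n := by
      have h1 : (fun s : ℝ => s) =O[𝓝[≠] 0] fun _ => (1 : ℝ) :=
        (continuousAt_id.isBigO_one ℝ).mono nhdsWithin_le_nhds
      simpa [pow_succ] using (Asymptotics.isBigO_refl (fun s : ℝ => s ^ n) (𝓝[≠] 0)).mul h1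
    have h0 : ∀ k < n, q k = 0 := by
      refine ih ?_
      have h2 : (fun s : ℝ => (s : ℂ) ^ n * q n) =O[𝓝[≠] 0] fun s => s ^ n := by
        refine Asymptotics.IsBigO.of_bound ‖q n‖ (Eventually.of_forall fun s => ?_)
        rw [norm_mul, norm_pow, norm_pow, Complex.norm_real, mul_comm]
      have h3 := (h.trans hpow).sub h2
      refine h3.congr_left fun s => ?_
      rw [Finset.sum_range_succ, add_sub_cancel_right]
    intro k hk
    rcases Nat.lt_succ_iff_lt_or_eq.1 hk with hk | rfl
    · exact h0 k hk
    obtain ⟨C, hC⟩ := h.bound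
    have h4 : ∀ᶠ s : ℝ in 𝓝[≠] 0, ‖q k‖ ≤ C * |s| := by
      filter_upwards [hC, self_mem_nhdsWithin] with s hs hs0
      rw [Finset.sum_range_succ, Finset.sum_eq_zero fun j hj => by
        rw [h0 j (Finset.mem_range.1 hj), mul_zero], zero_add, norm_mul, norm_pow, norm_pow,
        Complex.norm_real, pow_succ, Real.norm_eq_abs] at hs
      have : 0 < |s| ^ k := pow_pos (abs_pos.2 hs0) k
      refine le_of_mul_le_mul_left ?_ this
      linarith
    have h5 : Tendsto (fun s : ℝ => C * |s|) (𝓝[≠] 0) (𝓝 0) := by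
      have : ContinuousAt (fun s : ℝ => C * |s|) 0 := by fun_prop
      simpa [ContinuousAt] using this.tendsto.mono_left nhdsWithin_le_nhds
    exact norm_le_zero_iff.1 (ge_of_tendsto h5 h4)

/-- Homogeneous polynomials whose sum vanishes to higher order vanish. -/
theorem homPoly_eq_zero_of_orderGE {n : ℕ} {p : ℕ → ℕ → ℂ}
    (h : OrderGE n fun v => ∑ k ∈ Finset.range n, homPoly k (p k) v) {k : ℕ} (hk : k < n)
    (v : ℝ × ℝ) : homPoly k (p k) v = 0 := by
  refine coeff_eq_zero_of_isBigO n (q := fun k => homPoly k (p k) v) ?_ k hk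
  have ht : Tendsto (fun s : ℝ => s • v) (𝓝[≠] 0) (𝓝 0) := by
    have : ContinuousAt (fun s : ℝ => s • v) 0 := by fun_prop
    simpa [ContinuousAt] using this.tendsto.mono_left nhdsWithin_le_nhds
  have h1 := h.comp_tendsto ht
  have h2 : ((fun z : ℝ × ℝ => ‖z‖ ^ n) ∘ fun s : ℝ => s • v) =O[𝓝[≠] 0] fun s => s ^ n := by
    refine Asymptotics.IsBigO.of_bound (‖v‖ ^ n) (Eventually.of_forall fun s => ?_)
    simp only [Function.comp_apply, norm_smul, mul_pow, norm_mul, norm_pow, norm_norm]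
    rw [mul_comm]
  refine (h1.trans h2).congr_left fun s => ?_
  simp only [Function.comp_apply, homPoly_smul]

/-- The coefficients of a homogeneous polynomial are determined by its values. -/
theorem coeff_eq_zero_of_homPoly_eq_zero {k : ℕ} {p : ℕ → ℂ} (h : ∀ v, homPoly k p v = 0) {j : ℕ}
    (hj : j ≤ k) : p j = 0 := by
  set Q : Polynomial ℂ := ∑ i ∈ Finset.range (k + 1), Polynomial.C (p i) * Polynomial.X ^ i with hQ
  have hcoeff : Q.coeff j = p j := by
    rw [hQ, Polynomial.finsetSum_coeff]
    simp only [Polynomial.coeff_C_mul_X_pow]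
    rw [Finset.sum_ite_eq]
    rw [if_pos (Finset.mem_range.2 (Nat.lt_succ_of_le hj))]
  -- the points `z / z̄` with `z = 1 + i m` are infinitely many zeros of `Q`
  set w : ℕ → ℂ := fun m => toC (1, m) / (starRingEnd ℂ) (toC (1, m)) with hw
  have hne : ∀ m : ℕ, (starRingEnd ℂ) (toC (1, (m : ℝ))) ≠ 0 := fun m h0 => by
    have := congrArg Complex.re h0
    simp [toC] at this
  have hroot : ∀ m, Q.eval (w m) = 0 := by
    intro m
    have h1 := h (1, m)
    have h2 : homPoly k p (1, m) = (starRingEnd ℂ) (toC (1, (m : ℝ))) ^ k * Q.eval (w m) := by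
      rw [hQ, Polynomial.eval_finsetSum, homPoly, Finset.mul_sum]
      refine Finset.sum_congr rfl fun i hi => ?_
      have hk : k = i + (k - i) := by have := Finset.mem_range.1 hi; omega
      have h0 := hne m
      simp only [Polynomial.eval_mul, Polynomial.eval_C, Polynomial.eval_pow, Polynomial.eval_X, hw,
        div_pow]
      have h3 : (starRingEnd ℂ) (toC (1, (m : ℝ))) ^ k = (starRingEnd ℂ) (toC (1, (m : ℝ))) ^ i
          * (starRingEnd ℂ) (toC (1, (m : ℝ))) ^ (k - i) := by rw [← pow_add, ← hk]
      rw [h3]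
      field_simp
    rw [h2] at h1
    exact (mul_eq_zero.1 h1).resolve_left (pow_ne_zero _ (hne m))
  have hinj : Function.Injective w := by
    intro m m' hmm
    simp only [hw] at hmm
    rw [div_eq_div_iff (hne m) (hne m')] at hmm
    have := congrArg Complex.im hmm
    simp [toC] at this
    have h3 : (m : ℝ) = m' := by linarith
    exact_mod_cast h3
  have hzero : Q = 0 := Polynomial.eq_zero_of_infinite_isRoot Q
    (Set.infinite_of_injective_forall_mem hinj hroot)
  rw [← hcoeff, hzero, Polynomial.coeff_zero]

/-! ### Consequences of the preservation of area -/

/-- The round disc of radius `r`. -/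
def disc (r : ℝ) : Set (ℝ × ℝ) := {v | v.1 ^ 2 + v.2 ^ 2 < r ^ 2}

theorem isOpen_disc (r : ℝ) : IsOpen (disc r) :=
  isOpen_lt (by fun_prop) continuous_const

theorem norm_lt_of_mem_disc {r : ℝ} (hr : 0 < r) {v : ℝ × ℝ} (hv : v ∈ disc r) : ‖v‖ < r := by
  refine (norm_le_norm_toC v).trans_lt ?_
  refine lt_of_pow_lt_pow_left₀ 2 hr.le ?_
  rw [← Complex.normSq_eq_norm_sq, normSq_toC]
  exact hv

open scoped Pointwise in
theorem smul_disc {r : ℝ} (hr : 0 < r) : r • disc 1 = disc r := by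
  ext v
  rw [Set.mem_smul_set_iff_inv_smul_mem₀ hr.ne']
  simp only [disc, mem_ofPred_eq, Prod.smul_fst, Prod.smul_snd, smul_eq_mul, mul_pow, inv_pow]
  rw [← mul_add, inv_mul_lt_iff₀ (by positivity), one_pow, mul_one]

theorem volume_disc_lt {r r' : ℝ} (hr' : 0 < r') (h : r' < r) :
    MeasureTheory.volume (disc r') < MeasureTheory.volume (disc r) := by
  have hr : 0 < r := hr'.trans h
  have h1 : MeasureTheory.volume (disc 1) ≠ 0 :=
    ((isOpen_disc 1).measure_pos _ ⟨0, by simp [disc]⟩).ne'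
  have h2 : MeasureTheory.volume (disc 1) ≠ ⊤ := by
    refine (lt_of_le_of_lt (MeasureTheory.measure_mono fun v hv => ?_)
      (MeasureTheory.measure_ball_lt_top (x := (0 : ℝ × ℝ)) (r := 1))).ne
    rw [mem_ball_zero_iff]
    exact norm_lt_of_mem_disc one_pos hv
  rw [← smul_disc hr, ← smul_disc hr', MeasureTheory.Measure.addHaar_smul,
    MeasureTheory.Measure.addHaar_smul]
  refine (ENNReal.mul_lt_mul_iff_left h1 h2).2 ?_
  rw [Module.finrank_prod, Module.finrank_self, abs_of_pos (by positivity),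
    abs_of_pos (by positivity), ENNReal.ofReal_lt_ofReal_iff (by positivity)]
  exact pow_lt_pow_left₀ h hr'.le (by norm_num)

/-- A map that preserves the area cannot contract all small discs. -/
theorem nonneg_of_det_eq_one {e : OpenPartialHomeomorph (ℝ × ℝ) (ℝ × ℝ)}
    (h0 : (0 : ℝ × ℝ) ∈ e.source) (hd : ∀ v ∈ e.source, HasFDerivAt e (fderiv ℝ e v) v)
    (hdet : ∀ v ∈ e.source, (fderiv ℝ e v).det = 1) {κ : ℝ}
    (hκ : OrderGE 5 fun v => Complex.normSq (toC (e v)) -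
      (v.1 ^ 2 + v.2 ^ 2 + 2 * κ * (v.1 ^ 2 + v.2 ^ 2) ^ 2)) : 0 ≤ κ := by
  by_contra! hneg
  obtain ⟨C, hC⟩ := hκ.bound
  obtain ⟨δ, hδ, hball⟩ := Metric.eventually_nhds_iff_ball.1
    (hC.and (e.open_source.mem_nhds h0))
  obtain ⟨r, hr0, hrδ, hrC, hrκ⟩ : ∃ r : ℝ, 0 < r ∧ r < δ ∧ |C| * r < -κ ∧
      -κ * (2 * r ^ 2) < 1 := by
    have h1 : ∀ᶠ r : ℝ in 𝓝[>] 0, r < δ := nhdsWithin_le_nhds (eventually_lt_nhds hδ)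
    have h2 : ∀ᶠ r : ℝ in 𝓝[>] 0, |C| * r < -κ := by
      have : ContinuousAt (fun r : ℝ => |C| * r) 0 := by fun_prop
      rw [ContinuousAt, mul_zero] at this
      exact nhdsWithin_le_nhds (this.eventually (eventually_lt_nhds (by linarith)))
    have h3 : ∀ᶠ r : ℝ in 𝓝[>] 0, -κ * (2 * r ^ 2) < 1 := by
      have : ContinuousAt (fun r : ℝ => -κ * (2 * r ^ 2)) 0 := by fun_prop
      simp only [ContinuousAt, ne_eq, OfNat.ofNat_ne_zero, not_false_eq_true, zero_pow,
        mul_zero] at this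
      exact nhdsWithin_le_nhds (this.eventually (eventually_lt_nhds one_pos))
    obtain ⟨r, hr, e1, e2, e3⟩ := ((show ∀ᶠ r : ℝ in 𝓝[>] 0, r ∈ Ioi 0 from
      self_mem_nhdsWithin).and (h1.and (h2.and h3))).exists
    exact ⟨r, hr, e1, e2, e3⟩
  have hsub : disc r ⊆ e.source := fun v hv =>
    (hball v (by rw [mem_ball_zero_iff]; exact (norm_lt_of_mem_disc hr0 hv).trans hrδ)).2
  have hpos : 0 < 1 + κ * r ^ 2 := by nlinarith
  set r' := r * √(1 + κ * r ^ 2) with hr'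
  have hr'0 : 0 < r' := mul_pos hr0 (Real.sqrt_pos.2 hpos)
  have hr'2 : r' ^ 2 = r ^ 2 + κ * (r ^ 2) ^ 2 := by
    rw [hr', mul_pow, Real.sq_sqrt hpos.le]
    ring
  have hr'r : r' < r := by
    refine lt_of_pow_lt_pow_left₀ 2 hr0.le ?_
    rw [hr'2]
    have : 0 < (r ^ 2) ^ 2 := by positivity
    nlinarith
  have himg : e '' disc r ⊆ disc r' := by
    rintro _ ⟨v, hv, rfl⟩
    have hvr := norm_lt_of_mem_disc hr0 hv
    have h1 := (hball v (by rw [mem_ball_zero_iff]; exact hvr.trans hrδ)).1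
    have hv' : v.1 ^ 2 + v.2 ^ 2 < r ^ 2 := hv
    rw [normSq_toC] at h1
    change (e v).1 ^ 2 + (e v).2 ^ 2 < r' ^ 2
    rw [hr'2]
    set ρ := v.1 ^ 2 + v.2 ^ 2 with hρ
    have hρ0 : 0 ≤ ρ := by positivity
    have h2 : ‖v‖ ^ 2 ≤ ρ := by
      have := norm_le_norm_toC v
      rw [hρ, ← normSq_toC, Complex.normSq_eq_norm_sq]
      exact pow_le_pow_left₀ (norm_nonneg _) this 2
    have h3 : C * ‖‖v‖ ^ 5‖ ≤ -κ * ρ ^ 2 := by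
      rw [norm_pow, norm_norm]
      have h4 : ‖v‖ ^ 4 ≤ ρ ^ 2 := by
        calc ‖v‖ ^ 4 = (‖v‖ ^ 2) ^ 2 := by ring
          _ ≤ ρ ^ 2 := pow_le_pow_left₀ (by positivity) h2 2
      have h5 : |C| * ‖v‖ ≤ -κ :=
        (mul_le_mul_of_nonneg_left hvr.le (abs_nonneg C)).trans hrC.le
      calc C * ‖v‖ ^ 5 ≤ |C| * ‖v‖ ^ 5 :=
            mul_le_mul_of_nonneg_right (le_abs_self C) (by positivity)
        _ = |C| * ‖v‖ * ‖v‖ ^ 4 := by ring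
        _ ≤ -κ * ρ ^ 2 := mul_le_mul h5 h4 (by positivity) (by linarith)
    have h6 := (le_abs_self _).trans (h1.trans h3)
    -- `x + κ x ^ 2` is increasing for `x ≤ r ^ 2`
    have h7 : 0 < (r ^ 2 - ρ) * (1 + κ * (r ^ 2 + ρ)) := by
      refine mul_pos (by linarith) ?_
      nlinarith
    nlinarith
  have hvol := MeasureTheory.lintegral_abs_det_fderiv_eq_addHaar_image MeasureTheory.volume
    (isOpen_disc r).measurableSet (fun v hv => (hd v (hsub hv)).hasFDerivWithinAt)
    (e.injOn.mono hsub)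
  have hone : ∫⁻ v in disc r, ENNReal.ofReal |(fderiv ℝ e v).det| =
      MeasureTheory.volume (disc r) := by
    rw [MeasureTheory.setLIntegral_congr_fun (isOpen_disc r).measurableSet
      (fun v hv => by rw [hdet v (hsub hv), abs_one, ENNReal.ofReal_one]),
      MeasureTheory.setLIntegral_one]
  rw [hone] at hvol
  have := volume_disc_lt hr'0 hr'r
  rw [hvol] at this
  exact absurd (MeasureTheory.measure_mono himg) (not_le.2 this)

/-- The inverse of a chart whose derivative has determinant one. -/
theorem symm_det_eq_one {e : OpenPartialHomeomorph (ℝ × ℝ) (ℝ × ℝ)}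
    (hs : ContDiffOn ℝ ∞ e e.source) (hdet : ∀ v ∈ e.source, (fderiv ℝ e v).det = 1) :
    ContDiffOn ℝ ∞ e.symm e.target ∧ ∀ w ∈ e.target, (fderiv ℝ e.symm w).det = 1 := by
  have hcd : ∀ v ∈ e.source, ContDiffAt ℝ ∞ e v := fun v hv =>
    hs.contDiffAt (e.open_source.mem_nhds hv)
  have hd : ∀ v ∈ e.source, HasFDerivAt e (fderiv ℝ e v) v := fun v hv =>
    ((hcd v hv).differentiableAt (by simp)).hasFDerivAt
  have hsm : ContDiffOn ℝ ∞ e.symm e.target := by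
    intro w hw
    have hp := e.map_target hw
    have hne : (fderiv ℝ e (e.symm w)).det ≠ 0 := by rw [hdet _ hp]; exact one_ne_zero
    have hfp : HasFDerivAt e ((ContinuousLinearMap.toContinuousLinearEquivOfDetNeZero
        (fderiv ℝ e (e.symm w)) hne : (ℝ × ℝ) ≃L[ℝ] ℝ × ℝ) : ℝ × ℝ →L[ℝ] ℝ × ℝ) (e.symm w) :=
      hd _ hp
    exact (e.contDiffAt_symm hw hfp (hcd _ hp)).contDiffWithinAt
  refine ⟨hsm, fun w hw => ?_⟩
  have hp := e.map_target hw
  have h1 : HasFDerivAt e.symm (fderiv ℝ e.symm w) w :=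
    ((hsm.contDiffAt (e.open_target.mem_nhds hw)).differentiableAt (by simp)).hasFDerivAt
  have h4 : (fderiv ℝ e (e.symm w)).comp (fderiv ℝ e.symm w) = ContinuousLinearMap.id ℝ _ := by
    refine ((hd _ hp).comp w h1).unique ((hasFDerivAt_id w).congr_of_eventuallyEq ?_)
    filter_upwards [e.open_target.mem_nhds hw] with q hq
    rw [Function.comp_apply, e.right_inv hq, id]
  have h5 := congrArg ContinuousLinearMap.det h4
  rw [det_comp, hdet _ hp, one_mul] at h5
  rw [h5]
  simp [ContinuousLinearMap.det]

theorem orderGE_of_contDiffAt {F : Type*} [NormedAddCommGroup F] [NormedSpace ℝ F]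
    {f : ℝ × ℝ → F} (hf : ContDiffAt ℝ ∞ f 0) (hf0 : f 0 = 0) : OrderGE 1 f := by
  have := (hf.differentiableAt (by simp)).isBigO_sub
  simpa [OrderGE, hf0] using this.norm_right

/-- If `e` preserves the area and `|e|² = r² + 2 κ r⁴ + O(r⁵)`, then `κ = 0`. -/
theorem eq_zero_of_det_eq_one {e : OpenPartialHomeomorph (ℝ × ℝ) (ℝ × ℝ)}
    (h0 : (0 : ℝ × ℝ) ∈ e.source) (he0 : e 0 = 0) (hs : ContDiffOn ℝ ∞ e e.source)
    (hdet : ∀ v ∈ e.source, (fderiv ℝ e v).det = 1) {κ : ℝ}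
    (hκ : OrderGE 5 fun v => Complex.normSq (toC (e v)) -
      (v.1 ^ 2 + v.2 ^ 2 + 2 * κ * (v.1 ^ 2 + v.2 ^ 2) ^ 2)) : κ = 0 := by
  obtain ⟨hsm, hdet'⟩ := symm_det_eq_one hs hdet
  have ht0 : (0 : ℝ × ℝ) ∈ e.target := by simpa [he0] using e.map_source h0
  have hes0 : e.symm 0 = 0 := by
    have := e.left_inv h0
    rwa [he0] at this
  refine le_antisymm ?_ (nonneg_of_det_eq_one h0 (fun v hv =>
    ((hs.contDiffAt (e.open_source.mem_nhds hv)).differentiableAt (by simp)).hasFDerivAt) hdet hκ)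
  rw [← neg_nonneg]
  refine nonneg_of_det_eq_one (e := e.symm) ht0 (fun v hv =>
    ((hsm.contDiffAt (e.open_target.mem_nhds hv)).differentiableAt (by simp)).hasFDerivAt) hdet' ?_
  have ho := orderGE_of_contDiffAt (hsm.contDiffAt (e.open_target.mem_nhds ht0)) hes0
  -- the relation at `e.symm w`
  have h1 : OrderGE 5 fun w => (w.1 ^ 2 + w.2 ^ 2) - (Complex.normSq (toC (e.symm w))
      + 2 * κ * Complex.normSq (toC (e.symm w)) ^ 2) := by
    refine (hκ.comp ho).congr' ?_ EventuallyEq.rfl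
    filter_upwards [e.open_target.mem_nhds ht0] with w hw
    rw [e.right_inv hw, normSq_toC, normSq_toC]
  have hN : OrderGE 2 fun w => Complex.normSq (toC (e.symm w)) := by
    have h2 := (orderGE_fst.comp ho).pow 2
    have h3 := (orderGE_snd.comp ho).pow 2
    exact (h2.add h3).congr fun w => (normSq_toC _).symm
  have hρ : OrderGE 2 fun w : ℝ × ℝ => w.1 ^ 2 + w.2 ^ 2 :=
    (orderGE_fst.pow 2).add (orderGE_snd.pow 2)
  have h4 : OrderGE 4 fun w => Complex.normSq (toC (e.symm w)) - (w.1 ^ 2 + w.2 ^ 2) := by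
    have h5 : OrderGE 4 fun w => 2 * κ * Complex.normSq (toC (e.symm w)) ^ 2 :=
      (hN.pow 2).const_mul _
    refine (((h1.mono (show 4 ≤ 5 by norm_num)).add h5).const_mul (-1)).congr fun w => ?_
    ring
  have h6 := ((h4.mul (hN.add hρ)).mono (show 5 ≤ 4 + 2 by norm_num)).const_mul (-2 * κ)
  refine ((h1.const_mul (-1)).add h6).congr fun w => ?_
  ring

/-! ### Uniqueness of the normal form -/

/-- In the complex coordinate, the twist map is the multiplication by this function. -/
def rotation (N : ℕ) (θ : ℝ) (τ : ℕ → ℝ) (ρ : ℝ) : ℂ := Complex.exp (angle N θ τ ρ * Complex.I)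

theorem toC_twistMap (N : ℕ) (θ : ℝ) (τ : ℕ → ℝ) (v : ℝ × ℝ) :
    toC (twistMap N θ τ v) = rotation N θ τ (v.1 ^ 2 + v.2 ^ 2) * toC v := by
  rw [rotation, Complex.exp_mul_I, ← Complex.ofReal_cos, ← Complex.ofReal_sin]
  apply Complex.ext <;> simp [toC, twistMap, -Complex.ofReal_cos, -Complex.ofReal_sin] <;> ring

theorem norm_rotation (N : ℕ) (θ : ℝ) (τ : ℕ → ℝ) (ρ : ℝ) : ‖rotation N θ τ ρ‖ = 1 :=
  Complex.norm_exp_ofReal_mul_I _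

theorem orderGE_twistMap (N : ℕ) (θ : ℝ) (τ : ℕ → ℝ) : OrderGE 1 (twistMap N θ τ) := by
  refine Asymptotics.IsBigO.trans (Asymptotics.IsBigO.of_bound 1 (Eventually.of_forall
    fun v => ?_)) orderGE_toC
  refine (norm_le_norm_toC _).trans ?_
  rw [toC_twistMap, norm_mul, norm_rotation]

theorem conj_exp_mul_I (x : ℝ) :
    (starRingEnd ℂ) (Complex.exp (x * Complex.I)) = Complex.exp (-(x * Complex.I)) := by
  rw [← Complex.exp_conj, map_mul, Complex.conj_ofReal, Complex.conj_I, mul_neg]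

theorem norm_exp_sub_exp_le (x y : ℝ) :
    ‖Complex.exp (x * Complex.I) - Complex.exp (y * Complex.I)‖ ≤ |x - y| := by
  have h : Complex.exp (x * Complex.I) - Complex.exp (y * Complex.I) =
      Complex.exp (y * Complex.I) * (Complex.exp (Complex.I * (x - y : ℝ)) - 1) := by
    rw [mul_sub, ← Complex.exp_add, mul_one]
    congr 2
    push_cast
    ring
  rw [h, norm_mul, Complex.norm_exp_ofReal_mul_I, one_mul, ← Real.norm_eq_abs]
  exact Real.norm_exp_I_mul_ofReal_sub_one_le

theorem orderGE_exp_sub {k : ℕ} {f g : ℝ × ℝ → ℝ} (h : OrderGE k fun v => f v - g v) :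
    OrderGE k fun v => Complex.exp (f v * Complex.I) - Complex.exp (g v * Complex.I) := by
  refine Asymptotics.IsBigO.trans ?_ h
  exact Asymptotics.IsBigO.of_bound 1 (Eventually.of_forall fun v => by
    rw [one_mul, Real.norm_eq_abs]
    exact norm_exp_sub_exp_le _ _)

theorem orderGE_radiusSq : OrderGE 2 fun v : ℝ × ℝ => v.1 ^ 2 + v.2 ^ 2 :=
  (orderGE_fst.pow 2).add (orderGE_snd.pow 2)

theorem OrderGE.ofReal {k : ℕ} {f : ℝ × ℝ → ℝ} (h : OrderGE k f) :
    OrderGE k fun v => (f v : ℂ) :=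
  Asymptotics.IsBigO.trans (Asymptotics.IsBigO.of_bound 1 (Eventually.of_forall fun v => by simp)) h

/-- The linear part of the exponential of a function that vanishes to order `2 m`. -/
theorem orderGE_exp_sub_linear {m : ℕ} (hm : 1 ≤ m) {f g : ℝ × ℝ → ℝ} {θ d : ℝ}
    (hg : OrderGE 2 fun v => g v - θ)
    (h : OrderGE (2 * m + 2) fun v => f v - g v - d * (v.1 ^ 2 + v.2 ^ 2) ^ m) :
    OrderGE (2 * m + 2) fun v => Complex.exp (f v * Complex.I) - Complex.exp (g v * Complex.I)
      - Complex.I * d * Complex.exp (θ * Complex.I) * ((v.1 ^ 2 + v.2 ^ 2 : ℝ) : ℂ) ^ m := by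
  set u : ℝ × ℝ → ℝ := fun v => d * (v.1 ^ 2 + v.2 ^ 2) ^ m with hu
  have hu2 : OrderGE (2 * m) u := (orderGE_radiusSq.pow m).const_mul d
  have h1 : OrderGE (2 * m + 2) fun v => Complex.exp (f v * Complex.I)
      - Complex.exp ((g v + u v : ℝ) * Complex.I) :=
    orderGE_exp_sub (h.congr fun v => by rw [hu]; ring)
  have h2 : OrderGE (2 * m + 2) fun v => Complex.exp (u v * Complex.I) - 1 - u v * Complex.I := by
    have hsq : OrderGE (2 * m + 2) fun v => (u v : ℂ) ^ 2 :=
      ((hu2.ofReal).pow 2).mono (by omega)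
    refine Asymptotics.IsBigO.trans ?_ hsq
    have ht : Tendsto u (𝓝 0) (𝓝 0) :=
      OrderGE.tendsto (k := 0) (hu2.mono (by omega))
    refine Asymptotics.IsBigO.of_bound 1 ?_
    filter_upwards [ht.eventually (Metric.ball_mem_nhds 0 one_pos)] with v hv
    have hv : ‖u v‖ < 1 := by simpa using hv
    refine (Complex.norm_exp_sub_one_sub_id_le (by simpa using hv.le)).trans ?_
    simp
  have h3 : OrderGE 2 fun v => Complex.exp (g v * Complex.I) - Complex.exp (θ * Complex.I) :=
    orderGE_exp_sub hg
  have hE : OrderGE 0 fun v => Complex.exp (g v * Complex.I) := by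
    refine Asymptotics.IsBigO.of_bound 1 (Eventually.of_forall fun v => ?_)
    rw [Complex.norm_exp_ofReal_mul_I]
    simp
  have h4 := (hE.mul h2).mono (show 2 * m + 2 ≤ 0 + (2 * m + 2) by omega)
  have h5 := (h3.mul ((hu2.ofReal).mul (orderGE_const Complex.I))).mono
    (show 2 * m + 2 ≤ 2 + (2 * m + 0) by omega)
  refine ((h1.add h4).add h5).congr fun v => ?_
  have h6 : Complex.exp ((g v + u v : ℝ) * Complex.I) =
      Complex.exp (g v * Complex.I) * Complex.exp (u v * Complex.I) := by
    rw [← Complex.exp_add]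
    push_cast
    ring_nf
  rw [h6, hu]
  push_cast
  ring

/-- A homogeneous polynomial after a twist map. -/
theorem orderGE_homPoly_twistMap {N : ℕ} {θ : ℝ} {τ : ℕ → ℝ}
    (hθ : OrderGE 2 fun v => angle N θ τ (v.1 ^ 2 + v.2 ^ 2) - θ) (k : ℕ) (p : ℕ → ℂ) :
    OrderGE (k + 2) fun v => homPoly k p (twistMap N θ τ v) - homPoly k
      (fun j => p j * (Complex.exp (θ * Complex.I) ^ j
        * (starRingEnd ℂ) (Complex.exp (θ * Complex.I)) ^ (k - j))) v := by
  have h : ∀ j ∈ Finset.range (k + 1), OrderGE (k + 2) fun v =>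
      (Complex.exp ((((j : ℝ) - (k - j : ℕ)) * angle N θ τ (v.1 ^ 2 + v.2 ^ 2) : ℝ) * Complex.I)
        - Complex.exp (((((j : ℝ) - (k - j : ℕ)) * θ : ℝ) : ℂ) * Complex.I))
      * (p j * toC v ^ j * (starRingEnd ℂ) (toC v) ^ (k - j)) := by
    intro j hj
    have h1 : OrderGE 2 fun v => Complex.exp
        ((((j : ℝ) - (k - j : ℕ)) * angle N θ τ (v.1 ^ 2 + v.2 ^ 2) : ℝ) * Complex.I)
        - Complex.exp (((((j : ℝ) - (k - j : ℕ)) * θ : ℝ) : ℂ) * Complex.I) :=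
      orderGE_exp_sub ((hθ.const_mul ((j : ℝ) - (k - j : ℕ))).congr fun v => by ring)
    have h2 := ((orderGE_const (p j)).mul (orderGE_toC.pow j)).mul (orderGE_conj_toC.pow (k - j))
    refine (h1.mul h2).mono ?_
    have := Finset.mem_range.1 hj
    omega
  refine (orderGE_sum _ h).congr fun v => ?_
  rw [homPoly, homPoly, ← Finset.sum_sub_distrib]
  refine Finset.sum_congr rfl fun j _ => ?_
  have hexp : ∀ x : ℝ, Complex.exp ((((j : ℝ) - (k - j : ℕ)) * x : ℝ) * Complex.I) =
      Complex.exp (x * Complex.I) ^ j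
        * (starRingEnd ℂ) (Complex.exp (x * Complex.I)) ^ (k - j) := fun x => by
    rw [conj_exp_mul_I, ← Complex.exp_nat_mul, ← Complex.exp_nat_mul, ← Complex.exp_add]
    congr 1
    push_cast
    ring
  rw [hexp, hexp, toC_twistMap, map_mul, mul_pow, mul_pow, rotation]
  ring

/-- The two lowest homogeneous parts of a smooth function that vanishes to order `m`. -/
theorem exists_taylor_of_orderGE {m : ℕ} {f : ℝ × ℝ → ℂ} {U : Set (ℝ × ℝ)} (hU : IsOpen U)
    (h0 : (0 : ℝ × ℝ) ∈ U) (hf : ContDiffOn ℝ ∞ f U) (hm : OrderGE m f) :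
    ∃ a b : ℕ → ℂ, OrderGE (m + 2) fun v => f v - (homPoly m a v + homPoly (m + 1) b v) := by
  obtain ⟨p, hp⟩ := exists_taylor (m + 2) hU h0 hf
  refine ⟨p m, p (m + 1), hp.congr fun v => ?_⟩
  have h1 : OrderGE m fun v => ∑ k ∈ Finset.range m, homPoly k (p k) v := by
    refine (((hm.sub (hp.mono (by omega))).sub (orderGE_homPoly m (p m))).sub
      ((orderGE_homPoly (m + 1) (p (m + 1))).mono (by omega))).congr fun v => ?_
    rw [Finset.sum_range_succ, Finset.sum_range_succ]
    ring
  rw [Finset.sum_range_succ, Finset.sum_range_succ, Finset.sum_eq_zero fun k hk =>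
    homPoly_eq_zero_of_orderGE h1 (Finset.mem_range.1 hk) v]
  ring

/-- Comparison of coefficients in the relation between a change of coordinates `r` and the two twist
maps that it conjugates. Here `q` is the part of `r` of degree less than `2 m`. -/
theorem coeff_eq_zero_of_conjugacy {m : ℕ} (hm : 1 ≤ m) {N : ℕ} {θ d : ℝ} {τ : ℕ → ℝ}
    (hθ : OrderGE 2 fun v => angle N θ τ (v.1 ^ 2 + v.2 ^ 2) - θ) {E₀ q r : ℝ × ℝ → ℂ}
    (hE₀ : ∀ v, ‖E₀ v‖ = 1)
    (hE : OrderGE (2 * m + 2) fun v => rotation N θ τ (v.1 ^ 2 + v.2 ^ 2) - E₀ v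
      - Complex.I * d * Complex.exp (θ * Complex.I) * ((v.1 ^ 2 + v.2 ^ 2 : ℝ) : ℂ) ^ m)
    (hq : OrderGE 2 fun v => q v - toC v)
    (hqT : ∀ v, q (twistMap N θ τ v) = rotation N θ τ (v.1 ^ 2 + v.2 ^ 2) * q v) {a b : ℕ → ℂ}
    (hr : OrderGE (2 * m + 2) fun v =>
      r v - q v - (homPoly (2 * m) a v + homPoly (2 * m + 1) b v))
    (hrel : OrderGE (2 * m + 2) fun v => r (twistMap N θ τ v) - E₀ v * r v) :
    (∀ j ≤ 2 * m, a j * (Complex.exp (θ * Complex.I) ^ j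
        * (starRingEnd ℂ) (Complex.exp (θ * Complex.I)) ^ (2 * m - j)
        - Complex.exp (θ * Complex.I)) = 0) ∧
    (∀ j ≤ 2 * m + 1, b j * (Complex.exp (θ * Complex.I) ^ j
        * (starRingEnd ℂ) (Complex.exp (θ * Complex.I)) ^ (2 * m + 1 - j)
        - Complex.exp (θ * Complex.I))
        + (if j = m + 1 then Complex.I * d * Complex.exp (θ * Complex.I) else 0) = 0) := by
  set Λ := Complex.exp (θ * Complex.I) with hΛ
  have hT := orderGE_twistMap N θ τ
  have hE2 : OrderGE 2 fun v => E₀ v - Λ := by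
    have h1 : OrderGE 2 fun v => rotation N θ τ (v.1 ^ 2 + v.2 ^ 2) - Λ := orderGE_exp_sub hθ
    have h2 := ((orderGE_const (Complex.I * d * Λ)).mul ((orderGE_radiusSq.ofReal).pow m)).mono
      (show 2 ≤ 0 + 2 * m by omega)
    refine ((h1.sub h2).sub (hE.mono (by omega))).congr fun v => by ring
  have hE0 : OrderGE 0 E₀ := Asymptotics.IsBigO.of_bound 1 (Eventually.of_forall fun v => by
    rw [hE₀ v]; simp)
  have hq1 : OrderGE 1 q := ((hq.mono (by norm_num)).add orderGE_toC).congr fun v => by ring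
  -- the relation, with all terms expanded to order `2 m + 2`
  have key : OrderGE (2 * m + 2) fun v =>
      homPoly (2 * m) (fun j => a j * (Λ ^ j * (starRingEnd ℂ) Λ ^ (2 * m - j) - Λ)) v
      + homPoly (2 * m + 1) (fun j => b j * (Λ ^ j * (starRingEnd ℂ) Λ ^ (2 * m + 1 - j) - Λ)
        + (if j = m + 1 then Complex.I * d * Λ else 0)) v := by
    have e1 := hr.comp hT
    have e2 := (hE0.mul hr).mono (show 2 * m + 2 ≤ 0 + (2 * m + 2) by omega)
    have e3 := orderGE_homPoly_twistMap hθ (2 * m) a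
    have e4 := (orderGE_homPoly_twistMap hθ (2 * m + 1) b).mono
      (show 2 * m + 2 ≤ 2 * m + 1 + 2 by omega)
    have e5 := (hE2.mul (orderGE_homPoly (2 * m) a)).mono (show 2 * m + 2 ≤ 2 + 2 * m by omega)
    have e6 := (hE2.mul (orderGE_homPoly (2 * m + 1) b)).mono
      (show 2 * m + 2 ≤ 2 + (2 * m + 1) by omega)
    have e7 := (hE.mul hq1).mono (show 2 * m + 2 ≤ 2 * m + 2 + 1 by omega)
    have e8 := (((orderGE_const (Complex.I * d * Λ)).mul ((orderGE_radiusSq.ofReal).pow m)).mul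
      hq).mono (show 2 * m + 2 ≤ 0 + 2 * m + 2 by omega)
    refine ((((((((hrel.sub e1).add e2).sub e3).sub e4).add e5).add e6).sub e7).sub e8).congr
      fun v => ?_
    have f1 : homPoly (2 * m) (fun j => a j * (Λ ^ j * (starRingEnd ℂ) Λ ^ (2 * m - j) - Λ)) v =
        homPoly (2 * m) (fun j => a j * (Λ ^ j * (starRingEnd ℂ) Λ ^ (2 * m - j))) v
          - Λ * homPoly (2 * m) a v := by
      simp only [homPoly, Finset.mul_sum, ← Finset.sum_sub_distrib]
      exact Finset.sum_congr rfl fun j _ => by ring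
    have f2 : homPoly (2 * m + 1)
        (fun j => b j * (Λ ^ j * (starRingEnd ℂ) Λ ^ (2 * m + 1 - j) - Λ)
          + (if j = m + 1 then Complex.I * d * Λ else 0)) v =
        homPoly (2 * m + 1) (fun j => b j * (Λ ^ j * (starRingEnd ℂ) Λ ^ (2 * m + 1 - j))) v
          - Λ * homPoly (2 * m + 1) b v
          + Complex.I * d * Λ * ((v.1 ^ 2 + v.2 ^ 2 : ℝ) : ℂ) ^ m * toC v := by
      have f3 : Complex.I * d * Λ * ((v.1 ^ 2 + v.2 ^ 2 : ℝ) : ℂ) ^ m * toC v =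
          ∑ j ∈ Finset.range (2 * m + 1 + 1), (if j = m + 1 then Complex.I * d * Λ else 0)
            * toC v ^ j * (starRingEnd ℂ) (toC v) ^ (2 * m + 1 - j) := by
        rw [Finset.sum_eq_single (m + 1), if_pos rfl, show 2 * m + 1 - (m + 1) = m by omega,
          ← normSq_toC, Complex.normSq_eq_conj_mul_self]
        · ring
        · intro j _ hj
          rw [if_neg hj]
          ring
        · intro h
          exact absurd (Finset.mem_range.2 (by omega)) h
      rw [f3]
      simp only [homPoly, Finset.mul_sum, ← Finset.sum_sub_distrib, ← Finset.sum_add_distrib]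
      exact Finset.sum_congr rfl fun j _ => by ring
    rw [f1, f2]
    simp only [hqT]
    ring
  have key2 : OrderGE (2 * m + 2) fun v => ∑ k ∈ Finset.range (2 * m + 2), homPoly k
      ((fun k => if k = 2 * m then
        (fun j => a j * (Λ ^ j * (starRingEnd ℂ) Λ ^ (2 * m - j) - Λ)) else if k = 2 * m + 1 then
        (fun j => b j * (Λ ^ j * (starRingEnd ℂ) Λ ^ (2 * m + 1 - j) - Λ)
          + (if j = m + 1 then Complex.I * d * Λ else 0)) else fun _ => 0) k) v := by
    refine key.congr fun v => ?_
    rw [Finset.sum_range_succ, Finset.sum_range_succ, Finset.sum_eq_zero]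
    · simp
    · intro k hk
      have := Finset.mem_range.1 hk
      simp only [show k ≠ 2 * m by omega, show k ≠ 2 * m + 1 by omega, if_false]
      simp [homPoly]
  constructor
  · intro j hj
    have h1 := homPoly_eq_zero_of_orderGE key2 (show 2 * m < 2 * m + 2 by omega)
    simp only [if_true] at h1
    exact coeff_eq_zero_of_homPoly_eq_zero h1 hj
  · intro j hj
    have h1 := homPoly_eq_zero_of_orderGE key2 (show 2 * m + 1 < 2 * m + 2 by omega)
    simp only [show 2 * m + 1 ≠ 2 * m by omega, if_false, if_true] at h1
    exact coeff_eq_zero_of_homPoly_eq_zero h1 hj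

/-- The transition between two normal forms of the same map is an area preserving chart that
conjugates the twist maps up to the order of the normal forms. -/
theorem exists_conjugacy {f : ℝ × ℝ → ℝ × ℝ} {N : ℕ}
    {h h₀ : OpenPartialHomeomorph (ℝ × ℝ) (ℝ × ℝ)} {θ θ₀ : ℝ} {τ τ₀ : ℕ → ℝ}
    (hh : IsBirkhoffNormalForm f N h θ τ) (hh₀ : IsBirkhoffNormalForm f N h₀ θ₀ τ₀) :
    ∃ e : OpenPartialHomeomorph (ℝ × ℝ) (ℝ × ℝ), (0 : ℝ × ℝ) ∈ e.source ∧ e 0 = 0 ∧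
      ContDiffOn ℝ ∞ e e.source ∧ (∀ v ∈ e.source, (fderiv ℝ e v).det = 1) ∧
      OrderGE (2 * N + 2) fun v => toC (e (twistMap N θ τ v))
        - rotation N θ₀ τ₀ (Complex.normSq (toC (e v))) * toC (e v) := by
  obtain ⟨hs₀, hd₀⟩ := symm_det_eq_one hh₀.smooth hh₀.symplectic
  set e := h.trans h₀.symm with he
  have hsrc : ∀ v, v ∈ e.source ↔ v ∈ h.source ∧ h v ∈ h₀.target := fun v => by
    rw [he, OpenPartialHomeomorph.trans_source]
    rfl
  have hev : ∀ v, e v = h₀.symm (h v) := fun v => rfl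
  have ht₀ : (0 : ℝ × ℝ) ∈ h₀.target := by
    have := h₀.map_source hh₀.zero_mem
    rwa [hh₀.map_zero] at this
  have hsymm₀ : h₀.symm 0 = 0 := by
    have := h₀.left_inv hh₀.zero_mem
    rwa [hh₀.map_zero] at this
  have he0 : (0 : ℝ × ℝ) ∈ e.source := (hsrc 0).2 ⟨hh.zero_mem, by rwa [hh.map_zero]⟩
  have hez : e 0 = 0 := by rw [hev, hh.map_zero, hsymm₀]
  have hsm : ContDiffOn ℝ ∞ e e.source :=
    hs₀.comp (hh.smooth.mono fun v hv => ((hsrc v).1 hv).1) fun v hv => ((hsrc v).1 hv).2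
  refine ⟨e, he0, hez, hsm, fun v hv => ?_, ?_⟩
  · obtain ⟨h1, h2⟩ := (hsrc v).1 hv
    have d1 : HasFDerivAt h (fderiv ℝ h v) v :=
      ((hh.smooth.contDiffAt (h.open_source.mem_nhds h1)).differentiableAt (by simp)).hasFDerivAt
    have d2 : HasFDerivAt h₀.symm (fderiv ℝ h₀.symm (h v)) (h v) :=
      ((hs₀.contDiffAt (h₀.open_target.mem_nhds h2)).differentiableAt (by simp)).hasFDerivAt
    have d3 : fderiv ℝ e v = (fderiv ℝ h₀.symm (h v)).comp (fderiv ℝ h v) := (d2.comp v d1).fderiv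
    rw [d3, det_comp, hd₀ _ h2, hh.symplectic v h1, one_mul]
  · have ho := orderGE_of_contDiffAt (hsm.contDiffAt (e.open_source.mem_nhds he0)) hez
    have hT := orderGE_twistMap N θ τ
    have hnf : OrderGE (2 * N + 2) fun v => h.symm (f (h v)) - twistMap N θ τ v := hh.normal_form
    have hx : OrderGE 1 fun v => h.symm (f (h v)) :=
      ((hnf.mono (by omega)).add hT).congr fun v => by abel
    -- `e` is Lipschitz near the origin
    obtain ⟨K, s, hs, hK⟩ := ((hsm.contDiffAt (e.open_source.mem_nhds he0)).of_le
      (show (1 : WithTop ℕ∞) ≤ ∞ by exact_mod_cast le_top)).exists_lipschitzOnWith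
    have h1 : OrderGE (2 * N + 2) fun v => e (h.symm (f (h v))) - e (twistMap N θ τ v) := by
      refine Asymptotics.IsBigO.trans (Asymptotics.IsBigO.of_bound K ?_) hnf
      filter_upwards [OrderGE.tendsto (k := 0) hx hs, OrderGE.tendsto (k := 0) hT hs] with v hv1 hv2
      exact hK.norm_sub_le hv1 hv2
    have hnf₀ : OrderGE (2 * N + 2) fun v => h₀.symm (f (h₀ v)) - twistMap N θ₀ τ₀ v :=
      hh₀.normal_form
    have h2 := (hnf₀.comp ho).sub h1
    have h3 : OrderGE (2 * N + 2) fun v => e (twistMap N θ τ v) - twistMap N θ₀ τ₀ (e v) := by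
      refine h2.congr' ?_ EventuallyEq.rfl
      filter_upwards [hh.eventually_mem, e.open_source.mem_nhds he0] with v hv1 hv2
      rw [hev v, hev (h.symm _), h.right_inv hv1, h₀.right_inv ((hsrc v).1 hv2).2]
      abel
    have h4 : OrderGE (2 * N + 2) fun v => toC (e (twistMap N θ τ v) - twistMap N θ₀ τ₀ (e v)) := by
      refine Asymptotics.IsBigO.trans (Asymptotics.IsBigO.of_bound 2 (Eventually.of_forall
        fun v => ?_)) h3
      exact norm_toC_le _
    refine h4.congr fun v => ?_
    rw [toC_sub, toC_twistMap N θ₀, normSq_toC]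

theorem toC_zero : toC 0 = 0 := rfl

theorem contDiff_toC : ContDiff ℝ ∞ toC :=
  Complex.equivRealProdCLM.symm.contDiff

/-- The linear part of an area preserving chart, in the complex coordinate. -/
theorem normSq_sub_normSq_eq_one {e : OpenPartialHomeomorph (ℝ × ℝ) (ℝ × ℝ)}
    (h0 : (0 : ℝ × ℝ) ∈ e.source) (hs : ContDiffOn ℝ ∞ e e.source)
    (hdet : (fderiv ℝ e 0).det = 1) {A B : ℂ}
    (h : OrderGE 2 fun v => toC (e v) - (A * toC v + B * (starRingEnd ℂ) (toC v))) :
    Complex.normSq A - Complex.normSq B = 1 := by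
  have hd : HasFDerivAt e (fderiv ℝ e 0) 0 :=
    ((hs.contDiffAt (e.open_source.mem_nhds h0)).differentiableAt (by simp)).hasFDerivAt
  have hline : ∀ w : ℝ × ℝ, toC (fderiv ℝ e 0 w) = A * toC w + B * (starRingEnd ℂ) (toC w) := by
    intro w
    have h1 : HasDerivAt (fun s : ℝ => toC (e (s • w))) (toC (fderiv ℝ e 0 w)) 0 := by
      have h2 : HasDerivAt (fun s : ℝ => s • w) ((1 : ℝ) • w) 0 :=
        (hasDerivAt_id (0 : ℝ)).smul_const w
      rw [one_smul] at h2
      have hd' : HasFDerivAt e (fderiv ℝ e 0) ((0 : ℝ) • w) := by rwa [zero_smul]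
      exact (Complex.equivRealProdCLM.symm : (ℝ × ℝ) →L[ℝ] ℂ).hasFDerivAt.comp_hasDerivAt 0
        (hd'.comp_hasDerivAt 0 h2)
    have ht : Tendsto (fun s : ℝ => s • w) (𝓝 0) (𝓝 0) := by
      have : ContinuousAt (fun s : ℝ => s • w) 0 := by fun_prop
      simpa [ContinuousAt] using this
    have h3 : (fun s : ℝ => toC (e (s • w)) - s * (A * toC w + B * (starRingEnd ℂ) (toC w)))
        =O[𝓝 0] fun s => ‖s - 0‖ ^ 2 := by
      refine ((h.comp_tendsto ht).trans (Asymptotics.IsBigO.of_bound (‖w‖ ^ 2)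
        (Eventually.of_forall fun s => ?_))).congr_left fun s => ?_
      · simp only [Function.comp_apply, norm_smul, mul_pow, norm_mul, norm_pow, norm_norm, sub_zero]
        rw [mul_comm]
      · simp only [Function.comp_apply, toC_smul, map_mul, Complex.conj_ofReal]
        ring
    have h4 := h3.hasFDerivAt (𝕜 := ℝ) (by norm_num)
    have h5 : HasDerivAt (fun s : ℝ => toC (e (s • w))
        - s * (A * toC w + B * (starRingEnd ℂ) (toC w))) 0 0 := by
      simpa using h4.hasDerivAt
    have h6 : HasDerivAt (fun s : ℝ => (s : ℂ) * (A * toC w + B * (starRingEnd ℂ) (toC w)))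
        (A * toC w + B * (starRingEnd ℂ) (toC w)) 0 := by
      have : HasDerivAt (fun s : ℝ => (s : ℂ)) 1 0 := by
        simpa using (hasDerivAt_id (0 : ℝ)).ofReal_comp
      simpa using this.mul_const (A * toC w + B * (starRingEnd ℂ) (toC w))
    exact sub_eq_zero.1 ((h1.sub h6).unique h5)
  have e1 := hline (1, 0)
  have e2 := hline (0, 1)
  rw [det_eq] at hdet
  have r1 := congrArg Complex.re e1
  have i1 := congrArg Complex.im e1
  have r2 := congrArg Complex.re e2
  have i2 := congrArg Complex.im e2
  simp [toC] at r1 i1 r2 i2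
  rw [r1, i1, r2, i2] at hdet
  rw [Complex.normSq_apply, Complex.normSq_apply]
  linear_combination hdet

/-- A chart that conjugates two twist maps is a rotation to first order. -/
theorem exists_rotation {e : OpenPartialHomeomorph (ℝ × ℝ) (ℝ × ℝ)}
    (h0 : (0 : ℝ × ℝ) ∈ e.source) (he0 : e 0 = 0) (hs : ContDiffOn ℝ ∞ e e.source)
    (hdet : (fderiv ℝ e 0).det = 1) {N : ℕ} {θ θ₀ : ℝ} {τ τ₀ : ℕ → ℝ}
    (hθ : OrderGE 2 fun v => angle N θ τ (v.1 ^ 2 + v.2 ^ 2) - θ)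
    (hθ₀ : OrderGE 2 fun v => angle N θ₀ τ₀ (v.1 ^ 2 + v.2 ^ 2) - θ₀)
    (hrel : OrderGE 2 fun v => toC (e (twistMap N θ τ v))
      - rotation N θ₀ τ₀ (Complex.normSq (toC (e v))) * toC (e v))
    (h2 : Complex.exp (θ₀ * Complex.I) ^ 2 ≠ 1) :
    Complex.exp (θ * Complex.I) = Complex.exp (θ₀ * Complex.I) ∧
      ∃ A : ℂ, ‖A‖ = 1 ∧ OrderGE 2 fun v => A * toC (e v) - toC v := by
  set Λ := Complex.exp (θ * Complex.I) with hΛ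
  set Λ₀ := Complex.exp (θ₀ * Complex.I) with hΛ₀
  have hsC : ContDiffOn ℝ ∞ (fun v => toC (e v)) e.source := contDiff_toC.comp_contDiffOn hs
  obtain ⟨a', p, hp⟩ := exists_taylor_of_orderGE (m := 0) e.open_source h0 hsC
    ((OrderGE.mono (j := 0) (orderGE_of_contDiffAt (hsC.contDiffAt (e.open_source.mem_nhds h0))
      (by rw [he0, toC_zero])) (by norm_num)))
  have ha0 : a' 0 = 0 := by
    have := hp.eq_zero_imp.self_of_nhds (by simp)
    simpa [he0, homPoly, toC_zero, Finset.sum_range_succ] using this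
  have hp1 : OrderGE 2 fun v => toC (e v) - homPoly 1 p v := by
    refine hp.congr fun v => ?_
    simp [homPoly, ha0]
  have hlin : OrderGE 2 fun v => toC (e v) - (p 1 * toC v + p 0 * (starRingEnd ℂ) (toC v)) := by
    refine hp1.congr fun v => ?_
    simp [homPoly, Finset.sum_range_succ]
    ring
  have hAB := normSq_sub_normSq_eq_one h0 hs hdet hlin
  have ho := orderGE_of_contDiffAt (hs.contDiffAt (e.open_source.mem_nhds h0)) he0
  have hT := orderGE_twistMap N θ τ
  have key : OrderGE 2 fun v => ∑ k ∈ Finset.range 2, homPoly k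
      ((fun k => if k = 0 then fun _ => 0 else fun j => p j * (Λ ^ j
        * (starRingEnd ℂ) Λ ^ (1 - j) - Λ₀)) k) v := by
    have e1 : OrderGE 2 fun v => (rotation N θ₀ τ₀ (Complex.normSq (toC (e v))) - Λ₀)
        * toC (e v) := by
      have e2 : OrderGE 2 fun v => rotation N θ₀ τ₀ (Complex.normSq (toC (e v))) - Λ₀ :=
        orderGE_exp_sub (f := fun v => angle N θ₀ τ₀ (Complex.normSq (toC (e v))))
          (g := fun _ => θ₀) ((hθ₀.comp ho).congr fun v => by rw [normSq_toC])
      exact (e2.mul (orderGE_toC.comp ho)).mono (by norm_num)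
    have e3 := (orderGE_homPoly_twistMap hθ 1 p).mono (show 2 ≤ 1 + 2 by norm_num)
    refine ((((hrel.sub (hp1.comp hT)).add e1).sub e3).add (hp1.const_mul Λ₀)).congr fun v => ?_
    simp [homPoly, Finset.sum_range_succ]
    ring
  have hz := fun j (hj : j ≤ 1) => coeff_eq_zero_of_homPoly_eq_zero
    (homPoly_eq_zero_of_orderGE key (show 1 < 2 by norm_num)) hj
  have c0 := hz 0 (by norm_num)
  have c1 := hz 1 le_rfl
  simp only [one_ne_zero, if_false, pow_zero, one_mul, pow_one, Nat.sub_zero, Nat.sub_self,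
    mul_one] at c0 c1
  have hp1ne : p 1 ≠ 0 := by
    intro h
    rw [h, Complex.normSq_zero] at hAB
    have := Complex.normSq_nonneg (p 0)
    linarith
  have hΛeq : Λ = Λ₀ := sub_eq_zero.1 ((mul_eq_zero.1 c1).resolve_left hp1ne)
  have hΛΛ : Λ₀ * (starRingEnd ℂ) Λ₀ = 1 := by
    rw [hΛ₀, conj_exp_mul_I, ← Complex.exp_add, add_neg_cancel, Complex.exp_zero]
  have hp0 : p 0 = 0 := by
    refine (mul_eq_zero.1 c0).resolve_right fun h => h2 ?_
    rw [hΛeq] at h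
    rw [pow_two]
    nth_rewrite 2 [← sub_eq_zero.1 h]
    exact hΛΛ
  rw [hp0, Complex.normSq_zero, sub_zero] at hAB
  refine ⟨hΛeq, (starRingEnd ℂ) (p 1), ?_, ?_⟩
  · rw [RCLike.norm_conj]
    rw [Complex.normSq_eq_norm_sq] at hAB
    nlinarith [norm_nonneg (p 1)]
  · refine (hlin.const_mul ((starRingEnd ℂ) (p 1))).congr fun v => ?_
    rw [hp0]
    have : (starRingEnd ℂ) (p 1) * p 1 = 1 := by
      rw [← Complex.normSq_eq_conj_mul_self, hAB, Complex.ofReal_one]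
    linear_combination -(toC v) * this

theorem orderGE_angle_one (θ : ℝ) (τ : ℕ → ℝ) :
    OrderGE 2 fun v => angle 1 θ τ (v.1 ^ 2 + v.2 ^ 2) - θ := by
  refine (orderGE_radiusSq.const_mul (τ 1)).congr fun v => ?_
  simp [angle]

theorem angle_two (θ : ℝ) (τ : ℕ → ℝ) (ρ : ℝ) : angle 2 θ τ ρ = θ + (τ 1 * ρ + τ 2 * ρ ^ 2) := by
  rw [angle, show Finset.Icc 1 2 = {1, 2} by decide, Finset.sum_pair (by norm_num), pow_one]

theorem orderGE_angle_two (θ : ℝ) (τ : ℕ → ℝ) :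
    OrderGE 2 fun v => angle 2 θ τ (v.1 ^ 2 + v.2 ^ 2) - θ := by
  refine ((orderGE_radiusSq.const_mul (τ 1)).add
    (((orderGE_radiusSq.pow 2).const_mul (τ 2)).mono (by norm_num))).congr fun v => ?_
  rw [angle_two]
  ring

/-- If `ρ` is close to the squared radius, the rotation by the angle at `ρ` may be replaced by the
rotation by the angle at the squared radius. -/
theorem orderGE_rotation_mul_sub {m : ℕ} {N : ℕ} {θ : ℝ} {τ : ℕ → ℝ} {ρ : ℝ × ℝ → ℝ}
    {r : ℝ × ℝ → ℂ} (hr : OrderGE 1 r)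
    (h : OrderGE m fun v => angle N θ τ (ρ v) - angle N θ τ (v.1 ^ 2 + v.2 ^ 2)) :
    OrderGE (m + 1) fun v => rotation N θ τ (ρ v) * r v
      - rotation N θ τ (v.1 ^ 2 + v.2 ^ 2) * r v :=
  ((orderGE_exp_sub h).mul hr).congr fun v => by rw [rotation, rotation, sub_mul]

theorem OrderGE.normSq_sub {m : ℕ} {r q : ℝ × ℝ → ℂ} (hr : OrderGE 1 r) (hq : OrderGE 1 q)
    (h : OrderGE m fun v => r v - q v) :
    OrderGE (m + 1) fun v => Complex.normSq (r v) - Complex.normSq (q v) := by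
  have h1 : OrderGE m fun v => (starRingEnd ℂ) (r v - q v) :=
    Asymptotics.IsBigO.trans (Asymptotics.IsBigO.of_bound 1
      (Eventually.of_forall fun v => by rw [RCLike.norm_conj, one_mul])) h
  have h2 : OrderGE 1 fun v => (starRingEnd ℂ) (q v) :=
    Asymptotics.IsBigO.trans (Asymptotics.IsBigO.of_bound 1
      (Eventually.of_forall fun v => by simp)) hq
  have h3 := ((h1.mul hr).add ((h2.mul h).mono (show m + 1 ≤ 1 + m by omega)))
  refine Asymptotics.IsBigO.trans (Asymptotics.IsBigO.of_bound 1
      (Eventually.of_forall fun v => ?_)) h3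
  rw [one_mul, ← Complex.norm_real]
  refine le_of_eq (congrArg _ ?_)
  rw [Complex.ofReal_sub, Complex.normSq_eq_conj_mul_self, Complex.normSq_eq_conj_mul_self, map_sub]
  ring

theorem rotation_congr {θ θ₀ : ℝ} (h : Complex.exp (θ * Complex.I) = Complex.exp (θ₀ * Complex.I))
    (N : ℕ) (τ : ℕ → ℝ) (ρ : ℝ) : rotation N θ τ ρ = rotation N θ₀ τ ρ := by
  simp only [rotation, angle, Complex.ofReal_add, add_mul, Complex.exp_add, h]

/-- If the chart `e`, normalized by a rotation, conjugates two twist maps up to order four, then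
the first twist coefficients agree (their difference is `d`), and the terms of degree two and three
of `e` consist of resonant monomials. -/
theorem twist_one_eq {e : OpenPartialHomeomorph (ℝ × ℝ) (ℝ × ℝ)}
    (h0 : (0 : ℝ × ℝ) ∈ e.source) (hs : ContDiffOn ℝ ∞ e e.source) {N : ℕ} {θ θ₀ d : ℝ}
    {τ τ₀ : ℕ → ℝ} (hθ : OrderGE 2 fun v => angle N θ τ (v.1 ^ 2 + v.2 ^ 2) - θ)
    (hθ₀ : OrderGE 2 fun v => angle N θ τ₀ (v.1 ^ 2 + v.2 ^ 2) - θ)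
    (hd : OrderGE 4 fun v => angle N θ τ (v.1 ^ 2 + v.2 ^ 2) - angle N θ τ₀ (v.1 ^ 2 + v.2 ^ 2)
      - d * (v.1 ^ 2 + v.2 ^ 2))
    (hΛ : Complex.exp (θ * Complex.I) = Complex.exp (θ₀ * Complex.I)) {A : ℂ} (hA : ‖A‖ = 1)
    (hAe : OrderGE 2 fun v => A * toC (e v) - toC v)
    (h₀ : OrderGE 3 fun v => angle N θ₀ τ₀ (Complex.normSq (A * toC (e v)))
        - angle N θ₀ τ₀ (v.1 ^ 2 + v.2 ^ 2))
    (hrel : OrderGE 4 fun v => toC (e (twistMap N θ τ v))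
        - rotation N θ₀ τ₀ (Complex.normSq (toC (e v))) * toC (e v)) :
    d = 0 ∧ ∃ a b : ℕ → ℂ,
      (OrderGE 4 fun v => A * toC (e v) - toC v - (homPoly 2 a v + homPoly 3 b v)) ∧
      (∀ j ≤ 2, a j * (Complex.exp (θ * Complex.I) ^ j
        * (starRingEnd ℂ) (Complex.exp (θ * Complex.I)) ^ (2 - j)
        - Complex.exp (θ * Complex.I)) = 0) ∧
      ∀ j ≤ 3, b j * (Complex.exp (θ * Complex.I) ^ j
        * (starRingEnd ℂ) (Complex.exp (θ * Complex.I)) ^ (3 - j)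
        - Complex.exp (θ * Complex.I)) = 0 := by
  set r : ℝ × ℝ → ℂ := fun v => A * toC (e v) with hr
  have hrs : ContDiffOn ℝ ∞ (fun v => r v - toC v) e.source :=
    (contDiffOn_const.mul (contDiff_toC.comp_contDiffOn hs)).sub contDiff_toC.contDiffOn
  obtain ⟨a, b, hab⟩ := exists_taylor_of_orderGE e.open_source h0 hrs hAe
  have hr1 : OrderGE 1 r := ((hAe.mono (by norm_num)).add orderGE_toC).congr fun v => by ring
  have hnorm : ∀ v, Complex.normSq (toC (e v)) = Complex.normSq (r v) := fun v => by
    rw [hr, Complex.normSq_mul, Complex.normSq_eq_norm_sq A, hA]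
    ring
  have hrot : OrderGE 4 fun v => r (twistMap N θ τ v)
      - rotation N θ τ₀ (v.1 ^ 2 + v.2 ^ 2) * r v := by
    refine ((hrel.const_mul A).add (orderGE_rotation_mul_sub hr1 h₀)).congr fun v => ?_
    rw [hnorm, rotation_congr hΛ]
    simp only [hr]
    ring
  have hE := orderGE_exp_sub_linear (m := 1) le_rfl hθ₀ (hd.congr fun v => by rw [pow_one])
  obtain ⟨ca, cb⟩ := coeff_eq_zero_of_conjugacy (m := 1) le_rfl hθ
    (fun v => norm_rotation _ _ _ _) hE ((orderGE_zero 2).congr fun v => by rw [sub_self])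
    (fun v => toC_twistMap _ _ _ _) hab hrot
  have hΛΛ : Complex.exp (θ * Complex.I) * (starRingEnd ℂ) (Complex.exp (θ * Complex.I)) = 1 := by
    rw [conj_exp_mul_I, ← Complex.exp_add, add_neg_cancel, Complex.exp_zero]
  have hd0 : d = 0 := by
    have h2 := cb 2 (by norm_num)
    rw [if_pos rfl, show 2 * 1 + 1 - 2 = 1 by norm_num, pow_two, pow_one, mul_assoc, hΛΛ, mul_one,
      sub_self, mul_zero, zero_add] at h2
    simpa [Complex.exp_ne_zero] using h2
  refine ⟨hd0, a, b, hab, ca, fun j hj => ?_⟩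
  have := cb j hj
  rw [hd0] at this
  simpa using this

/-- The rotation number and the first twist coefficient do not depend on the normal form. -/
theorem IsBirkhoffNormalForm.unique_one {f : ℝ × ℝ → ℝ × ℝ}
    {h h₀ : OpenPartialHomeomorph (ℝ × ℝ) (ℝ × ℝ)} {θ θ₀ : ℝ} {τ τ₀ : ℕ → ℝ}
    (hh : IsBirkhoffNormalForm f 1 h θ τ) (hh₀ : IsBirkhoffNormalForm f 1 h₀ θ₀ τ₀)
    (h4 : Complex.exp (θ₀ * Complex.I) ^ 4 ≠ 1) :
    Complex.exp (θ * Complex.I) = Complex.exp (θ₀ * Complex.I) ∧ τ 1 = τ₀ 1 := by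
  obtain ⟨e, h0, he0, hs, hdet, hrel⟩ := exists_conjugacy hh hh₀
  obtain ⟨hΛ, A, hA, hAe⟩ := exists_rotation h0 he0 hs (hdet 0 h0) (orderGE_angle_one θ τ)
    (orderGE_angle_one θ₀ τ₀) (hrel.mono (by norm_num)) fun h2 => h4 (by
      rw [show 4 = 2 * 2 by norm_num, pow_mul, h2, one_pow])
  refine ⟨hΛ, ?_⟩
  have hr1 : OrderGE 1 fun v => A * toC (e v) :=
    ((hAe.mono (by norm_num)).add orderGE_toC).congr fun v => by ring
  have hρ := OrderGE.normSq_sub hr1 orderGE_toC hAe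
  have := (twist_one_eq h0 hs (d := τ 1 - τ₀ 1) (orderGE_angle_one θ τ) (orderGE_angle_one θ τ₀)
    ((orderGE_zero 4).congr fun v => ?_) hΛ hA hAe ((hρ.const_mul (τ₀ 1)).congr fun v => ?_)
    hrel).1
  · exact sub_eq_zero.1 this
  · simp [angle]
    ring
  · simp [angle, normSq_toC]
    ring

/-- The rotation number and the second twist coefficient do not depend on the normal form. The
transition between two normal forms is a rotation of `z + β |z|² z + O(4)`, and the preservation of
the area forces `re β = 0`, so that it does not mix the twist coefficients. -/
theorem IsBirkhoffNormalForm.unique_two {f : ℝ × ℝ → ℝ × ℝ}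
    {h h₀ : OpenPartialHomeomorph (ℝ × ℝ) (ℝ × ℝ)} {θ θ₀ : ℝ} {τ τ₀ : ℕ → ℝ}
    (hh : IsBirkhoffNormalForm f 2 h θ τ) (hh₀ : IsBirkhoffNormalForm f 2 h₀ θ₀ τ₀)
    (h4 : Complex.exp (θ₀ * Complex.I) ^ 4 ≠ 1) (h3 : Complex.exp (θ₀ * Complex.I) ^ 3 ≠ 1) :
    Complex.exp (θ * Complex.I) = Complex.exp (θ₀ * Complex.I) ∧ τ 2 = τ₀ 2 := by
  obtain ⟨e, h0, he0, hs, hdet, hrel⟩ := exists_conjugacy hh hh₀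
  have h2 : Complex.exp (θ₀ * Complex.I) ^ 2 ≠ 1 := fun h2 => h4 (by
      rw [show 4 = 2 * 2 by norm_num, pow_mul, h2, one_pow])
  obtain ⟨hΛ, A, hA, hAe⟩ := exists_rotation h0 he0 hs (hdet 0 h0) (orderGE_angle_two θ τ)
    (orderGE_angle_two θ₀ τ₀) (hrel.mono (by norm_num)) h2
  refine ⟨hΛ, ?_⟩
  set r : ℝ × ℝ → ℂ := fun v => A * toC (e v) with hr
  have hr1 : OrderGE 1 r := ((hAe.mono (by norm_num)).add orderGE_toC).congr fun v => by ring
  have hnorm : ∀ v, Complex.normSq (toC (e v)) = Complex.normSq (r v) := fun v => by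
    rw [hr, Complex.normSq_mul, Complex.normSq_eq_norm_sq A, hA]
    ring
  have hN : OrderGE 2 fun v => Complex.normSq (r v) := by
    refine ((OrderGE.normSq_sub hr1 orderGE_toC hAe).mono (by norm_num)).add orderGE_radiusSq
      |>.congr fun v => ?_
    rw [normSq_toC]
    ring
  -- the difference of the angles is controlled by the difference of the radii
  have hang : ∀ {m : ℕ}, (OrderGE m fun v => Complex.normSq (r v) - (v.1 ^ 2 + v.2 ^ 2)) →
      OrderGE m fun v => angle 2 θ₀ τ₀ (Complex.normSq (r v))
        - angle 2 θ₀ τ₀ (v.1 ^ 2 + v.2 ^ 2) := fun {m} hm => by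
    have e1 := (hm.mul (((hN.add orderGE_radiusSq).mono (show 0 ≤ 2 by norm_num)).const_mul
      (τ₀ 2)))
    refine ((hm.const_mul (τ₀ 1)).add e1).congr fun v => ?_
    rw [angle_two, angle_two]
    ring
  obtain ⟨hd, a, b, hab, ca, cb⟩ := twist_one_eq h0 hs (d := τ 1 - τ₀ 1) (orderGE_angle_two θ τ)
    (orderGE_angle_two θ τ₀)
    (((orderGE_radiusSq.pow 2).const_mul (τ 2 - τ₀ 2)).congr fun v => by
      rw [angle_two, angle_two]; ring) hΛ hA hAe
    (hang ((OrderGE.normSq_sub hr1 orderGE_toC hAe).congr fun v => by rw [normSq_toC]))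
    (hrel.mono (by norm_num))
  rw [hΛ] at ca cb
  set Λ := Complex.exp (θ₀ * Complex.I) with hΛdef
  have hne : Λ ≠ 0 := Complex.exp_ne_zero _
  have hΛΛ : Λ * (starRingEnd ℂ) Λ = 1 := by
    rw [hΛdef, conj_exp_mul_I, ← Complex.exp_add, add_neg_cancel, Complex.exp_zero]
  have h1 : Λ ≠ 1 := fun h => h2 (by rw [h, one_pow])
  set K := (starRingEnd ℂ) Λ with hK
  -- the absence of resonances leaves the term `|z|² z` only
  have a0 : a 0 = 0 := (mul_eq_zero.1 (ca 0 (by norm_num))).resolve_right fun h => h3 (by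
    change Λ ^ 0 * K ^ 2 - Λ = 0 at h
    linear_combination (-Λ ^ 2) * h + (K * Λ + 1) * hΛΛ)
  have a1 : a 1 = 0 := (mul_eq_zero.1 (ca 1 (by norm_num))).resolve_right fun h => h1 (by
    change Λ ^ 1 * K ^ 1 - Λ = 0 at h
    linear_combination -h + hΛΛ)
  have a2 : a 2 = 0 := (mul_eq_zero.1 (ca 2 (by norm_num))).resolve_right fun h => h1 (by
    change Λ ^ 2 * K ^ 0 - Λ = 0 at h
    linear_combination K * h - (Λ - 1) * hΛΛ)
  have b0 : b 0 = 0 := (mul_eq_zero.1 (cb 0 (by norm_num))).resolve_right fun h => h4 (by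
    change Λ ^ 0 * K ^ 3 - Λ = 0 at h
    linear_combination (-Λ ^ 3) * h + ((K * Λ) ^ 2 + K * Λ + 1) * hΛΛ)
  have b1 : b 1 = 0 := (mul_eq_zero.1 (cb 1 (by norm_num))).resolve_right fun h => h2 (by
    change Λ ^ 1 * K ^ 2 - Λ = 0 at h
    linear_combination (-Λ) * h + (K * Λ + 1) * hΛΛ)
  have b3 : b 3 = 0 := (mul_eq_zero.1 (cb 3 (by norm_num))).resolve_right fun h => h2 (by
    change Λ ^ 3 * K ^ 0 - Λ = 0 at h
    linear_combination K * h - (Λ ^ 2 - 1) * hΛΛ)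
  set q : ℝ × ℝ → ℂ := fun v => toC v + b 2 * ((v.1 ^ 2 + v.2 ^ 2 : ℝ) : ℂ) * toC v with hq
  have hrq : OrderGE 4 fun v => r v - q v := by
    refine hab.congr fun v => ?_
    simp only [hq, homPoly, Finset.sum_range_succ, Finset.sum_range_zero, a0, a1, a2, b0, b1, b3,
      ← normSq_toC, Complex.normSq_eq_conj_mul_self]
    norm_num
    ring
  have hqz : OrderGE 3 fun v => q v - toC v := by
    refine (((orderGE_const (b 2)).mul orderGE_radiusSq.ofReal).mul orderGE_toC).congr fun v => ?_
    rw [hq]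
    ring
  have hq1 : OrderGE 1 q := ((hqz.mono (by norm_num)).add orderGE_toC).congr fun v => by ring
  have hNq : OrderGE 5 fun v => Complex.normSq (r v)
      - (v.1 ^ 2 + v.2 ^ 2 + 2 * (b 2).re * (v.1 ^ 2 + v.2 ^ 2) ^ 2) := by
    have e1 := OrderGE.normSq_sub hr1 hq1 hrq
    have e2 := ((orderGE_radiusSq.pow 3).const_mul (Complex.normSq (b 2))).mono
      (show 5 ≤ 2 * 3 by norm_num)
    refine (e1.add e2).congr fun v => ?_
    have : Complex.normSq (q v) = (1 + 2 * (b 2).re * (v.1 ^ 2 + v.2 ^ 2)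
        + Complex.normSq (b 2) * (v.1 ^ 2 + v.2 ^ 2) ^ 2) * (v.1 ^ 2 + v.2 ^ 2) := by
      have e3 : q v = (1 + b 2 * ((v.1 ^ 2 + v.2 ^ 2 : ℝ) : ℂ)) * toC v := by rw [hq]; ring
      rw [e3, Complex.normSq_mul, normSq_toC]
      congr 1
      rw [Complex.normSq_apply, Complex.normSq_apply]
      simp only [Complex.add_re, Complex.add_im, Complex.one_re, Complex.one_im,
        Complex.re_mul_ofReal, Complex.im_mul_ofReal]
      ring
    rw [this]
    ring
  have hre : (b 2).re = 0 := eq_zero_of_det_eq_one h0 he0 hs hdet (hNq.congr fun v => by rw [hnorm])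
  have hρ : OrderGE 5 fun v => Complex.normSq (r v) - (v.1 ^ 2 + v.2 ^ 2) :=
    hNq.congr fun v => by rw [hre]; ring
  have hrs : ContDiffOn ℝ ∞ (fun v => r v - q v) e.source := by
    refine (contDiffOn_const.mul (contDiff_toC.comp_contDiffOn hs)).sub (ContDiff.contDiffOn ?_)
    refine contDiff_toC.add ((contDiff_const.mul ?_).mul contDiff_toC)
    exact Complex.ofRealCLM.contDiff.comp ((contDiff_fst.pow 2).add (contDiff_snd.pow 2))
  obtain ⟨a', b', hab'⟩ := exists_taylor_of_orderGE e.open_source h0 hrs hrq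
  have hrot : OrderGE 6 fun v => r (twistMap 2 θ τ v)
      - rotation 2 θ τ₀ (v.1 ^ 2 + v.2 ^ 2) * r v := by
    refine ((hrel.const_mul A).add (orderGE_rotation_mul_sub hr1 (hang hρ))).congr fun v => ?_
    rw [hnorm, rotation_congr hΛ]
    simp only [hr]
    ring
  have hE := orderGE_exp_sub_linear (m := 2) (f := fun v => angle 2 θ τ (v.1 ^ 2 + v.2 ^ 2))
    (d := τ 2 - τ₀ 2) one_le_two (orderGE_angle_two θ τ₀) ((orderGE_zero 6).congr fun v => by
      rw [angle_two, angle_two, sub_eq_zero.1 hd]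
      ring)
  have h5 := (coeff_eq_zero_of_conjugacy (m := 2) one_le_two (orderGE_angle_two θ τ)
    (fun v => norm_rotation _ _ _ _) hE (hqz.mono (by norm_num)) (fun v => by
      simp only [hq]
      rw [twistMap_radiusSq, toC_twistMap]
      ring) hab' hrot).2 3 (by norm_num)
  rw [hΛ, if_pos rfl, show 2 * 2 + 1 - 3 = 2 by norm_num] at h5
  have h6 : Λ ^ 3 * K ^ 2 = Λ := by
    linear_combination (Λ * (Λ * K + 1)) * hΛΛ
  rw [h6, sub_self, mul_zero, zero_add] at h5
  have h7 : ((τ 2 - τ₀ 2 : ℝ) : ℂ) = 0 := by simpa [hne, -Complex.ofReal_sub] using h5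
  exact sub_eq_zero.1 (Complex.ofReal_eq_zero.1 h7)

/-! ### The radius of curvature -/

/-- Taylor's formula of order five at the origin. -/
theorem taylor_isBigO_five {f : ℝ → ℝ} (hf : ContDiffAt ℝ ∞ f 0) :
    (fun x => f x - (f 0 + deriv f 0 * x + iteratedDeriv 2 f 0 / 2 * x ^ 2
      + iteratedDeriv 3 f 0 / 6 * x ^ 3 + iteratedDeriv 4 f 0 / 24 * x ^ 4))
      =O[𝓝 0] fun x => x ^ 5 := by
  obtain ⟨u, hu, hfu⟩ := hf.contDiffOn (m := ((5 : ℕ) : WithTop ℕ∞)) 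
    (WithTop.coe_le_coe.2 (le_top : ((5 : ℕ) : ℕ∞) ≤ ⊤)) (by simp)
  obtain ⟨δ, hδ, hball⟩ := Metric.mem_nhds_iff.1 hu
  have h0 : (0 : ℝ) ∈ Metric.ball (0 : ℝ) δ := Metric.mem_ball_self hδ
  have h1 := (taylor_isLittleO (convex_ball 0 δ) h0 (hfu.mono hball)).isBigO
  rw [Metric.isOpen_ball.nhdsWithin_eq h0] at h1
  have h2 : (fun x : ℝ => iteratedDeriv 5 f 0 / 120 * x ^ 5) =O[𝓝 0] fun x : ℝ => x ^ 5 :=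
    (Asymptotics.isBigO_refl (fun x : ℝ => x ^ 5) (𝓝 0)).const_mul_left _
  have h3 : (fun x : ℝ => (x - 0) ^ 5) = fun x => x ^ 5 := by simp
  rw [h3] at h1
  refine (h1.add h2).congr_left fun x => ?_
  rw [taylor_within_apply]
  simp only [iteratedDerivWithin_of_isOpen Metric.isOpen_ball h0, Finset.sum_range_succ,
    Finset.sum_range_zero, Nat.factorial, iteratedDeriv_zero, iteratedDeriv_one, smul_eq_mul]
  push_cast
  ring

namespace IsWall

variable {a : ℝ → ℝ} {ε k₀ k₁ k₂ : ℝ}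

theorem smoothAt_arcParam (ha : IsWall a ε k₀ k₁ k₂) : ContDiffAt ℝ ∞ (arcParam a ε) 0 := by
  have h1 : ContDiffAt ℝ ∞ (arcLength a) 0 :=
    ha.smooth_arcLength.contDiffAt (isOpen_Ioo.mem_nhds ha.zero_mem)
  have h2 : HasFDerivAt (arcLength a) ((ContinuousLinearEquiv.unitsEquivAut ℝ
      (Units.mk0 (speed a 0) (speed_pos a 0).ne') : ℝ ≃L[ℝ] ℝ) : ℝ →L[ℝ] ℝ) 0 := by
    have := (ha.hasDerivAt_arcLength ha.zero_mem).hasFDerivAt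
    refine this.congr_fderiv ?_
    ext
    simp
  set e := h1.toOpenPartialHomeomorph (arcLength a) h2 (by simp) with he
  have he' : ⇑e = arcLength a := h1.toOpenPartialHomeomorph_coe h2 (by simp)
  have h0 : (0 : ℝ) ∈ e.source := h1.mem_toOpenPartialHomeomorph_source h2 (by simp)
  have ht : (0 : ℝ) ∈ e.target := by
    have := e.map_source h0
    rwa [he', arcLength_zero] at this
  have hs0 : e.symm 0 = 0 := by
    have := e.left_inv h0
    rwa [he', arcLength_zero] at this
  have h3 := h1.to_localInverse h2 (by simp)
  rw [arcLength_zero] at h3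
  refine h3.congr_of_eventuallyEq ?_
  have hc : Tendsto e.symm (𝓝 0) (𝓝 0) := by
    have := e.continuousAt_symm ht
    rwa [ContinuousAt, hs0] at this
  filter_upwards [e.open_target.mem_nhds ht, hc.eventually ha.nhds_zero] with s hs hs'
  change arcParam a ε s = e.symm s
  have := ha.arcParam_arcLength hs'
  rwa [← he', e.right_inv hs] at this

theorem smoothAt_radius (ha : IsWall a ε k₀ k₁ k₂) (hk : k₀ ≠ 0) :
    ContDiffAt ℝ ∞ (radius a ε) 0 := by
  have h0 : arcParam a ε 0 = 0 := by
    have := ha.arcParam_arcLength ha.zero_mem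
    rwa [arcLength_zero] at this
  have hn := isOpen_Ioo.mem_nhds ha.zero_mem
  have h1 : ContDiffAt ℝ ∞ (speed a) (arcParam a ε 0) := by
    rw [h0]
    exact ha.smooth_speed.contDiffAt hn
  have h2 : ContDiffAt ℝ ∞ (deriv (deriv a)) (arcParam a ε 0) := by
    rw [h0]
    exact ((contDiffOn_infty_iff_deriv_of_isOpen isOpen_Ioo).1 ha.smooth_deriv).2.contDiffAt hn
  refine ((h1.comp 0 ha.smoothAt_arcParam).pow 3).div (h2.comp 0 ha.smoothAt_arcParam) ?_
  rw [h0, ha.deriv_deriv_zero]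
  simpa using hk

/-- The slope of the wall, as an odd function on the plane of `t = z.1`. -/
theorem isOddJet_deriv (ha : IsWall a ε k₀ k₁ k₂) :
    IsOddJet (fun z : ℝ × ℝ => deriv a z.1) (fun z => 2 * k₀ * z.1) (fun z => 4 * k₁ * z.1 ^ 3)
      (fun z => 6 * k₂ * z.1 ^ 5) := by
  obtain ⟨φ, ψ, χ, -, h2, -, -, h5, -⟩ := ha.expansion
  have ht := OrderGE.tendsto (k := 0) orderGE_fst
  refine ((((isOddJet_fst.mul isOddJet_fst).comp h5).mul_odd isOddJet_fst).congr_left ?_).congr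
    (fun z => rfl) (fun z => ?_) fun z => ?_
  · filter_upwards [ht.eventually h2] with z hz
    rw [hz, pow_two]
  all_goals ring

/-- The radius of curvature in terms of the parameter of the wall. -/
theorem isEvenJet_radius (ha : IsWall a ε k₀ k₁ k₂) (hk : k₀ ≠ 0) :
    IsEvenJet (fun z : ℝ × ℝ => speed a z.1 ^ 3 / deriv (deriv a) z.1) (1 / (2 * k₀))
      (fun z => (3 * k₀ - 3 * k₁ / k₀ ^ 2) * z.1 ^ 2)
      (fun z => (3 * k₀ ^ 3 - 6 * k₁ + 18 * k₁ ^ 2 / k₀ ^ 3 - 15 / 2 * k₂ / k₀ ^ 2) * z.1 ^ 4) := by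
  have jd := ha.isOddJet_deriv.mul ha.isOddJet_deriv
  have jv := ((isEvenJet_const 1).add jd)
  have js := (jv.mul jv).mul (jd.comp inv_sqrt_one_add_expansion)
  obtain ⟨φ, ψ, χ, -, -, h3, -, -, h6⟩ := ha.expansion
  have jχ := ((isEvenJet_const 1).sub (((isOddJet_fst.mul isOddJet_fst).comp h6).smul
    (1 / (2 * k₀)))).congr (d := 0) (by field_simp; ring) (fun z => rfl) fun z => rfl
  have ht := OrderGE.tendsto (k := 0) orderGE_fst
  refine ((js.mul ((jχ.comp inv_one_sub_expansion).smul (1 / (2 * k₀)))).congr_left ?_).congr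
    (by ring) (fun z => ?_) fun z => ?_
  · filter_upwards [ht.eventually h3] with z hz
    rw [hz, pow_two z.1]
    have h0 := speed_pos a z.1
    have h1 : √(1 + deriv a z.1 * deriv a z.1) = speed a z.1 := by rw [speed, pow_two]
    have h2 : 1 + deriv a z.1 * deriv a z.1 = speed a z.1 ^ 2 := by rw [speed_sq, pow_two]
    rw [h1, h2, sub_sub_cancel, mul_inv, one_div, inv_inv]
    field_simp
  all_goals
    field_simp
    ring

/-- The expansion of the arc length, on the plane of `t = z.1`. -/
theorem orderGE_arcLength (ha : IsWall a ε k₀ k₁ k₂) :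
    OrderGE 5 fun z : ℝ × ℝ => arcLength a z.1 - (z.1 + 2 / 3 * k₀ ^ 2 * z.1 ^ 3) := by
  -- the derivative of the remainder
  have h1 : OrderGE 4 fun z : ℝ × ℝ => speed a z.1 - (1 + 2 * k₀ ^ 2 * z.1 ^ 2) := by
    have h2 : OrderGE 4 fun z : ℝ × ℝ => deriv a z.1 * deriv a z.1 - 4 * k₀ ^ 2 * z.1 ^ 2
        - 4 * k₀ ^ 4 * z.1 ^ 4 := by
      have jd := ha.isOddJet_deriv.mul ha.isOddJet_deriv
      refine (((jd.rem.mono (by norm_num)).add jd.four).sub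
        ((orderGE_fst.pow 4).const_mul (4 * k₀ ^ 4))).congr fun z => ?_
      ring
    refine Asymptotics.IsBigO.trans (Asymptotics.IsBigO.of_bound 1
      (Eventually.of_forall fun z => ?_)) h2
    have h3 := one_le_speed a z.1
    have h4 : deriv a z.1 * deriv a z.1 - 4 * k₀ ^ 2 * z.1 ^ 2 - 4 * k₀ ^ 4 * z.1 ^ 4 =
        (speed a z.1 - (1 + 2 * k₀ ^ 2 * z.1 ^ 2))
          * (speed a z.1 + (1 + 2 * k₀ ^ 2 * z.1 ^ 2)) := by
      linear_combination -speed_sq a z.1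
    rw [h4, norm_mul, one_mul]
    refine le_mul_of_one_le_right (norm_nonneg _) ?_
    rw [Real.norm_eq_abs]
    refine le_trans ?_ (le_abs_self _)
    nlinarith [sq_nonneg (k₀ * z.1)]
  obtain ⟨C, hC⟩ := h1.bound
  have hC1 : ∀ᶠ t : ℝ in 𝓝 0, |speed a t - (1 + 2 * k₀ ^ 2 * t ^ 2)| ≤ C * |t| ^ 4 := by
    have ht : Tendsto (fun t : ℝ => (t, (0 : ℝ))) (𝓝 0) (𝓝 0) := by
      have : ContinuousAt (fun t : ℝ => (t, (0 : ℝ))) 0 := by fun_prop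
      exact this
    filter_upwards [ht.eventually hC] with t h
    simpa [Prod.norm_def] using h
  obtain ⟨δ, hδ, hball⟩ := Metric.eventually_nhds_iff_ball.1 (hC1.and ha.nhds_zero)
  refine Asymptotics.IsBigO.of_bound |C| ?_
  filter_upwards [(OrderGE.tendsto (k := 0) orderGE_fst) (Metric.ball_mem_nhds 0 hδ)] with z hz
  have hz' : |z.1| < δ := by simpa using hz
  have hin : ∀ t ∈ Icc (-|z.1|) |z.1|, t ∈ Metric.ball (0 : ℝ) δ := fun t ht => by
    rw [mem_ball_zero_iff, Real.norm_eq_abs]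
    exact (abs_le.2 ht).trans_lt hz'
  have h5 : ∀ t ∈ Icc (-|z.1|) |z.1|, HasDerivWithinAt
      (fun t => arcLength a t - (t + 2 / 3 * k₀ ^ 2 * t ^ 3))
      (speed a t - (1 + 2 * k₀ ^ 2 * t ^ 2)) (Icc (-|z.1|) |z.1|) t := fun t ht => by
    refine HasDerivAt.hasDerivWithinAt ?_
    refine ((ha.hasDerivAt_arcLength (hball t (hin t ht)).2).sub ((hasDerivAt_id t).add
      ((hasDerivAt_pow 3 t).const_mul (2 / 3 * k₀ ^ 2)))).congr_deriv ?_
    norm_num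
    ring
  have h6 := (convex_Icc (-|z.1|) |z.1|).norm_image_sub_le_of_norm_hasDerivWithin_le h5
    (C := |C| * |z.1| ^ 4) (fun t ht => ?_) (x := 0) (y := z.1)
    ⟨by simp, by simp⟩ ⟨neg_abs_le _, le_abs_self _⟩
  · rw [arcLength_zero] at h6
    simp only [sub_zero, ne_eq, OfNat.ofNat_ne_zero, not_false_eq_true, zero_pow, mul_zero,
      add_zero, Real.norm_eq_abs] at h6
    rw [Real.norm_eq_abs, norm_pow, norm_norm]
    refine h6.trans ?_
    rw [mul_assoc, ← pow_succ]
    refine mul_le_mul_of_nonneg_left (pow_le_pow_left₀ (abs_nonneg _) ?_ 5) (abs_nonneg _)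
    exact norm_fst_le z
  · have h7 := (hball t (hin t ht)).1
    rw [Real.norm_eq_abs]
    refine h7.trans (mul_le_mul (le_abs_self C) ?_ (by positivity) (abs_nonneg _))
    exact pow_le_pow_left₀ (abs_nonneg _) (abs_le.2 ht) 4

/-- The radius of curvature at the origin and its derivatives with respect to the arc
length. -/
theorem radius_derivs (ha : IsWall a ε k₀ k₁ k₂) (hk : k₀ ≠ 0) :
    radius a ε 0 = 1 / (2 * k₀) ∧
    iteratedDeriv 2 (radius a ε) 0 = 6 * k₀ - 6 * k₁ / k₀ ^ 2 ∧
    iteratedDeriv 4 (radius a ε) 0 = -24 * k₀ ^ 3 - 48 * k₁ + 432 * k₁ ^ 2 / k₀ ^ 3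
      - 180 * k₂ / k₀ ^ 2 := by
  set S : ℝ × ℝ → ℝ := fun z => arcLength a z.1 with hS
  have hS5 := ha.orderGE_arcLength
  have hS1 : OrderGE 1 S := by
    refine (((hS5.mono (by norm_num)).add orderGE_fst).add
      (((orderGE_fst.pow 3).const_mul (2 / 3 * k₀ ^ 2)).mono (by norm_num))).congr fun z => ?_
    rw [hS]
    ring
  have hT := taylor_isBigO_five (ha.smoothAt_radius hk)
  set r1 := deriv (radius a ε) 0
  set r2 := iteratedDeriv 2 (radius a ε) 0
  set r3 := iteratedDeriv 3 (radius a ε) 0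
  set r4 := iteratedDeriv 4 (radius a ε) 0
  set r0 := radius a ε 0
  have h1 : OrderGE 5 fun z => radius a ε (S z) - (r0 + r1 * S z + r2 / 2 * S z ^ 2
      + r3 / 6 * S z ^ 3 + r4 / 24 * S z ^ 4) :=
    (hT.comp_tendsto (OrderGE.tendsto (k := 0) hS1)).trans (hS1.pow 5)
  have h2 : OrderGE 5 fun z : ℝ × ℝ => radius a ε (S z) - (1 / (2 * k₀)
      + (3 * k₀ - 3 * k₁ / k₀ ^ 2) * z.1 ^ 2
      + (3 * k₀ ^ 3 - 6 * k₁ + 18 * k₁ ^ 2 / k₀ ^ 3 - 15 / 2 * k₂ / k₀ ^ 2) * z.1 ^ 4) := by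
    refine ((ha.isEvenJet_radius hk).rem.mono (show 5 ≤ 6 by norm_num)).congr' ?_ EventuallyEq.rfl
    filter_upwards [(OrderGE.tendsto (k := 0) orderGE_fst).eventually ha.nhds_zero] with z hz
    rw [radius, hS, ha.arcParam_arcLength hz]
  set T : ℝ × ℝ → ℝ := fun z => z.1 + 2 / 3 * k₀ ^ 2 * z.1 ^ 3 with hTdef
  have hT1 : OrderGE 1 T := orderGE_fst.add
      (((orderGE_fst.pow 3).const_mul (2 / 3 * k₀ ^ 2)).mono (by norm_num))
  have hp : ∀ n : ℕ, OrderGE 5 fun z => S z ^ (n + 1) - T z ^ (n + 1) := by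
    intro n
    induction n with
    | zero => simpa using hS5
    | succ n ih =>
      have e1 := (ih.mul hS1).mono (show 5 ≤ 5 + 1 by norm_num)
      have e2 := ((hT1.pow (n + 1)).mul hS5).mono (show 5 ≤ 1 * (n + 1) + 5 by omega)
      refine (e1.add e2).congr fun z => ?_
      simp only [hS, hTdef]
      ring
  set q : ℕ → ℝ := fun k => match k with
    | 0 => 1 / (2 * k₀) - r0
    | 1 => -r1
    | 2 => 3 * k₀ - 3 * k₁ / k₀ ^ 2 - r2 / 2
    | 3 => -(2 / 3 * k₀ ^ 2 * r1) - r3 / 6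
    | 4 => 3 * k₀ ^ 3 - 6 * k₁ + 18 * k₁ ^ 2 / k₀ ^ 3 - 15 / 2 * k₂ / k₀ ^ 2
      - (r4 / 24 + 2 / 3 * k₀ ^ 2 * r2)
    | _ => 0 with hq
  have h3 : OrderGE 5 fun z : ℝ × ℝ => ∑ k ∈ Finset.range 5, z.1 ^ k * q k := by
    have e1 := (hp 0).const_mul r1
    have e2 := (hp 1).const_mul (r2 / 2)
    have e3 := (hp 2).const_mul (r3 / 6)
    have e4 := (hp 3).const_mul (r4 / 24)
    have f : ∀ n : ℕ, 5 ≤ n → ∀ c : ℝ, OrderGE 5 fun z : ℝ × ℝ => c * z.1 ^ n := fun n hn c =>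
      ((orderGE_fst.pow n).const_mul c).mono (by omega)
    set σ := 2 / 3 * k₀ ^ 2 with hσ
    have g := (((((((f 6 (by norm_num) (r2 / 2 * σ ^ 2)).add (f 5 (by norm_num) (r3 / 2 * σ))).add
      (f 7 (by norm_num) (r3 / 2 * σ ^ 2))).add (f 9 (by norm_num) (r3 / 6 * σ ^ 3))).add
      (f 6 (by norm_num) (r4 / 6 * σ))).add (f 8 (by norm_num) (r4 / 4 * σ ^ 2))).add
      (f 10 (by norm_num) (r4 / 6 * σ ^ 3))).add (f 12 (by norm_num) (r4 / 24 * σ ^ 4))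
    refine (((((((h1.sub h2).add e1).add e2).add e3).add e4).add g)).congr fun z => ?_
    simp only [Finset.sum_range_succ, Finset.sum_range_zero, hq, hTdef]
    ring
  have h4 := coeff_eq_zero_of_isBigO 5 (q := fun k => (q k : ℂ)) (by
    have ht : Tendsto (fun t : ℝ => (t, (0 : ℝ))) (𝓝[≠] 0) (𝓝 0) := by
      have : ContinuousAt (fun t : ℝ => (t, (0 : ℝ))) 0 := by fun_prop
      exact this.tendsto.mono_left nhdsWithin_le_nhds
    have h5 := h3.comp_tendsto ht
    refine Asymptotics.IsBigO.of_norm_left ?_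
    refine (h5.norm_left.congr_left fun t => ?_).trans (Asymptotics.IsBigO.of_bound 1
      (Eventually.of_forall fun t => ?_))
    · rw [Function.comp_apply, ← Complex.norm_real]
      push_cast
      rfl
    · simp [Prod.norm_def])
  have q0 : q 0 = 0 := Complex.ofReal_eq_zero.1 (h4 0 (by norm_num))
  have q2 : q 2 = 0 := Complex.ofReal_eq_zero.1 (h4 2 (by norm_num))
  have q4 : q 4 = 0 := Complex.ofReal_eq_zero.1 (h4 4 (by norm_num))
  simp only [hq] at q0 q2 q4
  have e2 : r2 = 6 * k₀ - 6 * k₁ / k₀ ^ 2 := by linear_combination -2 * q2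
  refine ⟨by linarith, e2, ?_⟩
  rw [e2] at q4
  have : k₀ ^ 2 * (k₁ / k₀ ^ 2) = k₁ := by field_simp
  linear_combination -24 * q4 + 96 * this

end IsWall

/-! ### The billiard map near the periodic orbit -/

/-- Maps that agree to order `M` still do so after the application of a smooth map. -/
theorem OrderGE.comp_sub {F : ℝ × ℝ → ℝ × ℝ} (hF : ContDiffAt ℝ ∞ F 0) {M : ℕ}
    {u v : ℝ × ℝ → ℝ × ℝ} (hu : OrderGE 1 u) (hv : OrderGE 1 v)
    (h : OrderGE M fun z => u z - v z) : OrderGE M fun z => F (u z) - F (v z) := by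
  obtain ⟨K, s, hs, hK⟩ := (hF.of_le
    (show (1 : WithTop ℕ∞) ≤ ∞ by exact_mod_cast le_top)).exists_lipschitzOnWith
  refine Asymptotics.IsBigO.trans (Asymptotics.IsBigO.of_bound K ?_) h
  filter_upwards [OrderGE.tendsto (k := 0) hu hs, OrderGE.tendsto (k := 0) hv hs] with z h1 h2
  exact hK.norm_sub_le h1 h2

theorem OrderGE.prodMk {M : ℕ} {u v : ℝ × ℝ → ℝ} (hu : OrderGE M u) (hv : OrderGE M v) :
    OrderGE M fun z => (u z, v z) :=
  Asymptotics.IsBigO.prod_left hu hv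

theorem fderiv_apply_fst {F : Type*} [NormedAddCommGroup F] [NormedSpace ℝ F] {f : ℝ × ℝ → F}
    {z : ℝ × ℝ} (hf : DifferentiableAt ℝ f z) {f' : F}
    (h : HasDerivAt (fun t => f (t, z.2)) f' z.1) : fderiv ℝ f z (1, 0) = f' :=
  (hf.hasFDerivAt.comp_hasDerivAt (f := fun t : ℝ => (t, z.2)) z.1
    ((hasDerivAt_id z.1).prodMk (hasDerivAt_const z.1 z.2))).unique h

theorem fderiv_apply_snd {F : Type*} [NormedAddCommGroup F] [NormedSpace ℝ F] {f : ℝ × ℝ → F}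
    {z : ℝ × ℝ} (hf : DifferentiableAt ℝ f z) {f' : F}
    (h : HasDerivAt (fun t => f (z.1, t)) f' z.2) : fderiv ℝ f z (0, 1) = f' :=
  (hf.hasFDerivAt.comp_hasDerivAt (f := fun t : ℝ => (z.1, t)) z.2
    ((hasDerivAt_const z.2 z.1).prodMk (hasDerivAt_id z.2))).unique h

namespace IsWall

variable {a : ℝ → ℝ} {ε k₀ k₁ k₂ : ℝ}

theorem smooth_phaseCoord (ha : IsWall a ε k₀ k₁ k₂) :
    ContDiffOn ℝ ∞ (phaseCoord a) {q | q.1 ∈ Ioo (-ε) ε} := by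
  have h1 : ContDiffOn ℝ ∞ (fun q : ℝ × ℝ => arcLength a q.1) {q | q.1 ∈ Ioo (-ε) ε} :=
    ha.smooth_arcLength.comp contDiffOn_fst fun q hq => hq
  have h2 : ContDiffOn ℝ ∞ (fun q : ℝ × ℝ => speed a q.1) {q | q.1 ∈ Ioo (-ε) ε} :=
    ha.smooth_speed.comp contDiffOn_fst fun q hq => hq
  exact h1.prodMk (contDiffOn_snd.div h2 fun q _ => (speed_pos a q.1).ne')

theorem isOpen_domain : IsOpen {q : ℝ × ℝ | q.1 ∈ Ioo (-ε) ε} :=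
  isOpen_Ioo.preimage continuous_fst

theorem smoothAt_phaseCoord (ha : IsWall a ε k₀ k₁ k₂) : ContDiffAt ℝ ∞ (phaseCoord a) 0 :=
  ha.smooth_phaseCoord.contDiffAt (isOpen_domain.mem_nhds ha.zero_mem)

theorem phaseCoord_zero : phaseCoord a 0 = 0 := by
  simp [phaseCoord, arcLength_zero]

theorem det_phaseCoord (ha : IsWall a ε k₀ k₁ k₂) {q : ℝ × ℝ} (hq : q.1 ∈ Ioo (-ε) ε) :
    (fderiv ℝ (phaseCoord a) q).det = 1 := by
  have hd : DifferentiableAt ℝ (phaseCoord a) q :=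
    (ha.smooth_phaseCoord.contDiffAt (isOpen_domain.mem_nhds hq)).differentiableAt (by simp)
  have hs := ((ha.smooth_speed.contDiffAt (isOpen_Ioo.mem_nhds hq)).differentiableAt
    (by simp)).hasDerivAt
  have h0 := (speed_pos a q.1).ne'
  have h1 := fderiv_apply_fst hd ((ha.hasDerivAt_arcLength hq).prodMk
    ((hasDerivAt_const q.1 q.2).div hs h0))
  have h2 := fderiv_apply_snd hd ((hasDerivAt_const q.2 (arcLength a q.1)).prodMk
    ((hasDerivAt_id q.2).div_const (speed a q.1)))
  rw [det_eq, h1, h2]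
  simp [h0]

theorem smoothAt_momentum (ha : IsWall a ε k₀ k₁ k₂) {L : ℝ} (hL : 0 < L) :
    ∃ U : Set (ℝ × ℝ), IsOpen U ∧ 0 ∈ U ∧ (∀ q ∈ U, q.1 ∈ Ioo (-ε) ε ∧ q.2 ∈ Ioo (-ε) ε) ∧
      ContDiffOn ℝ ∞ (fun q => momentum a L q.1 q.2) U := by
  obtain ⟨δ, hδ, hδL, hδε, hb, -⟩ := ha.exists_bounds hL
  refine ⟨Ioo (-δ) δ ×ˢ Ioo (-δ) δ, isOpen_Ioo.prod isOpen_Ioo, ⟨⟨by simpa, by simpa⟩,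
    ⟨by simpa, by simpa⟩⟩, fun q hq => ⟨hδε hq.1, hδε hq.2⟩, ?_⟩
  have h1 : ContDiffOn ℝ ∞ (fun q : ℝ × ℝ => a q.1) (Ioo (-δ) δ ×ˢ Ioo (-δ) δ) :=
    ha.smooth.comp contDiffOn_fst fun q hq => hδε hq.1
  have h2 : ContDiffOn ℝ ∞ (fun q : ℝ × ℝ => a q.2) (Ioo (-δ) δ ×ˢ Ioo (-δ) δ) :=
    ha.smooth.comp contDiffOn_snd fun q hq => hδε hq.2
  have h3 : ContDiffOn ℝ ∞ (fun q : ℝ × ℝ => deriv a q.1) (Ioo (-δ) δ ×ˢ Ioo (-δ) δ) :=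
    ha.smooth_deriv.comp contDiffOn_fst fun q hq => hδε hq.1
  have hsum : ContDiffOn ℝ ∞ (fun q : ℝ × ℝ => q.1 + q.2) (Ioo (-δ) δ ×ˢ Ioo (-δ) δ) := by fun_prop
  have hD := (contDiffOn_const (c := L)).sub h1 |>.sub h2
  have hpos : ∀ q ∈ Ioo (-δ) δ ×ˢ Ioo (-δ) δ, 0 < (L - a q.1 - a q.2) ^ 2 + (q.1 + q.2) ^ 2 := by
    intro q hq
    have e1 := abs_lt.1 (hb _ hq.1)
    have e2 := abs_lt.1 (hb _ hq.2)
    have : 0 < L - a q.1 - a q.2 := by linarith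
    positivity
  exact (hsum.sub (hD.mul h3)).div (((hD.pow 2).add (hsum.pow 2)).sqrt fun q hq => (hpos q hq).ne')
    fun q hq => (Real.sqrt_pos.2 (hpos q hq)).ne'

theorem momentum_zero (ha : IsWall a ε k₀ k₁ k₂) (L : ℝ) : momentum a L 0 0 = 0 := by
  simp [momentum, ha.deriv_zero]

theorem hasDerivAt_momentum_zero (ha : IsWall a ε k₀ k₁ k₂) {L : ℝ} (hL : 0 < L) :
    HasDerivAt (momentum a L 0) (1 / L) 0 := by
  have hc : ContinuousAt a 0 := (ha.hasDerivAt ha.zero_mem).continuousAt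
  have h1 : ContinuousAt (fun σ : ℝ => 1 / √((L - a 0 - a σ) ^ 2 + (0 + σ) ^ 2)) 0 := by
    refine ContinuousAt.div continuousAt_const (by fun_prop) ?_
    rw [ha.apply_zero]
    simp [Real.sqrt_sq hL.le, hL.ne']
  rw [hasDerivAt_iff_tendsto_slope]
  have h2 : Tendsto (fun σ : ℝ => 1 / √((L - a 0 - a σ) ^ 2 + (0 + σ) ^ 2)) (𝓝[≠] 0)
      (𝓝 (1 / L)) := by
    have := h1.tendsto.mono_left (nhdsWithin_le_nhds (s := {0}ᶜ))
    rw [ha.apply_zero] at this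
    simpa [Real.sqrt_sq hL.le, ha.apply_zero] using this
  refine h2.congr' ?_
  filter_upwards [self_mem_nhdsWithin] with σ hσ
  have hσ' : σ ≠ 0 := hσ
  rw [slope_def_field, ha.momentum_zero, momentum, ha.deriv_zero]
  field_simp
  ring

/-- The two momenta of a chord as coordinates of the phase space, and the billiard map in terms of
them. -/
theorem exists_chord_chart (ha : IsWall a ε k₀ k₁ k₂) {L : ℝ} (hL : 0 < L) :
    map (fun q : ℝ × ℝ => phaseCoord a (q.1, momentum a L q.1 q.2)) (𝓝 0) = 𝓝 0 ∧
      ContDiffAt ℝ ∞ (oneStep a L ε) 0 ∧ oneStep a L ε 0 = 0 ∧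
      ∀ᶠ q in 𝓝 (0 : ℝ × ℝ), oneStep a L ε (phaseCoord a (q.1, momentum a L q.1 q.2)) =
        phaseCoord a (q.2, -momentum a L q.2 q.1) := by
  obtain ⟨U, hU, hU0, hUε, hm⟩ := ha.smoothAt_momentum hL
  have hev : ∀ᶠ q in 𝓝 (0 : ℝ × ℝ), oneStep a L ε (phaseCoord a (q.1, momentum a L q.1 q.2)) =
        phaseCoord a (q.2, -momentum a L q.2 q.1) := by
    filter_upwards [ha.eventually_billiardMap hL] with q hq
    rw [oneStep, hq 0]
  set g : ℝ × ℝ → ℝ × ℝ := fun q => phaseCoord a (q.1, momentum a L q.1 q.2) with hg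
  have hΦ : ContDiffOn ℝ ∞ (fun q : ℝ × ℝ => (q.1, momentum a L q.1 q.2)) U :=
    contDiffOn_fst.prodMk hm
  have hgs : ContDiffOn ℝ ∞ g U := ha.smooth_phaseCoord.comp hΦ fun q hq => (hUε q hq).1
  have hg0 : g 0 = 0 := by
    simp only [hg, Prod.fst_zero, Prod.snd_zero, ha.momentum_zero]
    exact phaseCoord_zero
  have hdet : (fderiv ℝ g 0).det ≠ 0 := by
    have d1 : HasFDerivAt (fun q : ℝ × ℝ => (q.1, momentum a L q.1 q.2))
        (fderiv ℝ (fun q : ℝ × ℝ => (q.1, momentum a L q.1 q.2)) 0) 0 :=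
      ((hΦ.contDiffAt (hU.mem_nhds hU0)).differentiableAt (by simp)).hasFDerivAt
    have d2 : HasFDerivAt (phaseCoord a) (fderiv ℝ (phaseCoord a) 0)
        ((0 : ℝ × ℝ).1, momentum a L (0 : ℝ × ℝ).1 (0 : ℝ × ℝ).2) := by
      have e : ((0 : ℝ × ℝ).1, momentum a L (0 : ℝ × ℝ).1 (0 : ℝ × ℝ).2) = (0 : ℝ × ℝ) := by
        rw [Prod.fst_zero, Prod.snd_zero, ha.momentum_zero]
        rfl
      rw [e]
      exact (ha.smoothAt_phaseCoord.differentiableAt (by simp)).hasFDerivAt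
    have d3 : fderiv ℝ g 0 = (fderiv ℝ (phaseCoord a) 0).comp
        (fderiv ℝ (fun q : ℝ × ℝ => (q.1, momentum a L q.1 q.2)) 0) :=
      (HasFDerivAt.comp (g := phaseCoord a) (0 : ℝ × ℝ) d2 d1).fderiv
    have dm : DifferentiableAt ℝ (fun q : ℝ × ℝ => momentum a L q.1 q.2) 0 :=
      (hm.contDiffAt (hU.mem_nhds hU0)).differentiableAt (by simp)
    have d4 := (hasFDerivAt_fst.prodMk dm.hasFDerivAt).fderiv
    rw [d3, det_comp, ha.det_phaseCoord ha.zero_mem, one_mul, d4, det_eq]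
    have d5 : fderiv ℝ (fun q : ℝ × ℝ => momentum a L q.1 q.2) 0 (0, 1) = 1 / L :=
      fderiv_apply_snd dm (ha.hasDerivAt_momentum_zero hL)
    simp [d5, hL.ne']
  obtain ⟨k, hkg, hk0, hkU, -, hks⟩ := exists_smooth_chart hU hU0 hgs hdet
  have hkt : (0 : ℝ × ℝ) ∈ k.target := by
    have := k.map_source hk0
    rwa [hkg, hg0] at this
  have hks0 : k.symm 0 = 0 := by
    have := k.left_inv hk0
    rwa [hkg, hg0] at this
  refine ⟨?_, ?_, ?_, hev⟩
  · have := k.map_nhds_eq hk0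
    rwa [hkg, hg0] at this
  · have hc : ContDiffAt ℝ ∞ k.symm 0 := hks.contDiffAt (k.open_target.mem_nhds hkt)
    have hm0 : ContDiffAt ℝ ∞ (fun q : ℝ × ℝ => momentum a L q.1 q.2) 0 :=
      hm.contDiffAt (hU.mem_nhds hU0)
    have hsw : ContDiffAt ℝ ∞ (fun q : ℝ × ℝ => momentum a L q.2 q.1) 0 :=
      ContDiffAt.comp (f := fun q : ℝ × ℝ => (q.2, q.1)) (0 : ℝ × ℝ) hm0
        (contDiffAt_snd.prodMk contDiffAt_fst)
    have hΦ' : ContDiffAt ℝ ∞ (fun q : ℝ × ℝ => (q.2, -momentum a L q.2 q.1)) 0 :=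
      contDiffAt_snd.prodMk hsw.neg
    have h1 : ContDiffAt ℝ ∞ (fun q : ℝ × ℝ => phaseCoord a (q.2, -momentum a L q.2 q.1)) 0 := by
      refine ContDiffAt.comp (g := phaseCoord a) (0 : ℝ × ℝ) ?_ hΦ'
      simp only [Prod.fst_zero, Prod.snd_zero, ha.momentum_zero, neg_zero]
      exact ha.smoothAt_phaseCoord
    have h2 : ContDiffAt ℝ ∞ (fun p => phaseCoord a ((k.symm p).2,
        -momentum a L (k.symm p).2 (k.symm p).1)) 0 := by
      refine ContDiffAt.comp (g := fun q : ℝ × ℝ => phaseCoord a (q.2, -momentum a L q.2 q.1))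
        (0 : ℝ × ℝ) ?_ hc
      rwa [hks0]
    refine h2.congr_of_eventuallyEq ?_
    have ht : Tendsto k.symm (𝓝 0) (𝓝 0) := by
      have := hc.continuousAt
      rwa [ContinuousAt, hks0] at this
    filter_upwards [ht.eventually hev, k.open_target.mem_nhds hkt] with p hp hpt
    rw [← hp]
    congr 1
    have := k.right_inv hpt
    rw [hkg] at this
    exact this.symm
  · have h1 := hev.self_of_nhds
    have h2 : phaseCoord a ((0 : ℝ × ℝ).1, momentum a L (0 : ℝ × ℝ).1 (0 : ℝ × ℝ).2) = 0 := hg0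
    rw [h2] at h1
    rw [h1]
    simp only [Prod.fst_zero, Prod.snd_zero, ha.momentum_zero, neg_zero]
    exact phaseCoord_zero

/-- Near the periodic orbit the billiard map exchanges the walls and is the same on both. -/
theorem eventually_billiardMap_eq_oneStep (ha : IsWall a ε k₀ k₁ k₂) {L : ℝ} (hL : 0 < L)
    (j : Fin 2) : ∀ᶠ p in 𝓝 (0 : ℝ × ℝ), billiardMap a L ε (j, p) = (1 - j, oneStep a L ε p) := by
  rw [← (ha.exists_chord_chart hL).1, eventually_map]
  filter_upwards [ha.eventually_billiardMap hL] with q hq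
  rw [oneStep, hq j, hq 0]

end IsWall

/-! ### From an invariant series to a normal form -/

theorem contDiff_twistMap (N : ℕ) (θ : ℝ) (τ : ℕ → ℝ) : ContDiff ℝ ∞ (twistMap N θ τ) := by
  have h : ContDiff ℝ ∞ fun z : ℝ × ℝ => angle N θ τ (z.1 ^ 2 + z.2 ^ 2) := by
    unfold angle
    refine contDiff_const.add (ContDiff.sum fun k _ => ?_)
    fun_prop
  have hc := Real.contDiff_cos.comp h
  have hs := Real.contDiff_sin.comp h
  exact ((contDiff_fst.mul hc).sub (contDiff_snd.mul hs)).prodMk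
    ((contDiff_fst.mul hs).add (contDiff_snd.mul hc))

/-- The twist map is reversed by the reflection `(x, y) ↦ (x, -y)`. -/
theorem twistMap_reversal (N : ℕ) (θ : ℝ) (τ : ℕ → ℝ) (z : ℝ × ℝ) :
    twistMap N θ τ ((twistMap N θ τ z).1, -(twistMap N θ τ z).2) = (z.1, -z.2) := by
  have h : (twistMap N θ τ z).1 ^ 2 + (-(twistMap N θ τ z).2) ^ 2 = z.1 ^ 2 + z.2 ^ 2 := by
    rw [neg_sq, twistMap_radiusSq]
  have h2 := Real.sin_sq_add_cos_sq (angle N θ τ (z.1 ^ 2 + z.2 ^ 2))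
  rw [twistMap]
  dsimp only
  rw [h]
  simp only [twistMap]
  ext
  · dsimp only
    linear_combination z.1 * h2
  · dsimp only
    linear_combination (-z.2) * h2

/-- The second half of the invariance: by reversibility it is a consequence of the first half. -/
theorem orderGE_momentum_reversed {a : ℝ → ℝ} {L : ℝ} {N M : ℕ} {θ : ℝ} {τ : ℕ → ℝ}
    {X W : ℝ × ℝ → ℝ} (heven : ∀ z : ℝ × ℝ, X (z.1, -z.2) = X z)
    (hodd : ∀ z : ℝ × ℝ, W (z.1, -z.2) = -W z)
    (hmom : OrderGE M fun z => momentum a L (X z) (X (twistMap N θ τ z)) - W z) :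
    OrderGE M fun z => -momentum a L (X (twistMap N θ τ z)) (X z) - W (twistMap N θ τ z) := by
  have h1 : OrderGE 1 fun z => ((twistMap N θ τ z).1, -(twistMap N θ τ z).2) :=
    (orderGE_fst.comp (orderGE_twistMap N θ τ)).prodMk
      (((orderGE_snd.comp (orderGE_twistMap N θ τ)).const_mul (-1)).congr fun z => by ring)
  refine ((hmom.comp h1).const_mul (-1)).congr fun z => ?_
  rw [twistMap_reversal, heven, heven, hodd]
  ring

namespace IsWall

variable {a : ℝ → ℝ} {ε k₀ k₁ k₂ : ℝ}

/-- The map `z ↦ (X z, W z)`, in the coordinates `(s, u)`, conjugates the twist map to the billiard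
map to the order to which the momentum of the chord from `X z` to `X (T z)` is `W z`. -/
theorem orderGE_oneStep_sub (ha : IsWall a ε k₀ k₁ k₂) {L : ℝ} (hL : 0 < L) {N M : ℕ} {θ : ℝ}
    {τ : ℕ → ℝ} {X W : ℝ × ℝ → ℝ} (hX : OrderGE 1 X) (hW : OrderGE 1 W)
    (heven : ∀ z : ℝ × ℝ, X (z.1, -z.2) = X z) (hodd : ∀ z : ℝ × ℝ, W (z.1, -z.2) = -W z)
    (hmom : OrderGE M fun z => momentum a L (X z) (X (twistMap N θ τ z)) - W z) (hM : 1 ≤ M) :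
    OrderGE M fun z => oneStep a L ε (phaseCoord a (X z, W z))
      - phaseCoord a (X (twistMap N θ τ z), W (twistMap N θ τ z)) := by
  obtain ⟨-, hf, hf0, hev⟩ := ha.exists_chord_chart hL
  have hΨ := ha.smoothAt_phaseCoord
  have hT := orderGE_twistMap N θ τ
  have hXT := hX.comp hT
  have hWT := hW.comp hT
  have hrev := orderGE_momentum_reversed heven hodd hmom
  set m : ℝ × ℝ → ℝ := fun z => momentum a L (X z) (X (twistMap N θ τ z)) with hm
  set m' : ℝ × ℝ → ℝ := fun z => -momentum a L (X (twistMap N θ τ z)) (X z) with hm'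
  have hm1 : OrderGE 1 m := ((hmom.mono hM).add hW).congr fun z => by ring
  have hm1' : OrderGE 1 m' := ((hrev.mono hM).add hWT).congr fun z => by ring
  have hΨO : ∀ {u : ℝ × ℝ → ℝ × ℝ}, OrderGE 1 u → OrderGE 1 fun z => phaseCoord a (u z) :=
    fun hu => (orderGE_of_contDiffAt hΨ phaseCoord_zero).comp hu
  have e1 : OrderGE M fun z => phaseCoord a (X z, W z) - phaseCoord a (X z, m z) := by
    refine OrderGE.comp_sub hΨ (hX.prodMk hW) (hX.prodMk hm1) ?_
    refine ((orderGE_zero M).prodMk (hmom.const_mul (-1))).congr fun z => ?_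
    ext <;> simp [hm]
  have e2 := OrderGE.comp_sub hf (hΨO (hX.prodMk hW)) (hΨO (hX.prodMk hm1)) e1
  have e3 : OrderGE M fun z => phaseCoord a (X (twistMap N θ τ z), m' z)
      - phaseCoord a (X (twistMap N θ τ z), W (twistMap N θ τ z)) := by
    refine OrderGE.comp_sub hΨ (hXT.prodMk hm1') (hXT.prodMk hWT) ?_
    refine ((orderGE_zero M).prodMk hrev).congr fun z => ?_
    ext <;> simp [hm']
  have e4 : ∀ᶠ z in 𝓝 (0 : ℝ × ℝ), oneStep a L ε (phaseCoord a (X z, m z)) =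
      phaseCoord a (X (twistMap N θ τ z), m' z) :=
    (OrderGE.tendsto (k := 0) (hX.prodMk hXT)).eventually hev
  refine (e2.add e3).congr' ?_ EventuallyEq.rfl
  filter_upwards [e4] with z hz
  rw [hz]
  abel

/-- An approximately invariant family of curves whose area form is `∂P / ∂y`, where `P` is close to
`y`, yields a normal form. -/
theorem exists_normalForm (ha : IsWall a ε k₀ k₁ k₂) {L : ℝ} (hL : 0 < L) {N : ℕ} {θ : ℝ}
    {τ : ℕ → ℝ} {X W P : ℝ × ℝ → ℝ} (hX : ContDiff ℝ ∞ X) (hW : ContDiff ℝ ∞ W) (hX0 : X 0 = 0)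
    (hW0 : W 0 = 0)
    (heven : ∀ z : ℝ × ℝ, X (z.1, -z.2) = X z) (hodd : ∀ z : ℝ × ℝ, W (z.1, -z.2) = -W z)
    (hmom : OrderGE (2 * N + 2) fun z => momentum a L (X z) (X (twistMap N θ τ z)) - W z)
    (hP : ContDiff ℝ ∞ P) (hP0 : P 0 = 0)
    (hdetP : ∀ z, (fderiv ℝ (fun z => (X z, W z)) z).det = fderiv ℝ P z (0, 1))
    (hPo : OrderGE (2 * N + 2) fun z => P z - z.2) :
    ∃ h, IsBirkhoffNormalForm (oneStep a L ε) N h θ τ := by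
  obtain ⟨-, hf, hf0, -⟩ := ha.exists_chord_chart hL
  have hX1 : OrderGE 1 X := orderGE_of_contDiffAt hX.contDiffAt hX0
  have hW1 : OrderGE 1 W := orderGE_of_contDiffAt hW.contDiffAt hW0
  have hmain := ha.orderGE_oneStep_sub hL hX1 hW1 heven hodd hmom (by omega)
  have hT := orderGE_twistMap N θ τ
  set T := twistMap N θ τ with hTdef
  set H : ℝ × ℝ → ℝ × ℝ := fun z => (X z, W z) with hH
  set F : ℝ × ℝ → ℝ × ℝ := fun z => phaseCoord a (H z) with hF
  set U : Set (ℝ × ℝ) := {z | X z ∈ Ioo (-ε) ε} with hU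
  have hUo : IsOpen U := isOpen_Ioo.preimage hX.continuous
  have hU0 : (0 : ℝ × ℝ) ∈ U := by
    rw [hU, mem_ofPred_eq, hX0]
    exact ha.zero_mem
  have hHs : ContDiff ℝ ∞ H := hX.prodMk hW
  have hFs : ContDiffOn ℝ ∞ F U := ha.smooth_phaseCoord.comp hHs.contDiffOn fun z hz => hz
  have hF0 : F 0 = 0 := by
    simp only [hF, hH, hX0, hW0]
    exact phaseCoord_zero
  have hdetF : ∀ z ∈ U, (fderiv ℝ F z).det = fderiv ℝ P z (0, 1) := fun z hz => by
    have d1 : HasFDerivAt H (fderiv ℝ H z) z := (hHs.differentiable (by simp) z).hasFDerivAt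
    have d2 : HasFDerivAt (phaseCoord a) (fderiv ℝ (phaseCoord a) (H z)) (H z) :=
      ((ha.smooth_phaseCoord.contDiffAt (isOpen_domain.mem_nhds hz)).differentiableAt
        (by simp)).hasFDerivAt
    have d3 : fderiv ℝ F z = (fderiv ℝ (phaseCoord a) (H z)).comp (fderiv ℝ H z) :=
      (d2.comp z d1).fderiv
    rw [d3, det_comp, ha.det_phaseCoord (q := H z) hz, one_mul, hdetP]
  have hP1 : fderiv ℝ P 0 (0, 1) = 1 := by
    have h1 : (fun z : ℝ × ℝ => P z - z.2) =O[𝓝 0] fun z => ‖z - 0‖ ^ (2 * N + 2) := by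
      simpa only [sub_zero] using hPo
    have h2 := ((h1.hasFDerivAt (𝕜 := ℝ) (by omega)).add hasFDerivAt_snd).fderiv
    have h3 : (fun z : ℝ × ℝ => P z - z.2) + Prod.snd = P := by
      funext z
      simp
    rw [h3] at h2
    rw [h2]
    simp
  obtain ⟨h, G, hG, hG0, hGt, hhG, hh0, hhs, hhdet, hhs', hGs'⟩ :=
    exists_symplectic_chart hUo hU0 hFs (by rw [hdetF 0 hU0, hP1]; exact one_ne_zero) hP hP0 hdetF
  have hGz : G 0 = 0 := by rw [hG]; simp [hP0]
  have hGt0 : (0 : ℝ × ℝ) ∈ G.target := by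
    have := G.map_source hG0
    rwa [hGz] at this
  have hGs0 : G.symm 0 = 0 := by
    have := G.left_inv hG0
    rwa [hGz] at this
  have hhz : h 0 = 0 := by rw [hhG, hGs0, hF0]
  have hht0 : (0 : ℝ × ℝ) ∈ h.target := by
    have := h.map_source hh0
    rwa [hhz] at this
  have hhs0 : h.symm 0 = 0 := by
    have := h.left_inv hh0
    rwa [hhz] at this
  have hhc : ContDiffAt ℝ ∞ h 0 := hhs.contDiffAt (h.open_source.mem_nhds hh0)
  have hhc' : ContDiffAt ℝ ∞ h.symm 0 := hhs'.contDiffAt (h.open_target.mem_nhds hht0)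
  have hGc' : ContDiffAt ℝ ∞ G.symm 0 := hGs'.contDiffAt (G.open_target.mem_nhds hGt0)
  have hh1 : OrderGE 1 h := orderGE_of_contDiffAt hhc hhz
  have hfh1 : OrderGE 1 fun p => oneStep a L ε (h p) := (orderGE_of_contDiffAt hf hf0).comp hh1
  set q : ℝ × ℝ → ℝ × ℝ := ⇑G.symm with hq
  have hq1 : OrderGE 1 q := orderGE_of_contDiffAt hGc' hGs0
  have hTq := hT.comp hq1
  have hF1 : OrderGE 1 F :=
    orderGE_of_contDiffAt (hFs.contDiffAt (hUo.mem_nhds hU0)) hF0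
  have hG1 : OrderGE (2 * N + 2) fun z => G z - z := by
    refine ((orderGE_zero (2 * N + 2)).prodMk hPo).congr fun z => ?_
    rw [hG]
    ext <;> simp
  have hGO : OrderGE 1 G := by
    refine ((hG1.mono (by omega)).add ((orderGE_fst.prodMk orderGE_snd).congr fun z => rfl)).congr
      fun z => ?_
    abel
  -- the correction `G` is negligible
  have hqp : OrderGE (2 * N + 2) fun p => q p - p := by
    refine ((hG1.comp hq1).neg_left).congr' ?_ EventuallyEq.rfl
    filter_upwards [G.open_target.mem_nhds hGt0] with p hp
    rw [hq, G.right_inv hp]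
    abel
  have e1 : OrderGE (2 * N + 2) fun p => h.symm (oneStep a L ε (h p)) - h.symm (F (T (q p))) := by
    refine OrderGE.comp_sub hhc' hfh1 (hF1.comp hTq) ((hmain.comp hq1).congr fun p => ?_)
    rw [hhG]
  have e2 : OrderGE (2 * N + 2) fun p => h.symm (oneStep a L ε (h p)) - G (T (q p)) := by
    refine e1.congr' ?_ EventuallyEq.rfl
    filter_upwards [OrderGE.tendsto (k := 0) hTq (G.open_source.mem_nhds hG0),
      OrderGE.tendsto (k := 0) (hGO.comp hTq) (h.open_source.mem_nhds hh0)] with p hp1 hp2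
    have h1 : h (G (T (q p))) = F (T (q p)) :=
      (hhG _).trans (congrArg F (G.left_inv hp1))
    rw [← h1, h.left_inv hp2]
  have e3 := hG1.comp hTq
  have e4 : OrderGE (2 * N + 2) fun p => T (q p) - T p :=
    OrderGE.comp_sub (contDiff_twistMap N θ τ).contDiffAt hq1
      ((orderGE_fst.prodMk orderGE_snd).congr fun z => rfl) hqp
  refine ⟨h, hh0, hhz, hhs, hhdet, OrderGE.tendsto (k := 0) hfh1 (h.open_target.mem_nhds hht0), ?_⟩
  exact ((e2.add e3).add e4).congr fun p => by abel

end IsWall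

/-! ### The area form of the Lindstedt series -/

theorem hasDerivAt_quintic {f : ℝ → ℝ} {c₀ c₁ c₂ c₃ c₄ c₅ : ℝ}
    (hf : ∀ t, f t = c₀ + c₁ * t + c₂ * t ^ 2 + c₃ * t ^ 3 + c₄ * t ^ 4 + c₅ * t ^ 5) (t : ℝ) :
    HasDerivAt f (c₁ + 2 * c₂ * t + 3 * c₃ * t ^ 2 + 4 * c₄ * t ^ 3 + 5 * c₅ * t ^ 4) t := by
  rw [show f = _ from funext hf]
  refine ((((((hasDerivAt_const t c₀).add ((hasDerivAt_id t).const_mul c₁)).add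
    ((hasDerivAt_pow 2 t).const_mul c₂)).add ((hasDerivAt_pow 3 t).const_mul c₃)).add
    ((hasDerivAt_pow 4 t).const_mul c₄)).add ((hasDerivAt_pow 5 t).const_mul c₅)).congr_deriv ?_
  norm_num
  ring

theorem hasDerivAt_odd_nonic {f : ℝ → ℝ} {c₀ c₂ c₄ c₆ c₈ : ℝ}
    (hf : ∀ t, f t = c₀ * t + c₂ * t ^ 3 / 3 + c₄ * t ^ 5 / 5 + c₆ * t ^ 7 / 7 + c₈ * t ^ 9 / 9)
    (t : ℝ) : HasDerivAt f (c₀ + c₂ * t ^ 2 + c₄ * t ^ 4 + c₆ * t ^ 6 + c₈ * t ^ 8) t := by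
  rw [show f = _ from funext hf]
  refine ((((((hasDerivAt_id t).const_mul c₀).add
    (((hasDerivAt_pow 3 t).const_mul c₂).div_const 3)).add
    (((hasDerivAt_pow 5 t).const_mul c₄).div_const 5)).add
    (((hasDerivAt_pow 7 t).const_mul c₆).div_const 7)).add
    (((hasDerivAt_pow 9 t).const_mul c₈).div_const 9)).congr_deriv ?_
  norm_num
  ring

theorem contDiff_position (α α₂ b B C : ℝ) : ContDiff ℝ ∞ (position α α₂ b B C) := by
  unfold position
  fun_prop

theorem contDiff_momentumSeries (w₁ w₂ w₃ w₄ w₅ : ℝ) :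
    ContDiff ℝ ∞ (momentumSeries w₁ w₂ w₃ w₄ w₅) := by
  unfold momentumSeries
  fun_prop

/-- The area form of the series has a polynomial primitive in the second variable, and the terms of
low degree of the area form can be read off from the coefficients. -/
theorem exists_areaPrimitive (α α₂ b B C w₁ w₂ w₃ w₄ w₅ : ℝ) :
    ∃ Q : ℝ × ℝ → ℝ, ContDiff ℝ ∞ Q ∧ Q 0 = 0 ∧
      (∀ z, (fderiv ℝ (fun z => (position α α₂ b B C z, momentumSeries w₁ w₂ w₃ w₄ w₅ z)) z).det =
        fderiv ℝ Q z (0, 1)) ∧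
      (w₁ = 3 * (α + b) → 3 * w₂ = α - 3 * b → (OrderGE 4 fun z => Q z + z.2) ∧
        (3 * (α + b) * w₁ - 5 * (α₂ + B + C) + w₃ = 0 →
          9 * (α + b) * w₂ - 3 * (α - 3 * b) * w₁ - 3 * (2 * α₂ - 2 * B - 10 * C) + 3 * w₄ = 0 →
          3 * (α - 3 * b) * w₂ - (α₂ - 3 * B + 5 * C) + 5 * w₅ = 0 →
          OrderGE 6 fun z => Q z + z.2)) := by
  set p₁ := α + b with hp₁
  set p₂ := α - 3 * b with hp₂
  set p₃ := α₂ + B + C with hp₃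
  set p₄ := 2 * α₂ - 2 * B - 10 * C with hp₄
  set p₅ := α₂ - 3 * B + 5 * C with hp₅
  -- the coefficients of the area form at `x ^ i * y ^ j`
  set d20 := w₁ - 3 * p₁ with h20
  set d02 := 3 * w₂ - p₂ with h02
  set d40 := 3 * p₁ * w₁ - 5 * p₃ + w₃ with h40
  set d22 := 9 * p₁ * w₂ - 3 * p₂ * w₁ - 3 * p₄ + 3 * w₄ with h22
  set d04 := 3 * p₂ * w₂ - p₅ + 5 * w₅ with h04
  set d60 := 3 * p₁ * w₃ + 5 * p₃ * w₁ with h60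
  set d42 := 9 * p₁ * w₄ - 7 * p₂ * w₃ + 15 * p₃ * w₂ - p₄ * w₁ with h42
  set d24 := 15 * p₁ * w₅ - p₂ * w₄ + 9 * p₄ * w₂ - 7 * p₅ * w₁ with h24
  set d06 := 5 * p₂ * w₅ + 3 * p₅ * w₂ with h06
  set d80 := 5 * p₃ * w₃ with h80
  set d62 := 15 * p₃ * w₄ - 5 * p₄ * w₃ with h62
  set d44 := 25 * p₃ * w₅ + 5 * p₄ * w₄ - 15 * p₅ * w₃ with h44
  set d26 := 15 * p₄ * w₅ - 5 * p₅ * w₄ with h26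
  set d08 := 5 * p₅ * w₅ with h08
  have mono : ∀ {k : ℕ} (m n : ℕ) (c : ℝ), k ≤ m + n → OrderGE k fun z : ℝ × ℝ =>
      c * (z.1 ^ m * z.2 ^ n) := fun m n c h =>
    (((orderGE_fst.pow m).mul (orderGE_snd.pow n)).const_mul c).mono (by omega)
  have high : OrderGE 6 fun z : ℝ × ℝ =>
      d60 * (z.1 ^ 6 * z.2 ^ 1) + d42 / 3 * (z.1 ^ 4 * z.2 ^ 3) + d24 / 5 * (z.1 ^ 2 * z.2 ^ 5)
      + d06 / 7 * (z.1 ^ 0 * z.2 ^ 7) + d80 * (z.1 ^ 8 * z.2 ^ 1) + d62 / 3 * (z.1 ^ 6 * z.2 ^ 3)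
      + d44 / 5 * (z.1 ^ 4 * z.2 ^ 5) + d26 / 7 * (z.1 ^ 2 * z.2 ^ 7)
      + d08 / 9 * (z.1 ^ 0 * z.2 ^ 9) :=
    ((((((((mono 6 1 _ (by norm_num)).add (mono 4 3 _ (by norm_num))).add
      (mono 2 5 _ (by norm_num))).add (mono 0 7 _ (by norm_num))).add
      (mono 8 1 _ (by norm_num))).add (mono 6 3 _ (by norm_num))).add
      (mono 4 5 _ (by norm_num))).add (mono 2 7 _ (by norm_num))).add (mono 0 9 _ (by norm_num))
  set Q : ℝ × ℝ → ℝ := fun z => (-1 + d20 * z.1 ^ 2 + d40 * z.1 ^ 4 + d60 * z.1 ^ 6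
      + d80 * z.1 ^ 8) * z.2
    + (d02 + d22 * z.1 ^ 2 + d42 * z.1 ^ 4 + d62 * z.1 ^ 6) * z.2 ^ 3 / 3
    + (d04 + d24 * z.1 ^ 2 + d44 * z.1 ^ 4) * z.2 ^ 5 / 5
    + (d06 + d26 * z.1 ^ 2) * z.2 ^ 7 / 7 + d08 * z.2 ^ 9 / 9 with hQ
  have hQs : ContDiff ℝ ∞ Q := by
    rw [hQ]
    fun_prop
  refine ⟨Q, hQs, by simp [hQ], fun z => ?_, fun e1 e2 => ⟨?_, fun e3 e4 e5 => ?_⟩⟩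
  · obtain ⟨x, y⟩ := z
    have hd : DifferentiableAt ℝ
        (fun z => (position α α₂ b B C z, momentumSeries w₁ w₂ w₃ w₄ w₅ z)) (x, y) :=
      ((contDiff_position α α₂ b B C).prodMk
        (contDiff_momentumSeries w₁ w₂ w₃ w₄ w₅)).differentiable (by simp) _
    have hx := fderiv_apply_fst hd (HasDerivAt.prodMk
      (hasDerivAt_quintic (c₀ := 0) (c₁ := 1 + p₂ * y ^ 2 + p₅ * y ^ 4) (c₂ := 0)
        (c₃ := p₁ + p₄ * y ^ 2) (c₄ := 0) (c₅ := p₃) (fun t => by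
          simp only [position, hp₁, hp₂, hp₃, hp₄, hp₅]
          ring) x)
      (hasDerivAt_quintic (c₀ := -y + w₂ * y ^ 3 + w₅ * y ^ 5) (c₁ := 0)
        (c₂ := w₁ * y + w₄ * y ^ 3) (c₃ := 0) (c₄ := w₃ * y) (c₅ := 0) (fun t => by
          simp only [momentumSeries]
          ring) x))
    have hy := fderiv_apply_snd hd (HasDerivAt.prodMk
      (hasDerivAt_quintic (c₀ := x + p₁ * x ^ 3 + p₃ * x ^ 5) (c₁ := 0)
        (c₂ := p₂ * x + p₄ * x ^ 3) (c₃ := 0) (c₄ := p₅ * x) (c₅ := 0) (fun t => by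
          simp only [position, hp₁, hp₂, hp₃, hp₄, hp₅]
          ring) y)
      (hasDerivAt_quintic (c₀ := 0) (c₁ := -1 + w₁ * x ^ 2 + w₃ * x ^ 4) (c₂ := 0)
        (c₃ := w₂ + w₄ * x ^ 2) (c₄ := 0) (c₅ := w₅) (fun t => by
          simp only [momentumSeries]
          ring) y))
    have hq := fderiv_apply_snd (hQs.differentiable (by simp) (x, y))
      (hasDerivAt_odd_nonic (c₀ := -1 + d20 * x ^ 2 + d40 * x ^ 4 + d60 * x ^ 6 + d80 * x ^ 8)
        (c₂ := d02 + d22 * x ^ 2 + d42 * x ^ 4 + d62 * x ^ 6)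
        (c₄ := d04 + d24 * x ^ 2 + d44 * x ^ 4) (c₆ := d06 + d26 * x ^ 2) (c₈ := d08)
        (fun t => by simp only [hQ]) y)
    rw [det_eq, hx, hy, hq]
    simp only [h20, h02, h40, h22, h04, h60, h42, h24, h06, h80, h62, h44, h26, h08]
    ring
  · have e20 : d20 = 0 := by rw [h20, e1]; ring
    have e02 : d02 = 0 := by rw [h02, e2]; ring
    refine ((((mono 4 1 d40 (by norm_num)).add (mono 2 3 (d22 / 3) (by norm_num))).add
      (mono 0 5 (d04 / 5) (by norm_num))).add (high.mono (show 4 ≤ 6 by norm_num))).congr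
      fun z => ?_
    simp only [hQ, e20, e02]
    ring
  · have e20 : d20 = 0 := by rw [h20, e1]; ring
    have e02 : d02 = 0 := by rw [h02, e2]; ring
    refine high.congr fun z => ?_
    simp only [hQ, e20, e02, e3, e4, e5]
    ring

/-! ### Existence of the normal forms -/

theorem position_neg (α α₂ b B C x y : ℝ) :
    position α α₂ b B C (x, -y) = position α α₂ b B C (x, y) := by
  simp only [position]
  ring

theorem momentumSeries_neg (w₁ w₂ w₃ w₄ w₅ x y : ℝ) :
    momentumSeries w₁ w₂ w₃ w₄ w₅ (x, -y) = -momentumSeries w₁ w₂ w₃ w₄ w₅ (x, y) := by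
  simp only [momentumSeries]
  ring

theorem smul_twistMap {N N' : ℕ} {θ κ : ℝ} {τ τ' : ℕ → ℝ}
    (h : ∀ ρ, angle N θ τ ρ = angle N' θ τ' (κ ^ 2 * ρ)) (z : ℝ × ℝ) :
    κ • twistMap N θ τ z = twistMap N' θ τ' (κ • z) := by
  have e : (κ * z.1) ^ 2 + (κ * z.2) ^ 2 = κ ^ 2 * (z.1 ^ 2 + z.2 ^ 2) := by ring
  ext
  · simp only [twistMap, Prod.smul_fst, Prod.smul_snd, smul_eq_mul, e, ← h]
    ring
  · simp only [twistMap, Prod.smul_fst, Prod.smul_snd, smul_eq_mul, e, ← h]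
    ring

theorem orderGE_smul (κ : ℝ) : OrderGE 1 fun z : ℝ × ℝ => κ • z :=
  ((orderGE_fst.const_mul κ).prodMk (orderGE_snd.const_mul κ)).congr fun _ => rfl

namespace IsWall

variable {a : ℝ → ℝ} {ε k₀ k₁ k₂ : ℝ}

/-- The rescaling by `κ` that makes the linear part of the series symplectic. -/
theorem exists_normalForm_of_rescaling (ha : IsWall a ε k₀ k₁ k₂) {L s κ θ : ℝ} (hL : 0 < L)
    (hκ : κ ^ 2 * (L * -s) = 1) {N N' : ℕ} {τ τ' : ℕ → ℝ}
    (hτ : ∀ ρ, angle N θ τ ρ = angle N' θ τ' (κ ^ 2 * ρ)) {α α₂ b B C w₁ w₂ w₃ w₄ w₅ : ℝ}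
    (hmom : OrderGE (2 * N + 2) fun z => momentum a L (L * position α α₂ b B C z)
      (L * position α α₂ b B C (twistMap N' θ τ' z)) - s * momentumSeries w₁ w₂ w₃ w₄ w₅ z)
    {Q : ℝ × ℝ → ℝ} (hQ : ContDiff ℝ ∞ Q) (hQ0 : Q 0 = 0)
    (hdetQ : ∀ z, (fderiv ℝ (fun z => (position α α₂ b B C z, momentumSeries w₁ w₂ w₃ w₄ w₅ z))
      z).det = fderiv ℝ Q z (0, 1))
    (hQo : OrderGE (2 * N + 2) fun z => Q z + z.2) :
    ∃ h, IsBirkhoffNormalForm (oneStep a L ε) N h θ τ := by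
  have hX := contDiff_position α α₂ b B C
  have hW := contDiff_momentumSeries w₁ w₂ w₃ w₄ w₅
  have hsm : ContDiff ℝ ∞ fun z : ℝ × ℝ => κ • z := by fun_prop
  refine ha.exists_normalForm hL (X := fun z => L * position α α₂ b B C (κ • z))
    (W := fun z => s * momentumSeries w₁ w₂ w₃ w₄ w₅ (κ • z))
    (P := fun z => κ * (L * s) * Q (κ • z)) (contDiff_const.mul (hX.comp hsm))
    (contDiff_const.mul (hW.comp hsm)) (by simp [position]) (by simp [momentumSeries])
    (fun z => ?_) (fun z => ?_) ?_ (contDiff_const.mul (hQ.comp hsm)) (by simp [hQ0])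
    (fun z => ?_) ?_
  · rw [← position_neg α α₂ b B C (κ • z).1]
    congr 2
    ext <;> simp
  · rw [show κ • (z.1, -z.2) = ((κ • z).1, -(κ • z).2) by ext <;> simp, momentumSeries_neg]
    ring
  · refine (hmom.comp (orderGE_smul κ)).congr fun z => ?_
    rw [smul_twistMap hτ]
  · have d0 : HasFDerivAt (fun z : ℝ × ℝ => κ • z)
        (κ • ContinuousLinearMap.id ℝ (ℝ × ℝ)) z := (hasFDerivAt_id z).const_smul κ
    have d1 := ((hX.prodMk hW).differentiable (by simp) (κ • z)).hasFDerivAt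
    have d2 := (hQ.differentiable (by simp) (κ • z)).hasFDerivAt
    set A := fderiv ℝ (fun z => (position α α₂ b B C z, momentumSeries w₁ w₂ w₃ w₄ w₅ z)) (κ • z)
      with hA
    set D : ℝ × ℝ →L[ℝ] ℝ × ℝ := (L • ContinuousLinearMap.fst ℝ ℝ ℝ).prod
      (s • ContinuousLinearMap.snd ℝ ℝ ℝ) with hD
    have d3 : HasFDerivAt (fun z => (L * position α α₂ b B C (κ • z),
        s * momentumSeries w₁ w₂ w₃ w₄ w₅ (κ • z)))
        (D.comp (A.comp (κ • ContinuousLinearMap.id ℝ (ℝ × ℝ)))) z :=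
      D.hasFDerivAt.comp z (d1.comp z d0)
    have d4 : HasFDerivAt (fun z => κ * (L * s) * Q (κ • z))
        ((κ * (L * s)) • (fderiv ℝ Q (κ • z)).comp (κ • ContinuousLinearMap.id ℝ (ℝ × ℝ))) z :=
      (d2.comp z d0).const_mul _
    rw [d3.fderiv, d4.fderiv, det_comp, det_comp, hdetQ, det_eq D, det_eq]
    simp [hD]
    ring
  · have h1 := ((hQo.comp (orderGE_smul κ)).const_mul (κ * (L * s)))
    refine h1.congr fun z => ?_
    simp only [Prod.smul_snd, smul_eq_mul]
    linear_combination (-z.2) * hκ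

end IsWall

namespace IsWall

variable {a : ℝ → ℝ} {ε k₀ k₁ k₂ : ℝ}

/-- A normal form of order one, for a wall with the scaled coefficient `quarticParam b c`. The
factor `κ` normalizes the area: the Lindstedt series multiplies it by `-L sin θ` to lowest order. -/
theorem exists_normalForm_one (ha : IsWall a ε k₀ k₁ k₂) {L c s κ θ b : ℝ} (hL : 0 < L)
    (hk₀ : k₀ * L = (1 + c) / 2) (hk₁ : k₁ * L ^ 3 = quarticParam b c) (hc : Real.cos θ = c)
    (hsin : Real.sin θ = s) (hs0 : s ≠ 0) (hκ : κ ^ 2 * (L * -s) = 1) :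
    ∃ h, IsBirkhoffNormalForm (oneStep a L ε) 1 h θ fun _ => s * twistOne b c * κ ^ 2 := by
  obtain ⟨φ, ψ, χ, hφ, hψ, -, hφ', hψ', -⟩ := ha.expansion
  have hs : s ^ 2 = 1 - c ^ 2 := by
    rw [← hc, ← hsin]
    linear_combination Real.sin_sq_add_cos_sq θ
  set τ' : ℕ → ℝ := fun k => if k = 1 then s * twistOne b c else 0 with hτ'
  obtain ⟨f₅, hf, -⟩ := isOddJet_momentum_position (τ := τ') (t₂ := 0) hL hφ hψ hφ' hψ' hk₀ hk₁ hc
    hsin hs hs0 (by simp [hτ']) (by simp [hτ']) 0 0 0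
  obtain ⟨Q, hQ, hQ0, hdetQ, hQo⟩ :=
    exists_areaPrimitive (amplOne b c) 0 b 0 0 (momA b c) (momB b c) 0 0 0
  refine ha.exists_normalForm_of_rescaling hL hκ (N' := 2) (τ' := τ') (fun ρ => ?_) ?_ hQ hQ0 hdetQ
    (hQo ?_ ?_).1
  · rw [angle_two]
    simp [angle, hτ']
    ring
  · refine ((hf.rem.mono (show 4 ≤ 6 by norm_num)).add
      (hf.five.mono (show 4 ≤ 5 by norm_num))).congr fun z => ?_
    simp only [momentumSeries]
    ring
  · simp only [momA, amplOne]
    ring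
  · simp only [momB, amplOne]
    ring

/-- A normal form of order two, for a wall with the scaled coefficients `quarticParam b c` and
`sexticParam b C c`. -/
theorem exists_normalForm_two (ha : IsWall a ε k₀ k₁ k₂) {L c s κ θ b C : ℝ} (hL : 0 < L)
    (hk₀ : k₀ * L = (1 + c) / 2) (hk₁ : k₁ * L ^ 3 = quarticParam b c)
    (hk₂ : k₂ * L ^ 5 = sexticParam b C c) (hc : Real.cos θ = c)
    (hsin : Real.sin θ = s) (hs0 : s ≠ 0) (hκ : κ ^ 2 * (L * -s) = 1) :
    ∃ h, IsBirkhoffNormalForm (oneStep a L ε) 2 h θ fun k =>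
      if k = 1 then s * twistOne b c * κ ^ 2 else s * twistTwo b C c * κ ^ 4 := by
  obtain ⟨φ, ψ, χ, hφ, hψ, -, hφ', hψ', -⟩ := ha.expansion
  have hs : s ^ 2 = 1 - c ^ 2 := by
    rw [← hc, ← hsin]
    linear_combination Real.sin_sq_add_cos_sq θ
  set τ' : ℕ → ℝ := fun k => if k = 1 then s * twistOne b c else s * twistTwo b C c with hτ'
  obtain ⟨f₅, hf, hf₅⟩ := isOddJet_momentum_position (τ := τ') (t₂ := twistTwo b C c) hL hφ hψ hφ'
    hψ' hk₀ hk₁ hc hsin hs hs0 (by simp [hτ']) (by simp [hτ']) (amplTwo b C c) (thirdTwo b C c) C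
  replace hf₅ := hf₅ rfl rfl rfl hk₂
  obtain ⟨Q, hQ, hQ0, hdetQ, hQo⟩ := exists_areaPrimitive (amplOne b c) (amplTwo b C c) b
    (thirdTwo b C c) C (momA b c) (momB b c) (momC b C c) (momD b C c) (momE b C c)
  refine ha.exists_normalForm_of_rescaling hL hκ (N' := 2) (τ' := τ') (fun ρ => ?_) ?_ hQ hQ0 hdetQ
    ((hQo ?_ ?_).2 ?_ ?_ ?_)
  · rw [angle_two, angle_two]
    simp [hτ']
    ring
  · refine hf.rem.congr fun z => ?_
    rw [hf₅]
    simp only [momentumSeries]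
    ring
  · simp only [momA, amplOne]
    ring
  · simp only [momB, amplOne]
    ring
  · simp only [momA, momC, amplOne, amplTwo, thirdTwo]
    ring
  · simp only [momA, momB, momD, amplOne, amplTwo, thirdTwo]
    ring
  · simp only [momB, momE, amplOne, amplTwo, thirdTwo]
    ring

end IsWall

/-! ### The twist coefficients in terms of the radius of curvature -/

/-- The first twist coefficient in terms of the radius of curvature; here `R` and `R2` are the
radius and its second derivative at the origin. -/
theorem twistOne_eq {L b c R R2 : ℝ} (hL : L ≠ 0) (h₁ : 1 + c ≠ 0) (h₂ : 1 - c ≠ 0)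
    (hR : R = L / (1 + c)) (hR2 : R2 = (3 * (1 + c) - 24 * quarticParam b c / (1 + c) ^ 2) / L) :
    -twistOne b c / L = 1 / (8 * R) - L / (8 * (2 * R - L)) * R2 := by
  have e1 : 2 * R - L = L * (1 - c) / (1 + c) := by
    rw [hR]
    field_simp
    ring
  rw [e1, hR2, hR]
  simp only [twistOne, quarticParam]
  field_simp
  ring

/-- The second twist coefficient, multiplied by `-sin θ` so that the square roots disappear, in
terms of the radius of curvature and its derivatives of orders two and four. -/
theorem twistTwo_eq {L b C c R R2 R4 : ℝ} (hL : L ≠ 0) (h₁ : 1 + c ≠ 0) (h₂ : 1 - c ≠ 0)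
    (h₃ : c ≠ 0) (hR : R = L / (1 + c))
    (hR2 : R2 = (3 * (1 + c) - 24 * quarticParam b c / (1 + c) ^ 2) / L)
    (hR4 : R4 = (-3 * (1 + c) ^ 3 - 48 * quarticParam b c
      + 3456 * quarticParam b c ^ 2 / (1 + c) ^ 3
      - 720 * sexticParam b C c / (1 + c) ^ 2) / L ^ 3) :
    -twistTwo b C c / L ^ 2 = 1 / 64 *
      (3 * (7 * R ^ 2 - 8 * R * L + 2 * L ^ 2) / (4 * R ^ 2 * (R - L)) * ((1 + c) / L)
        + (-(27 * R ^ 2 - 40 * R * L + 10 * L ^ 2) / (6 * R * (R - L) * (2 * R - L) ^ 2) * R2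
          + L * (31 * R ^ 2 - 36 * R * L + 6 * L ^ 2) / (12 * (R - L) * (2 * R - L) ^ 3) * R2 ^ 2
          - L * R / (3 * (2 * R - L) ^ 2) * R4) * (L * (1 - c))) := by
  have e1 : 2 * R - L = L * (1 - c) / (1 + c) := by
    rw [hR]
    field_simp
    ring
  have e2 : R - L = -(L * c) / (1 + c) := by
    rw [hR]
    field_simp
    ring
  rw [e1, e2, hR4, hR2, hR]
  simp only [twistTwo, quarticParam, sexticParam]
  field_simp
  ring

namespace IsWall

variable {a : ℝ → ℝ} {ε k₀ k₁ k₂ : ℝ}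

theorem radius_zero (ha : IsWall a ε k₀ k₁ k₂) : radius a ε 0 = 1 / (2 * k₀) := by
  have h0 : arcParam a ε 0 = 0 := by
    have := ha.arcParam_arcLength ha.zero_mem
    rwa [arcLength_zero] at this
  rw [radius, h0, ha.deriv_deriv_zero, speed, ha.deriv_zero]
  norm_num

end IsWall

theorem exp_neg_arccos_mul_I {c : ℝ} (h₁ : -1 ≤ c) (h₂ : c ≤ 1) :
    Complex.exp (((-Real.arccos c : ℝ) : ℂ) * Complex.I) =
      (c : ℂ) - Complex.I * (√(1 - c ^ 2) : ℝ) := by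
  rw [Complex.exp_mul_I, ← Complex.ofReal_cos, ← Complex.ofReal_sin, Real.cos_neg, Real.sin_neg,
    Real.cos_arccos h₁ h₂, Real.sin_arccos]
  push_cast
  ring

theorem eigenvalue_eq {L R c : ℝ} (hc : L / R = 1 + c) :
    eigenvalue L R = (c : ℂ) - Complex.I * (√(1 - c ^ 2) : ℝ) := by
  have h : L * (2 / R - L / R ^ 2) = 1 - c ^ 2 := by
    rw [show L * (2 / R - L / R ^ 2) = 2 * (L / R) - (L / R) ^ 2 by ring, hc]
    ring
  rw [eigenvalue, h, hc, add_sub_cancel_left]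

/-- Points of the unit circle with real part `±1/2` are sixth roots of unity. -/
theorem pow_six_eq_one {c q : ℝ} (hq : q ^ 2 = 1 - c ^ 2) (h : 4 * c ^ 2 = 1) :
    ((c : ℂ) - Complex.I * q) ^ 6 = 1 := by
  have h1 : (q : ℂ) ^ 2 = 1 - (c : ℂ) ^ 2 := by exact_mod_cast congrArg Complex.ofReal hq
  have h2 : 4 * (c : ℂ) ^ 2 = 1 := by exact_mod_cast congrArg Complex.ofReal h
  have h3 : ((c : ℂ) - Complex.I * q) ^ 3 = 4 * (c : ℂ) ^ 2 * c - 3 * c := by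
    linear_combination (-3 * (c : ℂ) + Complex.I * q) * h1
      + (3 * (c : ℂ) * q ^ 2 - Complex.I * q ^ 3) * Complex.I_sq - Complex.I * q * h2
  rw [show 6 = 3 * 2 from rfl, pow_mul, h3]
  linear_combination (4 * (c : ℂ) ^ 4 - 5 * (c : ℂ) ^ 2 + 1) * h2

theorem pow_four_eq_one {q : ℝ} (hq : q ^ 2 = 1) : (-(Complex.I * q)) ^ 4 = 1 := by
  have h1 : (q : ℂ) ^ 2 = 1 := by exact_mod_cast congrArg Complex.ofReal hq
  linear_combination (q : ℂ) ^ 4 * Complex.I_pow_four + (q ^ 2 + 1) * h1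

/-- The powers with half-integer exponents in the second twist coefficient, in terms of
`√(D L)`. -/
theorem twistTwo_formula {L D q : ℝ} (hL : 0 < L) (hD : 0 < D) (hq : √(D * L) = q)
    (A₀ A₁ A₂ A₃ E₀ E₁ E₂ r₁ r₂ r₃ : ℝ) :
    A₀ / (E₀ * √(D * L)) - √L * A₁ / (E₁ * D ^ (3 / 2 : ℝ)) * r₁
        + L ^ (3 / 2 : ℝ) * A₂ / (E₂ * D ^ (5 / 2 : ℝ)) * r₂
        - L ^ (3 / 2 : ℝ) * A₃ / (3 * D ^ (3 / 2 : ℝ)) * r₃ =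
      A₀ / E₀ * (1 / q) + (-A₁ / (E₁ * D ^ 2) * r₁ + L * A₂ / (E₂ * D ^ 3) * r₂
        - L * A₃ / (3 * D ^ 2) * r₃) * q := by
  have hx := Real.sqrt_pos.2 hL
  have hy := Real.sqrt_pos.2 hD
  have e1 : L ^ (3 / 2 : ℝ) = √L ^ 3 := by
    rw [Real.sqrt_eq_rpow, ← Real.rpow_natCast, ← Real.rpow_mul hL.le]
    norm_num
  have e2 : D ^ (3 / 2 : ℝ) = √D ^ 3 := by
    rw [Real.sqrt_eq_rpow, ← Real.rpow_natCast, ← Real.rpow_mul hD.le]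
    norm_num
  have e3 : D ^ (5 / 2 : ℝ) = √D ^ 5 := by
    rw [Real.sqrt_eq_rpow, ← Real.rpow_natCast, ← Real.rpow_mul hD.le]
    norm_num
  have eL : L = √L ^ 2 := (Real.sq_sqrt hL.le).symm
  have eD : D = √D ^ 2 := (Real.sq_sqrt hD.le).symm
  rw [e1, e2, e3, ← hq, Real.sqrt_mul hD.le]
  generalize √L = x at *
  generalize √D = y at *
  subst eL eD
  have hx' := hx.ne'
  have hy' := hy.ne'
  rw [show A₀ / (E₀ * (y * x)) = A₀ / E₀ * (1 / (y * x)) by rw [← div_div, mul_one_div],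
    show x * A₁ / (E₁ * y ^ 3) = A₁ / (E₁ * (y ^ 2) ^ 2) * (y * x) by
      rw [← div_div, ← div_div]; field_simp,
    show x ^ 3 * A₂ / (E₂ * y ^ 5) = x ^ 2 * A₂ / (E₂ * (y ^ 2) ^ 3) * (y * x) by
      rw [← div_div, ← div_div]; field_simp,
    show x ^ 3 * A₃ / (3 * y ^ 3) = x ^ 2 * A₃ / (3 * (y ^ 2) ^ 2) * (y * x) by field_simp]
  ring

/-- Since the twist coefficient is the same for all normal forms, it can be read off from one. -/
theorem IsBirkhoffNormalForm.isTwistCoefficient_one {f : ℝ × ℝ → ℝ × ℝ}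
    {h : OpenPartialHomeomorph (ℝ × ℝ) (ℝ × ℝ)} {θ t : ℝ} {τ : ℕ → ℝ} {lam : ℂ}
    (hf : IsBirkhoffNormalForm f 1 h θ τ) (hlam : Complex.exp (θ * Complex.I) = lam)
    (h4 : lam ^ 4 ≠ 1) (ht : τ 1 = t) : IsTwistCoefficient f lam 1 t := by
  subst hlam ht
  exact ⟨⟨h, θ, τ, hf, rfl⟩, fun _ _ _ hf' => hf'.unique_one hf h4⟩

theorem IsBirkhoffNormalForm.isTwistCoefficient_two {f : ℝ × ℝ → ℝ × ℝ}
    {h : OpenPartialHomeomorph (ℝ × ℝ) (ℝ × ℝ)} {θ t : ℝ} {τ : ℕ → ℝ} {lam : ℂ}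
    (hf : IsBirkhoffNormalForm f 2 h θ τ) (hlam : Complex.exp (θ * Complex.I) = lam)
    (h4 : lam ^ 4 ≠ 1) (h6 : lam ^ 6 ≠ 1) (ht : τ 2 = t) : IsTwistCoefficient f lam 2 t := by
  subst hlam ht
  refine ⟨⟨h, θ, τ, hf, rfl⟩, fun _ _ _ hf' => hf'.unique_two hf h4 fun h3 => h6 ?_⟩
  rw [show 6 = 3 * 2 from rfl, pow_mul, h3, one_pow]

namespace IsWall

variable {a : ℝ → ℝ} {ε k₀ k₁ k₂ : ℝ}

theorem isTwistCoefficient_one (ha : IsWall a ε k₀ k₁ k₂) {L c R R2 : ℝ} (hL : 0 < L)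
    (hc : c ^ 2 < 1) (hk : k₀ * L = (1 + c) / 2) (hR : R = L / (1 + c))
    (hR2 : R2 = 6 * k₀ - 6 * k₁ / k₀ ^ 2) (h4 : eigenvalue L R ^ 4 ≠ 1) :
    IsTwistCoefficient (oneStep a L ε) (eigenvalue L R) 1
      (1 / (8 * R) - L / (8 * (2 * R - L)) * R2) := by
  obtain ⟨hc1, hc2⟩ := abs_lt.1 ((sq_lt_one_iff_abs_lt_one c).1 hc)
  have h₁ : 1 + c ≠ 0 := by linarith
  have h₂ : 1 - c ≠ 0 := by linarith
  have hq : 0 < √(1 - c ^ 2) := Real.sqrt_pos.2 (by linarith)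
  have hev : eigenvalue L R = _ := eigenvalue_eq (c := c) (by rw [hR]; field_simp)
  have hc0 : c ≠ 0 := fun h => h4 (by
    rw [hev, h, Complex.ofReal_zero, zero_sub]
    exact pow_four_eq_one (by norm_num))
  -- `b` is the amplitude for which the scaled quartic coefficient of the wall is the given one
  have hk₁ : k₁ * L ^ 3 = quarticParam
      ((k₁ * L ^ 3 - (1 / 2 * c ^ 4 + 1 / 2 * c ^ 3 - 1 / 4 * c ^ 2 + 1 / 4))
        / (-4 * c * ((1 + c) * (1 - c)))) c := by
    simp only [quarticParam]
    field_simp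
    ring
  generalize (k₁ * L ^ 3 - (1 / 2 * c ^ 4 + 1 / 2 * c ^ 3 - 1 / 4 * c ^ 2 + 1 / 4))
        / (-4 * c * ((1 + c) * (1 - c))) = b at hk₁
  have hκ : (√(L * √(1 - c ^ 2)))⁻¹ ^ 2 * (L * √(1 - c ^ 2)) = 1 := by
    rw [inv_pow, Real.sq_sqrt (by positivity), inv_mul_cancel₀ (by positivity)]
  obtain ⟨h, hh⟩ := ha.exists_normalForm_one (θ := -Real.arccos c) (s := -√(1 - c ^ 2)) hL hk hk₁
    (by rw [Real.cos_neg, Real.cos_arccos hc1.le hc2.le])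
    (by rw [Real.sin_neg, Real.sin_arccos]) (neg_ne_zero.2 hq.ne')
    (κ := (√(L * √(1 - c ^ 2)))⁻¹) (by rw [neg_neg, hκ])
  refine hh.isTwistCoefficient_one (by rw [hev, exp_neg_arccos_mul_I hc1.le hc2.le]) h4 ?_
  rw [← twistOne_eq (b := b) hL.ne' h₁ h₂ hR, inv_pow, Real.sq_sqrt (by positivity)]
  · field_simp
  · rw [← hk₁, hR2, show k₀ = (1 + c) / (2 * L) by field_simp; linarith]
    field_simp
    ring

theorem isTwistCoefficient_two (ha : IsWall a ε k₀ k₁ k₂) {L c R R2 R4 : ℝ} (hL : 0 < L)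
    (hc : c ^ 2 < 1) (hk : k₀ * L = (1 + c) / 2) (hR : R = L / (1 + c))
    (hR2 : R2 = 6 * k₀ - 6 * k₁ / k₀ ^ 2)
    (hR4 : R4 = -24 * k₀ ^ 3 - 48 * k₁ + 432 * k₁ ^ 2 / k₀ ^ 3 - 180 * k₂ / k₀ ^ 2)
    (h4 : eigenvalue L R ^ 4 ≠ 1) (h6 : eigenvalue L R ^ 6 ≠ 1) :
    IsTwistCoefficient (oneStep a L ε) (eigenvalue L R) 2
      (1 / 64 *
        (3 * (7 * R ^ 2 - 8 * R * L + 2 * L ^ 2) / (4 * R ^ 2 * (R - L) * √((2 * R - L) * L))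
          - √L * (27 * R ^ 2 - 40 * R * L + 10 * L ^ 2) /
            (6 * R * (R - L) * (2 * R - L) ^ (3 / 2 : ℝ)) * R2
          + L ^ (3 / 2 : ℝ) * (31 * R ^ 2 - 36 * R * L + 6 * L ^ 2) /
            (12 * (R - L) * (2 * R - L) ^ (5 / 2 : ℝ)) * R2 ^ 2
          - L ^ (3 / 2 : ℝ) * R / (3 * (2 * R - L) ^ (3 / 2 : ℝ)) * R4)) := by
  obtain ⟨hc1, hc2⟩ := abs_lt.1 ((sq_lt_one_iff_abs_lt_one c).1 hc)
  have h₁ : 1 + c ≠ 0 := by linarith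
  have h₂ : 1 - c ≠ 0 := by linarith
  have hq : 0 < √(1 - c ^ 2) := Real.sqrt_pos.2 (by linarith)
  have hq2 : √(1 - c ^ 2) ^ 2 = 1 - c ^ 2 := Real.sq_sqrt (by linarith)
  have hev : eigenvalue L R = _ := eigenvalue_eq (c := c) (by rw [hR]; field_simp)
  have hc0 : c ≠ 0 := fun h => h4 (by
    rw [hev, h, Complex.ofReal_zero, zero_sub]
    exact pow_four_eq_one (by norm_num))
  have hc3 : 1 - 4 * c ^ 2 ≠ 0 := fun h => h6 (by
    rw [hev]
    exact pow_six_eq_one hq2 (by linarith))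
  -- `b` and `C` are the amplitudes for which the scaled coefficients of the wall are the given ones
  have hk₁ : k₁ * L ^ 3 = quarticParam
      ((k₁ * L ^ 3 - (1 / 2 * c ^ 4 + 1 / 2 * c ^ 3 - 1 / 4 * c ^ 2 + 1 / 4))
        / (-4 * c * ((1 + c) * (1 - c)))) c := by
    simp only [quarticParam]
    field_simp
    ring
  generalize (k₁ * L ^ 3 - (1 / 2 * c ^ 4 + 1 / 2 * c ^ 3 - 1 / 4 * c ^ 2 + 1 / 4))
        / (-4 * c * ((1 + c) * (1 - c))) = b at hk₁
  have hk₂ : k₂ * L ^ 5 = sexticParam b ((k₂ * L ^ 5 - sexticParam b 0 c)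
        / (32 / 3 * c * ((1 + c) * (1 - c)) * (1 - 4 * c ^ 2))) c := by
    have h (C : ℝ) : sexticParam b C c = sexticParam b 0 c
        + C * (32 / 3 * c * ((1 + c) * (1 - c)) * (1 - 4 * c ^ 2)) := by
      simp only [sexticParam]
      ring
    rw [h, div_mul_cancel₀]
    · ring
    · positivity
  generalize (k₂ * L ^ 5 - sexticParam b 0 c)
        / (32 / 3 * c * ((1 + c) * (1 - c)) * (1 - 4 * c ^ 2)) = C at hk₂
  have hκ : (√(L * √(1 - c ^ 2)))⁻¹ ^ 2 = (L * √(1 - c ^ 2))⁻¹ := by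
    rw [inv_pow, Real.sq_sqrt (by positivity)]
  obtain ⟨h, hh⟩ := ha.exists_normalForm_two (θ := -Real.arccos c) (s := -√(1 - c ^ 2)) hL hk hk₁
    hk₂ (by rw [Real.cos_neg, Real.cos_arccos hc1.le hc2.le])
    (by rw [Real.sin_neg, Real.sin_arccos]) (neg_ne_zero.2 hq.ne')
    (κ := (√(L * √(1 - c ^ 2)))⁻¹)
    (by rw [neg_neg, hκ, inv_mul_cancel₀ (by positivity)])
  refine hh.isTwistCoefficient_two (by rw [hev, exp_neg_arccos_mul_I hc1.le hc2.le]) h4 h6 ?_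
  have hk₀ : k₀ = (1 + c) / (2 * L) := by
    field_simp
    linarith
  have hk₁' : k₁ = quarticParam b c / L ^ 3 := by
    rw [← hk₁]
    field_simp
  have hk₂' : k₂ = sexticParam b C c / L ^ 5 := by
    rw [← hk₂]
    field_simp
  have key := twistTwo_eq (b := b) (C := C) (R2 := R2) (R4 := R4) hL.ne' h₁ h₂ hc0 hR
    (by rw [hR2, hk₀, hk₁']; field_simp; ring)
    (by rw [hR4, hk₀, hk₁', hk₂']; field_simp; ring)
  have hD : 2 * R - L = L * (1 - c) / (1 + c) := by
    rw [hR]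
    field_simp
    ring
  have hp1 : 0 < 1 + c := by linarith
  have hp2 : 0 < 1 - c := by linarith
  have hDpos : 0 < 2 * R - L := by
    rw [hD]
    positivity
  have hsq : √((2 * R - L) * L) = L * √(1 - c ^ 2) / (1 + c) := by
    rw [Real.sqrt_eq_iff_mul_self_eq (by positivity) (by positivity), hD, div_mul_div_comm,
      mul_mul_mul_comm, ← pow_two √(1 - c ^ 2), hq2]
    field_simp
    ring
  rw [twistTwo_formula hL hDpos hsq]
  generalize 3 * (7 * R ^ 2 - 8 * R * L + 2 * L ^ 2) / (4 * R ^ 2 * (R - L)) = A at key ⊢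
  generalize -(27 * R ^ 2 - 40 * R * L + 10 * L ^ 2) / (6 * R * (R - L) * (2 * R - L) ^ 2) * R2 +
    L * (31 * R ^ 2 - 36 * R * L + 6 * L ^ 2) / (12 * (R - L) * (2 * R - L) ^ 3) * R2 ^ 2 -
    L * R / (3 * (2 * R - L) ^ 2) * R4 = B at key ⊢
  change (if 2 = 1 then _ else -√(1 - c ^ 2) * twistTwo b C c * (√(L * √(1 - c ^ 2)))⁻¹ ^ 4) = _
  rw [if_neg (by norm_num), show 4 = 2 * 2 from rfl, pow_mul, hκ]
  generalize √(1 - c ^ 2) = q at hq hq2 ⊢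
  calc -q * twistTwo b C c * (L * q)⁻¹ ^ 2 = 1 / q * (-twistTwo b C c / L ^ 2) := by
        field_simp
    _ = 1 / 64 * (A * (1 / (L * q / (1 + c))) + B * (L * (1 - c) * (1 / q))) := by
        rw [key]
        field_simp
    _ = 1 / 64 * (A * (1 / (L * q / (1 + c))) + B * (L * q / (1 + c))) := by
        rw [show L * (1 - c) * (1 / q) = L * q / (1 + c) by
          field_simp
          linear_combination -hq2]

end IsWall

end SymmetricBilliard

end

theorem theorem1 (ε L : ℝ) (hε : 0 < ε) (hL : 0 < L) (coef : ℕ → ℝ) (a : ℝ → ℝ)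
    (ha : ∀ t ∈ Set.Ioo (-ε) ε, HasSum (fun n : ℕ => coef n * t ^ (2 * (n + 1))) (a t))
    (R R2 R4 : ℝ)
    (hR : R = SymmetricBilliard.radius a ε 0)
    (hR2 : R2 = iteratedDeriv 2 (SymmetricBilliard.radius a ε) 0)
    (hR4 : R4 = iteratedDeriv 4 (SymmetricBilliard.radius a ε) 0)
    (hpos : 0 < L / R) (hell : L / R < 2) :
    (∀ j : Fin 2, ∀ᶠ p in 𝓝 (0 : ℝ × ℝ),
      SymmetricBilliard.billiardMap a L ε (j, p) =
        (1 - j, SymmetricBilliard.oneStep a L ε p)) ∧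
    (SymmetricBilliard.eigenvalue L R ^ 4 ≠ 1 →
      SymmetricBilliard.IsTwistCoefficient (SymmetricBilliard.oneStep a L ε)
        (SymmetricBilliard.eigenvalue L R) 1
        (1 / (8 * R) - L / (8 * (2 * R - L)) * R2)) ∧
    (SymmetricBilliard.eigenvalue L R ^ 4 ≠ 1 → SymmetricBilliard.eigenvalue L R ^ 6 ≠ 1 →
      SymmetricBilliard.IsTwistCoefficient (SymmetricBilliard.oneStep a L ε)
        (SymmetricBilliard.eigenvalue L R) 2
        (1 / 64 *
          (3 * (7 * R ^ 2 - 8 * R * L + 2 * L ^ 2) /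
              (4 * R ^ 2 * (R - L) * √((2 * R - L) * L))
            - √L * (27 * R ^ 2 - 40 * R * L + 10 * L ^ 2) /
              (6 * R * (R - L) * (2 * R - L) ^ (3 / 2 : ℝ)) * R2
            + L ^ (3 / 2 : ℝ) * (31 * R ^ 2 - 36 * R * L + 6 * L ^ 2) /
              (12 * (R - L) * (2 * R - L) ^ (5 / 2 : ℝ)) * R2 ^ 2
            - L ^ (3 / 2 : ℝ) * R / (3 * (2 * R - L) ^ (3 / 2 : ℝ)) * R4))) := by
  have hw := SymmetricBilliard.isWall_of_hasSum hε ha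
  have hR₀ : 0 < R := (div_pos_iff_of_pos_left hL).1 hpos
  have hRk : R = 1 / (2 * coef 0) := hR.trans hw.radius_zero
  -- the wall is curved, since otherwise `R = 0` by the convention for division by zero
  have hk : coef 0 ≠ 0 := fun h => by
    rw [hRk, h] at hR₀
    norm_num at hR₀
  obtain ⟨-, h2, h4⟩ := hw.radius_derivs hk
  have hc : (L / R - 1) ^ 2 < 1 := by
    rw [sq_lt_one_iff_abs_lt_one, abs_lt]
    constructor <;> linarith
  have hk₀ : coef 0 * L = (1 + (L / R - 1)) / 2 := by
    rw [hRk]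
    field_simp
    ring
  have hRc : R = L / (1 + (L / R - 1)) := by
    rw [add_sub_cancel, div_div_cancel₀ hL.ne']
  exact ⟨hw.eventually_billiardMap_eq_oneStep hL,
    hw.isTwistCoefficient_one hL hc hk₀ hRc (hR2.trans h2),
    hw.isTwistCoefficient_two hL hc hk₀ hRc (hR2.trans h2) (hR4.trans h4)⟩
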